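/- Let $d\ge 2$ and let $\mathbb{H}^d$ be $d$-dimensional hyperbolic space of constant curvature $-1$, realised as the Poincaré ball $\{y\in\mathbb{R}^d:\|y\|<1\}$ with metric tensor $4\|dy\|^2/(1-\|y\|^2)^2$, origin $o$ and hyperbolic volume measure $\mathrm{d}x$. For $u,v\in\mathbb{H}^d$ let $t_{u,v}$ denote the hyperbolic translation along the geodesic through $u$ and $v$ that maps $u$ to $v$ (the identity if $u=v$). Let $\varphi:\mathbb{H}^d\times\mathbb{H}^d\to[0,1]$ be measurable with $\varphi(x,y)=\varphi(y,x)$ and $\varphi(t_{u,v}(x),t_{u,v}(y))=\varphi(x,y)$ for all $x,y,u,v\in\mathbb{H}^d$. For $\lambda>0$ let $\eta$ be a Poisson point process on $\mathbb{H}^d$ with intensity measure $\lambda\,\mathrm{d}x$, and let $\xi^o$ be the random graph with vertex set $\eta\cup\{o\}$ in which, given $\eta$, each pair of distinct vertices $u,v$ is joined by an edge independently with probability $\varphi(u,v)$. Let $\mathscr{C}(o,\xi^o)$ be the set of vertices connected to $o$ by a finite path in $\xi^o$ (including $o$), and put $$\chi(\lambda)=\mathbb{E}_\lambda\big[\#\mathscr{C}(o,\xi^o)\big],\qquad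 \theta(\lambda)=\mathbb{P}_\lambda\big(\#\mathscr{C}(o,\xi^o)=\infty\big),$$ $$\lambda_T=\inf\{\lambda>0:\chi(\lambda)=\infty\},\qquad \lambda_c=\inf\{\lambda>0:\theta(\lambda)>0\},$$ with $\inf\emptyset=\infty$. Then: - $\lambda_T<\infty$ if and only if $\int_{\mathbb{H}^d}\varphi(o,x)\,\mathrm{d}x>0$, and likewise $\lambda_c<\infty$ if and only if $\int_{\mathbb{H}^d}\varphi(o,x)\,\mathrm{d}x>0$; - $\lambda_T>0$ if and only if $\int_{\mathbb{H}^d}\varphi(o,x)\,\mathrm{d}x<\infty$, and likewise $\lambda_c>0$ if and only if $\int_{\mathbb{H}^d}\varphi(o,x)\,\mathrm{d}x<\infty$. -/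

import Mathlib

open MeasureTheory ProbabilityTheory
open scoped NNReal ENNReal

noncomputable section

namespace HypRCM

/-- The underlying set of the Poincaré ball model of `d`-dimensional hyperbolic space: the open
unit ball of `ℝ^d`. The metric inherited from `ℝ^d` is only used for the topology and the Borel
sets; the hyperbolic distance and volume are `hdist` and `hvol`. -/
abbrev HSpace (d : ℕ) : Type := Metric.ball (0 : EuclideanSpace ℝ (Fin d)) 1

variable {d : ℕ}

/-- The origin of the ball model. -/
def origin (d : ℕ) : HSpace d := ⟨0, Metric.mem_ball_self one_pos⟩

/-- Hyperbolic distance (curvature `-1`). -/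
def hdist (x y : HSpace d) : ℝ :=
  Real.arcosh (1 + 2 * ‖(x : EuclideanSpace ℝ (Fin d)) - y‖ ^ 2 /
    ((1 - ‖(x : EuclideanSpace ℝ (Fin d))‖ ^ 2) * (1 - ‖(y : EuclideanSpace ℝ (Fin d))‖ ^ 2)))

/-- Hyperbolic volume: the Riemannian volume of the metric tensor `4 ‖dy‖² / (1 - ‖y‖²)²`, that
is, Lebesgue measure on the ball with density `(2 / (1 - ‖y‖²)) ^ d`. -/
def hvol (d : ℕ) : Measure (HSpace d) :=
  (Measure.comap Subtype.val (volume : Measure (EuclideanSpace ℝ (Fin d)))).withDensity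
    fun y => ENNReal.ofReal ((2 / (1 - ‖(y : EuclideanSpace ℝ (Fin d))‖ ^ 2)) ^ d)

/-! ### Translation isometries -/

lemma mobius_den_pos {E : Type*} [NormedAddCommGroup E] [InnerProductSpace ℝ E] {a x : E}
    (ha : ‖a‖ < 1) (hx : ‖x‖ < 1) : 0 < 1 + 2 * inner ℝ a x + ‖a‖ ^ 2 * ‖x‖ ^ 2 := by
  have h1 : -(‖a‖ * ‖x‖) ≤ inner ℝ a x := (abs_le.1 (abs_real_inner_le_norm a x)).1
  have h2 : ‖a‖ * ‖x‖ < 1 := by nlinarith [norm_nonneg a, norm_nonneg x]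
  nlinarith [mul_pos (sub_pos.2 h2) (sub_pos.2 h2)]

lemma mobius_norm_lt {E : Type*} [NormedAddCommGroup E] [InnerProductSpace ℝ E] {a x : E}
    (ha : ‖a‖ < 1) (hx : ‖x‖ < 1) :
    ‖(1 + 2 * inner ℝ a x + ‖a‖ ^ 2 * ‖x‖ ^ 2)⁻¹ •
      ((1 + 2 * inner ℝ a x + ‖x‖ ^ 2) • a + (1 - ‖a‖ ^ 2) • x)‖ < 1 := by
  have hD := mobius_den_pos ha hx
  rw [norm_smul, norm_inv, Real.norm_of_nonneg hD.le, inv_mul_lt_one₀ hD]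
  refine lt_of_pow_lt_pow_left₀ 2 hD.le ?_
  rw [norm_add_sq_real, norm_smul, norm_smul, inner_smul_left, inner_smul_right, mul_pow, mul_pow,
    Real.norm_eq_abs, Real.norm_eq_abs, sq_abs, sq_abs]
  simp only [conj_trivial]
  have h1 : 0 < 1 - ‖a‖ ^ 2 := by nlinarith [norm_nonneg a]
  have h2 : 0 < 1 - ‖x‖ ^ 2 := by nlinarith [norm_nonneg x]
  nlinarith [mul_pos hD (mul_pos h1 h2)]

/-- The translation isometry `x ↦ a ⊕ x` of the ball (Möbius addition) along the diameter through
`a` that takes the origin to `a`. -/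
def mobiusAdd (a x : HSpace d) : HSpace d :=
  ⟨(1 + 2 * inner ℝ (a : EuclideanSpace ℝ (Fin d)) x +
      ‖(a : EuclideanSpace ℝ (Fin d))‖ ^ 2 * ‖(x : EuclideanSpace ℝ (Fin d))‖ ^ 2)⁻¹ •
    ((1 + 2 * inner ℝ (a : EuclideanSpace ℝ (Fin d)) x +
        ‖(x : EuclideanSpace ℝ (Fin d))‖ ^ 2) • (a : EuclideanSpace ℝ (Fin d)) +
      (1 - ‖(a : EuclideanSpace ℝ (Fin d))‖ ^ 2) • (x : EuclideanSpace ℝ (Fin d))),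
    mem_ball_zero_iff.2 (mobius_norm_lt (mem_ball_zero_iff.1 a.2) (mem_ball_zero_iff.1 x.2))⟩

/-- The antipodal point `-a`. -/
def antipode (a : HSpace d) : HSpace d :=
  ⟨-(a : EuclideanSpace ℝ (Fin d)), by
    rw [mem_ball_zero_iff, norm_neg]; exact mem_ball_zero_iff.1 a.2⟩

/-- The translation isometry `t_{u,v}` along the geodesic through `u` and `v` that maps `u` to `v`
(the identity if `u = v`). With `τ_u = mobiusAdd u`, whose inverse is `mobiusAdd (-u)`, and
`w = τ_u⁻¹ v`, it is the conjugate `τ_u ∘ τ_w ∘ τ_u⁻¹` of the translation of the origin to `w`. -/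
def translation (u v x : HSpace d) : HSpace d :=
  mobiusAdd u (mobiusAdd (mobiusAdd (antipode u) v) (mobiusAdd (antipode u) x))

/-- A connection function `φ : ℍ^d × ℍ^d → [0,1]`: measurable, symmetric, and invariant under
every translation isometry. -/
structure ConnectionFunction (d : ℕ) where
  /-- the connection probability of two points -/
  toFun : HSpace d → HSpace d → unitInterval
  measurable : Measurable (Function.uncurry toFun)
  symm : ∀ x y, toFun x y = toFun y x
  transl_inv : ∀ u v x y, toFun (translation u v x) (translation u v y) = toFun x y

/-- `∫ φ(o, x) dx`, with values in `[0, ∞]`. -/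
def ConnectionFunction.mass (φ : ConnectionFunction d) : ℝ≥0∞ :=
  ∫⁻ x, ENNReal.ofReal (φ.toFun (origin d) x) ∂(hvol d)

/-! ### The Poisson process and the random connection model

The Poisson process of intensity measure `lam • hvol` is built shell by shell: independently for
each `n`, the shell `shell d n` receives a Poisson number of points with mean
`lam * hvol (shell d n)`, and these are independent and uniformly distributed on the shell.
The point with label `(n, k)` is the `k`-th one of shell `n`. The label `none` is the added
vertex at the origin, so that the vertex set below is that of the Palm version `η ∪ {o}`. -/

/-- The half-open shell of points whose hyperbolic distance from the origin lies in `[n, n+1)`. -/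
def shell (d n : ℕ) : Set (HSpace d) :=
  {x | (n : ℝ) ≤ hdist (origin d) x ∧ hdist (origin d) x < n + 1}

/-- A sample: the number of points in each shell, the (candidate) positions of the points, and an
edge mark in `[0,1]` for every unordered pair of labels. -/
abbrev Sample (d : ℕ) : Type :=
  (ℕ → ℕ) × (ℕ × ℕ → HSpace d) × (Sym2 (Option (ℕ × ℕ)) → unitInterval)

/-- The law of the sample at intensity `lam`: independent Poisson numbers, independent uniform
positions in the shells, independent uniform edge marks. (For `d ≥ 1` every shell has positive
finite volume, so all factors are probability measures.) -/
def law (d : ℕ) (lam : ℝ≥0) : Measure (Sample d) :=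
  (Measure.infinitePi fun n : ℕ => poissonMeasure (lam * (hvol d (shell d n)).toNNReal)).prod
    ((Measure.infinitePi fun p : ℕ × ℕ => ProbabilityTheory.cond (hvol d) (shell d p.1)).prod
      (Measure.infinitePi fun _ : Sym2 (Option (ℕ × ℕ)) => (volume : Measure unitInterval)))

/-- Position of the vertex with a given label. -/
def position (ω : Sample d) : Option (ℕ × ℕ) → HSpace d
  | none => origin d
  | some p => ω.2.1 p

/-- Whether a label is the label of a vertex of the sample. -/
def IsVertex (ω : Sample d) : Option (ℕ × ℕ) → Prop
  | none => True
  | some p => p.2 < ω.1 p.1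

/-- The random graph on the labels: two distinct vertices are joined if their edge mark is at most
the value of `φ` at their positions. Labels that are not vertices are isolated. -/
def graph (φ : ConnectionFunction d) (ω : Sample d) : SimpleGraph (Option (ℕ × ℕ)) where
  Adj i j := i ≠ j ∧ IsVertex ω i ∧ IsVertex ω j ∧
    ω.2.2 s(i, j) ≤ φ.toFun (position ω i) (position ω j)
  symm := ⟨fun i j h => ⟨h.1.symm, h.2.2.1, h.2.1, by
    rw [Sym2.eq_swap, φ.symm]; exact h.2.2.2⟩⟩
  loopless := ⟨fun _ h => h.1 rfl⟩

/-- The cluster of the origin: the set of points connected to it by a finite path. -/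
def cluster (φ : ConnectionFunction d) (ω : Sample d) : Set (HSpace d) :=
  {x | ∃ i, (graph φ ω).Reachable none i ∧ position ω i = x}

/-- The expected cluster size `χ(lam)`. -/
def chi (φ : ConnectionFunction d) (lam : ℝ≥0) : ℝ≥0∞ :=
  ∫⁻ ω, ((cluster φ ω).encard : ℝ≥0∞) ∂(law d lam)

/-- The percolation probability `θ(lam)`. -/
def theta (φ : ConnectionFunction d) (lam : ℝ≥0) : ℝ≥0∞ :=
  law d lam {ω | (cluster φ ω).Infinite}

/-- `λ_T = inf {lam > 0 : χ(lam) = ∞}`, equal to `∞` if there is no such `lam`. -/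
def lambdaT (φ : ConnectionFunction d) : ℝ≥0∞ :=
  ⨅ (lam : ℝ≥0) (_ : 0 < lam ∧ chi φ lam = ∞), (lam : ℝ≥0∞)

/-- `λ_c = inf {lam > 0 : θ(lam) > 0}`, equal to `∞` if there is no such `lam`. -/
def lambdaC (φ : ConnectionFunction d) : ℝ≥0∞ :=
  ⨅ (lam : ℝ≥0) (_ : 0 < lam ∧ 0 < theta φ lam), (lam : ℝ≥0∞)

end HypRCM

end

noncomputable section

namespace HypRCM

/-! ### Integration against infinite product measures, one coordinate at a time -/

section Product

variable {ι X : Type*} [DecidableEq ι] [MeasurableSpace X] (μ : ι → Measure X)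
  [∀ i, IsProbabilityMeasure (μ i)]

/-! Write m for `φ.mass`. Translations preserve hyperbolic volume and `φ`, so ∫ φ(x, z) dz = m for
every x (`lintegral_prob`). The theorem then follows from three facts about an intensity lam.

If lam · m < 1, the cluster has finite mean size. Every point of the cluster ends a self-avoiding
open path from the origin, and the expected number of such paths with k steps is at most (lam ·
m)^k: a self-avoiding path uses distinct, hence independent, edge marks, and the factorial moments
of the Poisson counts turn sums over distinct labels into integrals against lam · dx
(`lintegral_pathNumber_le`). The geometric series bounds χ and forces θ = 0. For m < ∞ this makes
both thresholds positive; for m = 0 it applies to every lam, so both thresholds are infinite.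

If m = ∞, then for every lam > 0 the neighbours of the origin form a Poisson process of infinite
mean. The void probabilities `law_rootIsolated` show that almost surely there are neighbours
arbitrarily far away, so both thresholds vanish.

If m > 0, some lam percolates. Choose a > 0 such that {φ(o, ·) ≥ a} has positive volume, and two
Lebesgue density points p, q of it on different diameters. Translates of a small cell along the two
axes have the property that any point of one cell is joined with probability at least a to most
points of the next. Any two points in cells two steps apart therefore have a uniformly positive
intensity of common neighbours in the cell between (`two_step_le`). Two steps are essential, since φ
may vanish at a given pair of points. High powers of the two translations play ping-pong, so all the
cells indexed by words of a free semigroup are disjoint (`exists_disjoint_pieces`). They carry a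
subdivided binary tree: even cells are to contain a representative vertex, odd cells a vertex
joining consecutive representatives.

Disjointness does not make the failures independent, because adjacent links share a representative.
Given the vertices in the representative cells, however, all other vertices are independent, which
gives an exponential bound for any finite set of simultaneous failures (`law_biInter_bad_le`). A
Peierls-type induction on the binary tree (`measure_treeFail_le`) needs only this joint bound, and
for lam large an infinite branch survives with positive probability. -/

lemma measurable_update_prod (p : ι) :
    Measurable fun q : (ι → X) × X => Function.update q.1 p q.2 := by
  refine measurable_pi_iff.2 fun i => ?_
  by_cases h : i = p
  · subst h; simpa using measurable_snd
  · simp only [Function.update_of_ne h]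
    exact (measurable_pi_apply i).comp measurable_fst

/-- Resampling one coordinate independently does not change a product measure; on a box this depends
only on whether `p` is among the constrained coordinates. It allows coordinates to be integrated one
at a time without splitting the index set. -/
lemma map_update_infinitePi (p : ι) :
    ((Measure.infinitePi μ).prod (μ p)).map (fun q => Function.update q.1 p q.2) =
      Measure.infinitePi μ := by
  refine Measure.eq_infinitePi _ fun s t ht => ?_
  rw [Measure.map_apply (measurable_update_prod p)
    (MeasurableSet.pi s.countable_toSet fun i _ => ht i)]
  by_cases hp : p ∈ s
  · have : (fun q : (ι → X) × X => Function.update q.1 p q.2) ⁻¹' (Set.pi s t) =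
        (Set.pi (s.erase p : Finset ι) t) ×ˢ t p := by
      ext q
      simp only [Set.mem_preimage, Set.mem_pi, Finset.mem_coe, Set.mem_prod, Finset.mem_erase]
      constructor
      · intro h
        refine ⟨fun i hi => ?_, by simpa using h p hp⟩
        simpa [Function.update_of_ne hi.1] using h i hi.2
      · rintro ⟨h1, h2⟩ i hi
        by_cases hip : i = p
        · subst hip; simpa using h2
        · simpa [Function.update_of_ne hip] using h1 i ⟨hip, hi⟩
    rw [this, Measure.prod_prod, Measure.infinitePi_pi _ (fun i _ => ht i),
      Finset.prod_erase_mul _ _ hp]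
  · have : (fun q : (ι → X) × X => Function.update q.1 p q.2) ⁻¹' (Set.pi s t) =
        (Set.pi s t) ×ˢ Set.univ := by
      ext q
      simp only [Set.mem_preimage, Set.mem_pi, Finset.mem_coe, Set.mem_prod, Set.mem_univ,
        and_true]
      refine forall₂_congr fun i hi => ?_
      rw [Function.update_of_ne (by rintro rfl; exact hp hi)]
    rw [this, Measure.prod_prod, Measure.infinitePi_pi _ (fun i _ => ht i), measure_univ, mul_one]

lemma lintegral_infinitePi_update (p : ι) {f : (ι → X) → ℝ≥0∞} (hf : Measurable f) :
    ∫⁻ ω, f ω ∂(Measure.infinitePi μ) =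
      ∫⁻ ω, ∫⁻ x, f (Function.update ω p x) ∂(μ p) ∂(Measure.infinitePi μ) := by
  conv_lhs => rw [← map_update_infinitePi μ p]
  rw [lintegral_map hf (measurable_update_prod p),
    lintegral_prod (fun q : (ι → X) × X => f (Function.update q.1 p q.2))
      (hf.comp (measurable_update_prod p)).aemeasurable]

lemma measurable_lintegral_update (p : ι)
    {f : (ι → X) → ℝ≥0∞} (hf : Measurable f) :
    Measurable fun ω => ∫⁻ x, f (Function.update ω p x) ∂(μ p) :=
  (hf.comp (measurable_update_prod p)).lintegral_prod_right'

/-- Factors which use disjoint coordinates can be integrated separately. -/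
lemma lintegral_mul_prod_update {κ : Type*} (A : Finset κ) (a : κ → ι)
    (ha : Set.InjOn a A) (f : κ → (ι → X) → ℝ≥0∞) (hf : ∀ p ∈ A, Measurable (f p))
    (Ψ : (ι → X) → ℝ≥0∞) (hΨ : Measurable Ψ)
    (hΨA : ∀ p ∈ A, ∀ ω x, Ψ (Function.update ω (a p) x) = Ψ ω)
    (hfA : ∀ p ∈ A, ∀ q ∈ A, p ≠ q → ∀ ω x, f p (Function.update ω (a q) x) = f p ω) :
    ∫⁻ ω, Ψ ω * ∏ p ∈ A, f p ω ∂(Measure.infinitePi μ) =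
      ∫⁻ ω, Ψ ω * ∏ p ∈ A, ∫⁻ x, f p (Function.update ω (a p) x) ∂(μ (a p))
        ∂(Measure.infinitePi μ) := by
  classical
  induction A using Finset.induction_on generalizing Ψ with
  | empty => simp
  | insert p A hp ih =>
    have hne : ∀ q ∈ A, p ≠ q := fun q hq h => hp (h ▸ hq)
    have hane : ∀ q ∈ A, a p ≠ a q := fun q hq h =>
      hne q hq (ha (by simp) (by simp [hq]) h)
    have hm : Measurable fun ω => ∏ q ∈ A, f q ω :=
      Finset.measurable_prod _ fun q hq => hf q (Finset.mem_insert_of_mem hq)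
    simp only [Finset.prod_insert hp, ← mul_assoc]
    rw [lintegral_infinitePi_update μ (a p) (f := fun ω => Ψ ω * f p ω * ∏ q ∈ A, f q ω)
      ((hΨ.mul (hf p (Finset.mem_insert_self _ _))).mul hm)]
    -- The induction hypothesis is used with the already integrated factor of `p` absorbed into `Ψ`;
    -- this factor still ignores the coordinates of the remaining indices.
    rw [← ih (ha.mono (by simp)) (fun q hq => hf q (Finset.mem_insert_of_mem hq))
      (fun ω => Ψ ω * ∫⁻ x, f p (Function.update ω (a p) x) ∂(μ (a p)))
      (hΨ.mul (measurable_lintegral_update μ _ (hf p (Finset.mem_insert_self _ _)))) ?_ ?_]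
    · refine lintegral_congr fun ω => ?_
      have h1 : ∀ x, Ψ (Function.update ω (a p) x) = Ψ ω :=
        hΨA p (Finset.mem_insert_self _ _) ω
      have h2 : ∀ x, ∏ q ∈ A, f q (Function.update ω (a p) x) = ∏ q ∈ A, f q ω := fun x =>
        Finset.prod_congr rfl fun q hq => hfA q (Finset.mem_insert_of_mem hq) p
          (Finset.mem_insert_self _ _) (hne q hq).symm ω x
      simp only [h1, h2]
      have h3 : Measurable fun x => f p (Function.update ω (a p) x) :=
        ((hf p (Finset.mem_insert_self _ _)).comp (measurable_update_prod (a p))).comp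
          measurable_prodMk_left
      rw [lintegral_mul_const _ (h3.const_mul _), lintegral_const_mul _ h3]
    · intro q hq ω x
      simp only [hΨA q (Finset.mem_insert_of_mem hq)]
      congr 1
      refine lintegral_congr fun y => ?_
      rw [Function.update_comm (hane q hq).symm]
      exact hfA p (Finset.mem_insert_self _ _) q (Finset.mem_insert_of_mem hq) (hne q hq) _ _
    · exact fun q hq r hr => hfA q (Finset.mem_insert_of_mem hq) r (Finset.mem_insert_of_mem hr)

/-- Independent coordinates: the integral of a product of functions of distinct coordinates. -/
lemma lintegral_prod_eval (A : Finset ι) (f : ι → X → ℝ≥0∞) (hf : ∀ p ∈ A, Measurable (f p)) :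
    ∫⁻ ω, ∏ p ∈ A, f p (ω p) ∂(Measure.infinitePi μ) = ∏ p ∈ A, ∫⁻ x, f p x ∂(μ p) := by
  have := lintegral_mul_prod_update μ A id (Function.injective_id.injOn)
    (fun p ω => f p (ω p)) (fun p hp => (hf p hp).comp (measurable_pi_apply p))
    (fun _ => 1) measurable_const (fun _ _ _ _ => rfl)
    (fun p _ q _ hpq ω x => by simp [Function.update_of_ne hpq])
  simpa using this

/-- Upper bound for an integral of a product in which one group of coordinates decides, through
membership in the sets `R p`, which coordinates it consists of. -/
lemma lintegral_prod_split_le (A : Finset ι) (R R' : ι → Set X)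
    (hR : ∀ p, MeasurableSet (R p)) (hR' : ∀ p, MeasurableSet (R' p))
    (x₀ : X) (G : ι → (ι → X) → X → ℝ≥0∞)
    (hG : ∀ p ∈ A, Measurable (Function.uncurry (G p)))
    (hGR : ∀ p ∈ A, ∀ ω ω' : ι → X, (∀ q ∈ A, ω q ∈ R q ∨ ω' q ∈ R q → ω q = ω' q) →
      G p ω = G p ω')
    (hx₀ : ∀ p ∈ A, x₀ ∉ R p)
    (c : ι → ℝ≥0∞) (hc : ∀ p ∈ A, ∀ ω, ∫⁻ x in (R p)ᶜ, G p ω x ∂(μ p) ≤ c p) :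
    ∫⁻ ω, ∏ p ∈ A, ((R p ∩ R' p).indicator 1 (ω p) + (R p)ᶜ.indicator (G p ω) (ω p))
      ∂(Measure.infinitePi μ) ≤ ∏ p ∈ A, (μ p (R p ∩ R' p) + c p) := by
  classical
  -- Expanding the product sums over the set `S` of coordinates that fall into their `R p`. For
  -- fixed `S` it is known which coordinates determine the functions `G p`.
  simp only [Finset.prod_add]
  have hmG : ∀ p ∈ A, ∀ g : (ι → X) → (ι → X), Measurable g →
      Measurable fun ω => (R p)ᶜ.indicator (G p (g ω)) (ω p) := by
    intro p hp g hg
    have : (fun ω : ι → X => (R p)ᶜ.indicator (G p (g ω)) (ω p)) =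
        ((fun ω : ι → X => ω p) ⁻¹' (R p)ᶜ).indicator
          (fun ω => Function.uncurry (G p) (g ω, ω p)) := by
      ext ω; simp [Set.indicator, Function.uncurry]
    rw [this]
    exact ((hG p hp).comp (hg.prodMk (measurable_pi_apply p))).indicator
      ((hR p).compl.preimage (measurable_pi_apply p))
  have hmR : ∀ p, Measurable fun ω : ι → X => (R p ∩ R' p).indicator (1 : X → ℝ≥0∞) (ω p) :=
    fun p => (measurable_one.indicator ((hR p).inter (hR' p))).comp (measurable_pi_apply p)
  rw [lintegral_finsetSum']
  swap
  · intro S _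
    refine ((Finset.measurable_prod _ fun p _ => hmR p).mul
      (Finset.measurable_prod _ fun p hp => ?_)).aemeasurable
    exact hmG p (Finset.mem_sdiff.1 hp).1 id measurable_id
  refine Finset.sum_le_sum fun S hS => ?_
  have hSA : S ⊆ A := Finset.mem_powerset.1 hS
  -- Coordinates off `S` are frozen at `x₀`, which lies in no `R p`. On the support of the term for
  -- `S` this does not change `G p`, and the factors off `S` then use disjoint coordinates.
  let g : (ι → X) → (ι → X) := fun ω q => if q ∈ S then ω q else x₀
  have hg : Measurable g := by
    refine measurable_pi_iff.2 fun q => ?_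
    by_cases hq : q ∈ S
    · simpa [g, hq] using measurable_pi_apply q
    · simp [g, hq]
  calc ∫⁻ ω, (∏ p ∈ S, (R p ∩ R' p).indicator 1 (ω p)) *
        ∏ p ∈ A \ S, (R p)ᶜ.indicator (G p ω) (ω p) ∂(Measure.infinitePi μ)
      ≤ ∫⁻ ω, (∏ p ∈ S, (R p ∩ R' p).indicator 1 (ω p)) *
        ∏ p ∈ A \ S, (R p)ᶜ.indicator (G p (g ω)) (ω p) ∂(Measure.infinitePi μ) := by
        refine lintegral_mono fun ω => ?_
        by_cases h1 : ∀ p ∈ S, ω p ∈ R p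
        · by_cases h2 : ∀ p ∈ A \ S, ω p ∉ R p
          · refine le_of_eq ?_
            congr 1
            refine Finset.prod_congr rfl fun p hp => ?_
            rw [hGR p (Finset.mem_sdiff.1 hp).1 ω (g ω)]
            intro q hq hqR
            by_cases hqS : q ∈ S
            · simp [g, hqS]
            · exfalso
              simp only [g, hqS, if_false] at hqR
              exact hqR.elim (h2 q (Finset.mem_sdiff.2 ⟨hq, hqS⟩)) (hx₀ q hq)
          · push Not at h2
            obtain ⟨p, hp, hpR⟩ := h2
            have : ∏ p ∈ A \ S, (R p)ᶜ.indicator (G p ω) (ω p) = 0 :=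
              Finset.prod_eq_zero hp (by simp [hpR])
            simp only [this, mul_zero, zero_le]
        · push Not at h1
          obtain ⟨p, hp, hpR⟩ := h1
          have : ∏ p ∈ S, (R p ∩ R' p).indicator (1 : X → ℝ≥0∞) (ω p) = 0 :=
            Finset.prod_eq_zero hp (by simp [hpR])
          simp only [this, zero_mul, zero_le]
    _ = ∫⁻ ω, (∏ p ∈ S, (R p ∩ R' p).indicator 1 (ω p)) *
        ∏ p ∈ A \ S, ∫⁻ x, (R p)ᶜ.indicator (G p (g ω)) x ∂(μ p)
          ∂(Measure.infinitePi μ) := by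
        have hgu : ∀ q ∉ S, ∀ ω x, g (Function.update ω q x) = g ω := by
          intro q hq ω x
          funext r
          by_cases hr : r ∈ S
          · have : r ≠ q := by rintro rfl; exact hq hr
            simp [g, hr, Function.update_of_ne this]
          · simp [g, hr]
        rw [lintegral_mul_prod_update μ (A \ S) id Function.injective_id.injOn
          (fun p ω => (R p)ᶜ.indicator (G p (g ω)) (ω p))]
        · refine lintegral_congr fun ω => ?_
          congr 1
          refine Finset.prod_congr rfl fun p hp => ?_
          simp only [id, hgu p (Finset.mem_sdiff.1 hp).2, Function.update_self]
        · exact fun p hp => hmG p (Finset.mem_sdiff.1 hp).1 g hg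
        · exact Finset.measurable_prod _ fun p _ => hmR p
        · intro q hq ω x
          refine Finset.prod_congr rfl fun p hp => ?_
          have : p ≠ q := by rintro rfl; exact (Finset.mem_sdiff.1 hq).2 hp
          simp [Function.update_of_ne this]
        · intro p hp q hq hpq ω x
          simp only [id, hgu q (Finset.mem_sdiff.1 hq).2, Function.update_of_ne hpq]
    _ ≤ ∫⁻ ω, (∏ p ∈ S, (R p ∩ R' p).indicator 1 (ω p)) * ∏ p ∈ A \ S, c p
          ∂(Measure.infinitePi μ) := by
        refine lintegral_mono fun ω => ?_
        gcongr with p hp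
        rw [lintegral_indicator (hR p).compl]
        exact hc p (Finset.mem_sdiff.1 hp).1 _
    _ = (∏ p ∈ S, μ p (R p ∩ R' p)) * ∏ p ∈ A \ S, c p := by
        rw [lintegral_mul_const _ (Finset.measurable_prod _ fun p _ => hmR p),
          lintegral_prod_eval μ S (fun p => (R p ∩ R' p).indicator 1)
            (fun p _ => measurable_one.indicator ((hR p).inter (hR' p)))]
        congr 1
        refine Finset.prod_congr rfl fun p _ => ?_
        rw [lintegral_indicator_one ((hR p).inter (hR' p))]

end Product

/-! ### Poisson moments -/

lemma lintegral_poissonMeasure (r : ℝ≥0) (f : ℕ → ℝ≥0∞) :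
    ∫⁻ n, f n ∂(poissonMeasure r) =
      ∑' n : ℕ, ENNReal.ofReal (Real.exp (-r) * r ^ n / n.factorial) * f n := by
  simp [poissonMeasure, lintegral_sum_measure]

/-- The probability generating function: a factor `t` for each of a Poisson number of points becomes
an exponential, which is the source of all void probabilities below. -/
lemma lintegral_pow_poissonMeasure (r : ℝ≥0) {t : ℝ} (ht : 0 ≤ t) :
    ∫⁻ n, ENNReal.ofReal t ^ n ∂(poissonMeasure r) =
      ENNReal.ofReal (Real.exp (-(r * (1 - t)))) := by
  have h : HasSum (fun n : ℕ => Real.exp (-r) * ((r * t) ^ n / n.factorial))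
      (Real.exp (-(r * (1 - t)))) := by
    have := (NormedSpace.expSeries_div_hasSum_exp ((r : ℝ) * t)).mul_left (Real.exp (-r))
    rw [← Real.exp_eq_exp_ℝ, ← Real.exp_add] at this
    rwa [show -((r : ℝ) * (1 - t)) = -r + r * t by ring]
  rw [lintegral_poissonMeasure, ← h.tsum_eq, ENNReal.ofReal_tsum_of_nonneg _ h.summable]
  · refine tsum_congr fun n => ?_
    rw [← ENNReal.ofReal_pow ht, ← ENNReal.ofReal_mul (by positivity)]
    congr 1
    rw [mul_pow]; ring
  · intro n; positivity

/-- The terms with n < k vanish, and shifting the index by k cancels the falling factorial against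
n!. Falling factorials count tuples of distinct points, so these moments play the role of the Mecke
formula. -/
lemma lintegral_descFactorial_poissonMeasure (r : ℝ≥0) (k : ℕ) :
    ∫⁻ n, (n.descFactorial k : ℝ≥0∞) ∂(poissonMeasure r) = (r : ℝ≥0∞) ^ k := by
  rw [lintegral_poissonMeasure, ← Summable.sum_add_tsum_nat_add' (k := k) ENNReal.summable]
  rw [Finset.sum_eq_zero]
  swap
  · intro n hn
    rw [Nat.descFactorial_eq_zero_iff_lt.2 (Finset.mem_range.1 hn)]; simp
  rw [zero_add]
  have h1 : ∀ n : ℕ, ENNReal.ofReal (Real.exp (-r) * r ^ (n + k) / (n + k).factorial) *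
      ((n + k).descFactorial k : ℝ≥0∞) =
      (r : ℝ≥0∞) ^ k * (ENNReal.ofReal (Real.exp (-r) * r ^ n / n.factorial) * 1) := by
    intro n
    rw [mul_one, ← ENNReal.ofReal_natCast, ← ENNReal.ofReal_mul (by positivity),
      ← ENNReal.ofReal_coe_nnreal, ← ENNReal.ofReal_pow (by positivity),
      ← ENNReal.ofReal_mul (by positivity)]
    congr 1
    have h2 : ((n + k).factorial : ℝ) = n.factorial * (n + k).descFactorial k := by
      rw [← Nat.factorial_mul_descFactorial (Nat.le_add_left k n)]
      push_cast
      simp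
    have h3 : (n.factorial : ℝ) ≠ 0 := by positivity
    have h4 : ((n + k).descFactorial k : ℝ) ≠ 0 := by
      have : (n + k).descFactorial k ≠ 0 := by
        rw [Ne, Nat.descFactorial_eq_zero_iff_lt]; omega
      exact_mod_cast this
    rw [h2]
    field_simp
    ring
  simp only [h1]
  rw [ENNReal.tsum_mul_left, ← lintegral_poissonMeasure r (fun _ => 1)]
  simp

end HypRCM

end

noncomputable section

namespace HypRCM

/-! ### Möbius addition in an inner product space -/

section Mobius

variable {E : Type*} [NormedAddCommGroup E] [InnerProductSpace ℝ E]

/-- The denominator of Möbius addition. -/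
def mobDen (a x : E) : ℝ := 1 + 2 * inner ℝ a x + ‖a‖ ^ 2 * ‖x‖ ^ 2

/-- Möbius addition on the ambient inner product space. -/
def mobVec (a x : E) : E :=
  (mobDen a x)⁻¹ • ((1 + 2 * inner ℝ a x + ‖x‖ ^ 2) • a + (1 - ‖a‖ ^ 2) • x)

lemma norm_sq_mobVec {a x : E} (h : mobDen a x ≠ 0) :
    ‖mobVec a x‖ ^ 2 = (‖a‖ ^ 2 + 2 * inner ℝ a x + ‖x‖ ^ 2) / mobDen a x := by
  rw [mobVec, norm_smul, mul_pow, norm_add_sq_real, norm_smul, norm_smul, inner_smul_left,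
    inner_smul_right, mul_pow, mul_pow]
  simp only [Real.norm_eq_abs, sq_abs, conj_trivial]
  unfold mobDen at *
  field_simp
  ring

lemma one_sub_norm_sq_mobVec {a x : E} (h : mobDen a x ≠ 0) :
    1 - ‖mobVec a x‖ ^ 2 = (1 - ‖a‖ ^ 2) * (1 - ‖x‖ ^ 2) / mobDen a x := by
  rw [norm_sq_mobVec h]
  unfold mobDen at *
  field_simp
  ring

lemma inner_mobVec_right {a x : E} (b : E) :
    inner ℝ b (mobVec a x) = ((1 + 2 * inner ℝ a x + ‖x‖ ^ 2) * inner ℝ b a +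
      (1 - ‖a‖ ^ 2) * inner ℝ b x) / mobDen a x := by
  rw [mobVec, inner_smul_right, inner_add_right, inner_smul_right, inner_smul_right]
  ring

/-- The exact distortion formula for Möbius addition. It yields invariance of `pointPair`,
conformality of the derivative and the displacement estimates. -/
lemma norm_sq_mobVec_sub {a x y : E} (hx : mobDen a x ≠ 0) (hy : mobDen a y ≠ 0) :
    ‖mobVec a x - mobVec a y‖ ^ 2 =
      (1 - ‖a‖ ^ 2) ^ 2 * ‖x - y‖ ^ 2 / (mobDen a x * mobDen a y) := by
  rw [norm_sub_sq_real, norm_sub_sq_real, norm_sq_mobVec hx, norm_sq_mobVec hy, inner_mobVec_right,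
    real_inner_comm a (mobVec a x), real_inner_comm y (mobVec a x), inner_mobVec_right,
    inner_mobVec_right, real_inner_self_eq_norm_sq, real_inner_comm a y, real_inner_comm x y]
  unfold mobDen at *
  field_simp
  ring

lemma mobVec_neg_cancel {a x : E} (ha : ‖a‖ < 1) (hx : ‖x‖ < 1) :
    mobVec (-a) (mobVec a x) = x := by
  have hD : mobDen a x ≠ 0 := (mobius_den_pos ha hx).ne'
  have hq : 1 - ‖a‖ ^ 2 ≠ 0 := by nlinarith [norm_nonneg a]
  have h1 : inner ℝ (-a) (mobVec a x) = -(((1 + 2 * inner ℝ a x + ‖x‖ ^ 2) * ‖a‖ ^ 2 +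
      (1 - ‖a‖ ^ 2) * inner ℝ a x) / mobDen a x) := by
    rw [inner_neg_left, inner_mobVec_right, real_inner_self_eq_norm_sq]
  have h2 : mobDen (-a) (mobVec a x) = (1 - ‖a‖ ^ 2) ^ 2 / mobDen a x := by
    rw [mobDen, h1, norm_neg, norm_sq_mobVec hD]
    field_simp
    rw [mobDen]
    ring
  have h3 : 1 + 2 * inner ℝ (-a) (mobVec a x) + ‖mobVec a x‖ ^ 2 =
      (1 - ‖a‖ ^ 2) * (1 + 2 * inner ℝ a x + ‖x‖ ^ 2) / mobDen a x := by
    rw [h1, norm_sq_mobVec hD]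
    field_simp
    rw [mobDen]
    ring
  rw [mobVec, h2, h3, norm_neg, mobVec]
  simp only [smul_add, smul_smul, smul_neg]
  match_scalars
  · field_simp
    ring
  · field_simp

lemma differentiableAt_mobVec {a x : E} (h : mobDen a x ≠ 0) :
    DifferentiableAt ℝ (mobVec a) x := by
  have h1 : DifferentiableAt ℝ (fun y : E => inner ℝ a y) x :=
    (differentiableAt_const a).inner ℝ differentiableAt_id
  have h2 : DifferentiableAt ℝ (fun y : E => ‖y‖ ^ 2) x := differentiableAt_id.norm_sq ℝ
  have h3 : DifferentiableAt ℝ (fun y : E => mobDen a y) x := by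
    unfold mobDen
    fun_prop
  have h4 : DifferentiableAt ℝ (fun y : E => (mobDen a y)⁻¹) x := h3.inv h
  unfold mobVec
  fun_prop

/-- Obtained by letting y tend to x along a line in `norm_sq_mobVec_sub`, so that no formula for the
derivative is needed. -/
lemma norm_fderiv_mobVec {a x : E} (ha : ‖a‖ < 1) (hx : ‖x‖ < 1) (v : E) :
    ‖fderiv ℝ (mobVec a) x v‖ = (1 - ‖a‖ ^ 2) / mobDen a x * ‖v‖ := by
  have hD : 0 < mobDen a x := mobius_den_pos ha hx
  have hq : 0 < 1 - ‖a‖ ^ 2 := by nlinarith [norm_nonneg a]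
  have hl : HasDerivAt (fun t : ℝ => x + t • v) v 0 := by
    simpa using ((hasDerivAt_id (0 : ℝ)).smul_const v).const_add x
  have hf : HasFDerivAt (mobVec a) (fderiv ℝ (mobVec a) x) (x + (0 : ℝ) • v) := by
    simpa using (differentiableAt_mobVec hD.ne').hasFDerivAt
  have hc := (hf.comp_hasDerivAt (0 : ℝ) hl).tendsto_slope_zero
  have hcn := (hc.norm.pow 2)
  have hDc : Continuous fun t : ℝ => mobDen a (x + t • v) := by
    unfold mobDen; fun_prop
  have hD0 : Filter.Tendsto (fun t : ℝ => mobDen a (x + t • v)) (nhdsWithin 0 {0}ᶜ)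
      (nhds (mobDen a x)) := by
    have := hDc.tendsto 0
    simp only [zero_smul, add_zero] at this
    exact this.mono_left nhdsWithin_le_nhds
  have h2 : Filter.Tendsto (fun t : ℝ => (1 - ‖a‖ ^ 2) ^ 2 * ‖v‖ ^ 2 /
      (mobDen a (x + t • v) * mobDen a x)) (nhdsWithin 0 {0}ᶜ)
      (nhds ((1 - ‖a‖ ^ 2) ^ 2 * ‖v‖ ^ 2 / (mobDen a x * mobDen a x))) :=
    tendsto_const_nhds.div (hD0.mul_const _) (by positivity)
  have h3 := tendsto_nhds_unique_of_eventuallyEq hcn h2 (by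
    filter_upwards [hD0.eventually_ne hD.ne', self_mem_nhdsWithin] with t ht ht0
    have ht0 : t ≠ 0 := ht0
    simp only [Function.comp, zero_add, zero_smul, add_zero]
    rw [norm_smul, mul_pow, norm_sq_mobVec_sub ht hD.ne', add_sub_cancel_left, norm_smul,
      norm_inv, mul_pow]
    simp only [Real.norm_eq_abs, inv_pow, sq_abs]
    field_simp)
  have h4 : (1 - ‖a‖ ^ 2) ^ 2 * ‖v‖ ^ 2 / (mobDen a x * mobDen a x) =
      ((1 - ‖a‖ ^ 2) / mobDen a x * ‖v‖) ^ 2 := by field_simp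
  rw [h4] at h3
  exact (pow_left_inj₀ (norm_nonneg _) (by positivity) two_ne_zero).1 h3

end Mobius

/-- Such a map is onto and takes the unit ball to the ball of radius `c`; comparing the two volumes
gives the determinant. -/
lemma abs_det_eq_of_norm_eq {d : ℕ} (A : EuclideanSpace ℝ (Fin d) →L[ℝ] EuclideanSpace ℝ (Fin d))
    {c : ℝ} (hc : 0 < c) (h : ∀ v, ‖A v‖ = c * ‖v‖) : |A.det| = c ^ d := by
  have hinj : Function.Injective (A : EuclideanSpace ℝ (Fin d) →ₗ[ℝ] EuclideanSpace ℝ (Fin d)) := by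
    rw [← LinearMap.ker_eq_bot, LinearMap.ker_eq_bot']
    intro v hv
    have : ‖A v‖ = 0 := by simpa using hv
    rw [h, mul_eq_zero] at this
    exact norm_eq_zero.1 (this.resolve_left hc.ne')
  have hsurj := LinearMap.surjective_of_injective hinj
  have himg : A '' Metric.ball 0 1 = Metric.ball 0 (c * 1) := by
    ext y
    simp only [Set.mem_image, mem_ball_zero_iff, mul_one]
    constructor
    · rintro ⟨x, hx, rfl⟩
      rw [h]; nlinarith
    · intro hy
      obtain ⟨x, rfl⟩ := hsurj y
      refine ⟨x, ?_, rfl⟩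
      have : ‖A x‖ < c := hy
      rw [h] at this
      nlinarith
  have h1 := Measure.addHaar_image_continuousLinearMap
    (volume : Measure (EuclideanSpace ℝ (Fin d))) A (Metric.ball 0 1)
  rw [himg, Measure.addHaar_ball_mul_of_pos _ _ hc, finrank_euclideanSpace, Fintype.card_fin] at h1
  have h2 : volume (Metric.ball (0 : EuclideanSpace ℝ (Fin d)) 1) ≠ 0 :=
    (Metric.measure_ball_pos _ _ one_pos).ne'
  have h3 : volume (Metric.ball (0 : EuclideanSpace ℝ (Fin d)) 1) ≠ ⊤ := measure_ball_lt_top.ne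
  have h4 := (ENNReal.mul_left_inj h2 h3).1 h1
  exact ((ENNReal.ofReal_eq_ofReal_iff (by positivity) (abs_nonneg _)).1 h4).symm

/-! ### Translations of the ball model -/

variable {d : ℕ}

lemma norm_coe_lt (x : HSpace d) : ‖(x : EuclideanSpace ℝ (Fin d))‖ < 1 :=
  mem_ball_zero_iff.1 x.2

lemma one_sub_norm_sq_pos (x : HSpace d) : 0 < 1 - ‖(x : EuclideanSpace ℝ (Fin d))‖ ^ 2 := by
  nlinarith [norm_coe_lt x, norm_nonneg (x : EuclideanSpace ℝ (Fin d))]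

lemma mobDen_pos (a x : HSpace d) : 0 < mobDen (a : EuclideanSpace ℝ (Fin d)) x :=
  mobius_den_pos (norm_coe_lt a) (norm_coe_lt x)

lemma coe_mobiusAdd (a x : HSpace d) :
    (mobiusAdd a x : EuclideanSpace ℝ (Fin d)) = mobVec (a : EuclideanSpace ℝ (Fin d)) x := rfl

@[simp] lemma coe_origin : ((origin d : HSpace d) : EuclideanSpace ℝ (Fin d)) = 0 := rfl

@[simp] lemma coe_antipode (a : HSpace d) :
    (antipode a : EuclideanSpace ℝ (Fin d)) = -(a : EuclideanSpace ℝ (Fin d)) := rfl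

@[simp] lemma antipode_antipode (a : HSpace d) : antipode (antipode a) = a := by
  ext1; simp

@[simp] lemma antipode_origin : antipode (origin d) = origin d := by
  ext1; simp

@[simp] lemma mobiusAdd_origin_left (x : HSpace d) : mobiusAdd (origin d) x = x := by
  ext1; simp [coe_mobiusAdd, mobVec, mobDen]

@[simp] lemma mobiusAdd_origin_right (x : HSpace d) : mobiusAdd x (origin d) = x := by
  ext1; simp [coe_mobiusAdd, mobVec, mobDen]

@[simp] lemma mobiusAdd_antipode_cancel (a x : HSpace d) :
    mobiusAdd (antipode a) (mobiusAdd a x) = x := by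
  ext1
  exact mobVec_neg_cancel (norm_coe_lt a) (norm_coe_lt x)

@[simp] lemma mobiusAdd_cancel_antipode (a x : HSpace d) :
    mobiusAdd a (mobiusAdd (antipode a) x) = x := by
  simpa using mobiusAdd_antipode_cancel (antipode a) x

lemma continuous_mobiusAdd (a : HSpace d) : Continuous (mobiusAdd a) := by
  refine Continuous.subtype_mk ?_ _
  have h : Continuous fun x : HSpace d => mobDen (a : EuclideanSpace ℝ (Fin d)) x := by
    unfold mobDen; fun_prop
  exact Continuous.smul (h.inv₀ fun x => (mobDen_pos a x).ne') (by fun_prop)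

/-- Möbius addition as a measurable equivalence. -/
def mobiusEquiv (a : HSpace d) : HSpace d ≃ᵐ HSpace d where
  toFun := mobiusAdd a
  invFun := mobiusAdd (antipode a)
  left_inv := mobiusAdd_antipode_cancel a
  right_inv := mobiusAdd_cancel_antipode a
  measurable_toFun := (continuous_mobiusAdd a).measurable
  measurable_invFun := (continuous_mobiusAdd _).measurable

lemma mobiusAdd_injective (a : HSpace d) : Function.Injective (mobiusAdd a) :=
  (mobiusEquiv a).injective

lemma one_sub_norm_sq_mobiusAdd (a x : HSpace d) :
    1 - ‖(mobiusAdd a x : EuclideanSpace ℝ (Fin d))‖ ^ 2 =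
      (1 - ‖(a : EuclideanSpace ℝ (Fin d))‖ ^ 2) * (1 - ‖(x : EuclideanSpace ℝ (Fin d))‖ ^ 2) /
        mobDen (a : EuclideanSpace ℝ (Fin d)) x :=
  one_sub_norm_sq_mobVec (mobDen_pos a x).ne'

/-- The function `‖x - y‖² / ((1 - ‖x‖²)(1 - ‖y‖²))`, an increasing function of the hyperbolic
distance. -/
def pointPair (x y : HSpace d) : ℝ :=
  ‖(x : EuclideanSpace ℝ (Fin d)) - y‖ ^ 2 /
    ((1 - ‖(x : EuclideanSpace ℝ (Fin d))‖ ^ 2) * (1 - ‖(y : EuclideanSpace ℝ (Fin d))‖ ^ 2))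

lemma pointPair_mobiusAdd (a x y : HSpace d) :
    pointPair (mobiusAdd a x) (mobiusAdd a y) = pointPair x y := by
  rw [pointPair, pointPair, one_sub_norm_sq_mobiusAdd, one_sub_norm_sq_mobiusAdd, coe_mobiusAdd,
    coe_mobiusAdd, norm_sq_mobVec_sub (mobDen_pos a x).ne' (mobDen_pos a y).ne']
  have h1 := mobDen_pos a x
  have h2 := mobDen_pos a y
  have h3 := one_sub_norm_sq_pos a
  have h4 := one_sub_norm_sq_pos x
  have h5 := one_sub_norm_sq_pos y
  field_simp

/-! ### Invariance of hyperbolic volume -/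

lemma indicator_one_congr {α β : Type*} {s : Set α} {t : Set β} {x : α} {y : β}
    (h : x ∈ s ↔ y ∈ t) : s.indicator (1 : α → ℝ≥0∞) x = t.indicator 1 y := by
  by_cases hx : x ∈ s
  · rw [Set.indicator_of_mem hx, Set.indicator_of_mem (h.1 hx)]; rfl
  · rw [Set.indicator_of_notMem hx, Set.indicator_of_notMem (mt h.2 hx)]

lemma lintegral_hvol {g : EuclideanSpace ℝ (Fin d) → ℝ≥0∞} (hg : Measurable g) :
    ∫⁻ x : HSpace d, g x ∂(hvol d) = ∫⁻ x in Metric.ball (0 : EuclideanSpace ℝ (Fin d)) 1,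
      ENNReal.ofReal ((2 / (1 - ‖x‖ ^ 2)) ^ d) * g x := by
  have hm : Measurable fun y : HSpace d =>
      ENNReal.ofReal ((2 / (1 - ‖(y : EuclideanSpace ℝ (Fin d))‖ ^ 2)) ^ d) := by fun_prop
  rw [hvol, lintegral_withDensity_eq_lintegral_mul _ hm
    (g := fun y : HSpace d => g y) (hg.comp measurable_subtype_coe),
    ← lintegral_subtype_comap measurableSet_ball]
  rfl

/-- Change of variables: the Jacobian is the d-th power of (1 - ‖a‖²) / `mobDen a x`, and by
`one_sub_norm_sq_mobVec` the density changes by exactly the inverse factor. -/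
lemma measurePreserving_mobiusAdd (a : HSpace d) :
    MeasurePreserving (mobiusAdd a) (hvol d) (hvol d) := by
  refine ⟨(continuous_mobiusAdd a).measurable, ?_⟩
  ext s hs
  rw [Measure.map_apply (continuous_mobiusAdd a).measurable hs]
  set B := Metric.ball (0 : EuclideanSpace ℝ (Fin d)) 1 with hB
  have hemb : MeasurableEmbedding (Subtype.val : HSpace d → EuclideanSpace ℝ (Fin d)) :=
    MeasurableEmbedding.subtype_coe measurableSet_ball
  have hind : ∀ t : Set (HSpace d), MeasurableSet t → hvol d t =
      ∫⁻ x in B, ENNReal.ofReal ((2 / (1 - ‖x‖ ^ 2)) ^ d) *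
        (Subtype.val '' t : Set (EuclideanSpace ℝ (Fin d))).indicator 1 x := by
    intro t ht
    rw [← lintegral_hvol (measurable_one.indicator (hemb.measurableSet_image.2 ht)),
      ← lintegral_indicator_one ht]
    refine lintegral_congr fun x => ?_
    have : (x : EuclideanSpace ℝ (Fin d)) ∈ (Subtype.val '' t : Set _) ↔ x ∈ t :=
      Subtype.val_injective.mem_set_image
    exact indicator_one_congr this.symm
  rw [hind s hs, hind _ (hs.preimage (continuous_mobiusAdd a).measurable)]
  have hinj : Set.InjOn (mobVec (a : EuclideanSpace ℝ (Fin d))) B := by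
    intro x hx y hy hxy
    have := mobiusAdd_injective a (a₁ := ⟨x, hx⟩) (a₂ := ⟨y, hy⟩) (Subtype.ext hxy)
    exact congrArg Subtype.val this
  have himg : mobVec (a : EuclideanSpace ℝ (Fin d)) '' B = B := by
    ext y
    constructor
    · rintro ⟨x, hx, rfl⟩
      exact (mobiusAdd a ⟨x, hx⟩).2
    · intro hy
      exact ⟨mobiusAdd (antipode a) ⟨y, hy⟩, (mobiusAdd (antipode a) ⟨y, hy⟩).2,
        congrArg Subtype.val (mobiusAdd_cancel_antipode a ⟨y, hy⟩)⟩
  have hcv := lintegral_image_eq_lintegral_abs_det_fderiv_mul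
    (volume : Measure (EuclideanSpace ℝ (Fin d))) (s := B) measurableSet_ball
    (f := mobVec (a : EuclideanSpace ℝ (Fin d))) (f' := fderiv ℝ (mobVec (a : EuclideanSpace ℝ (Fin d))))
    (fun x hx => (differentiableAt_mobVec (mobDen_pos a ⟨x, hx⟩).ne').hasFDerivAt.hasFDerivWithinAt)
    hinj (fun x => ENNReal.ofReal ((2 / (1 - ‖x‖ ^ 2)) ^ d) *
        (Subtype.val '' s : Set (EuclideanSpace ℝ (Fin d))).indicator 1 x)
  rw [himg] at hcv
  rw [hcv]
  refine setLIntegral_congr_fun measurableSet_ball fun x hx => ?_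
  have hD := mobDen_pos a ⟨x, hx⟩
  have ha := one_sub_norm_sq_pos a
  have hx' := one_sub_norm_sq_pos ⟨x, hx⟩
  simp only at hD hx'
  have hnx : ‖x‖ < 1 := mem_ball_zero_iff.1 hx
  rw [abs_det_eq_of_norm_eq _ (div_pos ha hD) (norm_fderiv_mobVec (norm_coe_lt a) hnx),
    one_sub_norm_sq_mobVec hD.ne', ← mul_assoc, ← ENNReal.ofReal_mul (by positivity), ← mul_pow]
  congr 1
  · congr 2
    field_simp
  · have : x ∈ (Subtype.val '' (mobiusAdd a ⁻¹' s) : Set (EuclideanSpace ℝ (Fin d))) ↔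
        mobVec (a : EuclideanSpace ℝ (Fin d)) x ∈ (Subtype.val '' s : Set _) := by
      constructor
      · rintro ⟨y, hy, rfl⟩
        exact ⟨_, hy, rfl⟩
      · rintro ⟨y, hy, hyx⟩
        refine ⟨⟨x, hx⟩, ?_, rfl⟩
        have : y = mobiusAdd a ⟨x, hx⟩ := Subtype.ext hyx
        rw [Set.mem_preimage, ← this]
        exact hy
    exact indicator_one_congr this

/-! ### Invariance of the connection function -/

namespace ConnectionFunction

variable (φ : ConnectionFunction d)

/-- The translation taking the origin to `a` is `mobiusAdd a` itself. These are the only instances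
of the invariance hypothesis that the proof uses. -/
lemma mobiusAdd_inv (a x y : HSpace d) :
    φ.toFun (mobiusAdd a x) (mobiusAdd a y) = φ.toFun x y := by
  simpa [translation] using φ.transl_inv (origin d) a x y

/-- The connection function with values in `[0, ∞]`. -/
def prob (x y : HSpace d) : ℝ≥0∞ := ENNReal.ofReal (φ.toFun x y)

lemma measurable_prob : Measurable (Function.uncurry φ.prob) :=
  (measurable_subtype_coe.comp φ.measurable).ennreal_ofReal

lemma measurable_prob_left (x : HSpace d) : Measurable (φ.prob x) :=
  φ.measurable_prob.comp measurable_prodMk_left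

lemma prob_le_one (x y : HSpace d) : φ.prob x y ≤ 1 := by
  rw [prob, ← ENNReal.ofReal_one]
  exact ENNReal.ofReal_le_ofReal (φ.toFun x y).2.2

lemma prob_symm (x y : HSpace d) : φ.prob x y = φ.prob y x := by
  rw [prob, φ.symm]; rfl

lemma prob_mobiusAdd (a x y : HSpace d) :
    φ.prob (mobiusAdd a x) (mobiusAdd a y) = φ.prob x y := by
  rw [prob, mobiusAdd_inv]; rfl

/-- The substitution z ↦ x ⊕ z moves `x` to the origin. This homogeneity makes each step of a path
cost the same factor, wherever the path has arrived. -/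
lemma lintegral_prob (x : HSpace d) : ∫⁻ z, φ.prob x z ∂(hvol d) = φ.mass := by
  rw [← (measurePreserving_mobiusAdd x).lintegral_comp (φ.measurable_prob_left x)]
  refine lintegral_congr fun z => ?_
  have := φ.prob_mobiusAdd x (origin d) z
  rwa [mobiusAdd_origin_right] at this

end ConnectionFunction

/-! ### Shells -/

lemma cosh_hdist_origin (y : HSpace d) :
    Real.cosh (hdist (origin d) y) = 2 / (1 - ‖(y : EuclideanSpace ℝ (Fin d))‖ ^ 2) - 1 := by
  have h := one_sub_norm_sq_pos y
  rw [hdist, Real.cosh_arcosh]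
  · simp only [coe_origin, zero_sub, norm_neg, norm_zero]
    field_simp
    ring
  · have : 0 ≤ 2 * ‖((origin d : HSpace d) : EuclideanSpace ℝ (Fin d)) - y‖ ^ 2 /
      ((1 - ‖((origin d : HSpace d) : EuclideanSpace ℝ (Fin d))‖ ^ 2) *
        (1 - ‖(y : EuclideanSpace ℝ (Fin d))‖ ^ 2)) :=
      div_nonneg (by positivity) (mul_pos (one_sub_norm_sq_pos _) h).le
    linarith

lemma hdist_origin_nonneg (y : HSpace d) : 0 ≤ hdist (origin d) y := by
  refine Real.arcosh_nonneg ?_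
  have : 0 ≤ 2 * ‖((origin d : HSpace d) : EuclideanSpace ℝ (Fin d)) - y‖ ^ 2 /
      ((1 - ‖((origin d : HSpace d) : EuclideanSpace ℝ (Fin d))‖ ^ 2) *
        (1 - ‖(y : EuclideanSpace ℝ (Fin d))‖ ^ 2)) :=
      div_nonneg (by positivity) (mul_pos (one_sub_norm_sq_pos _) (one_sub_norm_sq_pos y)).le
  linarith

lemma mem_shell_iff {n : ℕ} {y : HSpace d} : y ∈ shell d n ↔
    Real.cosh n ≤ 2 / (1 - ‖(y : EuclideanSpace ℝ (Fin d))‖ ^ 2) - 1 ∧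
      2 / (1 - ‖(y : EuclideanSpace ℝ (Fin d))‖ ^ 2) - 1 < Real.cosh (n + 1) := by
  rw [← cosh_hdist_origin, Real.cosh_le_cosh, Real.cosh_lt_cosh, abs_of_nonneg (Nat.cast_nonneg n),
    abs_of_nonneg (hdist_origin_nonneg y), abs_of_nonneg (by positivity : (0 : ℝ) ≤ n + 1)]
  rfl

lemma measurableSet_shell (n : ℕ) : MeasurableSet (shell d n) := by
  have h : Measurable fun y : HSpace d => 2 / (1 - ‖(y : EuclideanSpace ℝ (Fin d))‖ ^ 2) - 1 := by
    fun_prop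
  have : shell d n = (fun y : HSpace d => 2 / (1 - ‖(y : EuclideanSpace ℝ (Fin d))‖ ^ 2) - 1) ⁻¹'
      Set.Ico (Real.cosh n) (Real.cosh (n + 1)) := by
    ext y; exact mem_shell_iff
  rw [this]
  exact h measurableSet_Ico

lemma exists_mem_shell (y : HSpace d) : ∃ n, y ∈ shell d n :=
  ⟨⌊hdist (origin d) y⌋₊, Nat.floor_le (hdist_origin_nonneg y), Nat.lt_floor_add_one _⟩

lemma iUnion_shell : ⋃ n, shell d n = Set.univ :=
  Set.eq_univ_of_forall fun y => Set.mem_iUnion.2 (exists_mem_shell y)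

lemma eq_of_mem_shell {m n : ℕ} {y : HSpace d} (hm : y ∈ shell d m) (hn : y ∈ shell d n) :
    m = n := by
  have h1 : (m : ℝ) < n + 1 := hm.1.trans_lt hn.2
  have h2 : (n : ℝ) < m + 1 := hn.1.trans_lt hm.2
  have h1 : m < n + 1 := by exact_mod_cast h1
  have h2 : n < m + 1 := by exact_mod_cast h2
  omega

lemma pairwise_disjoint_shell : Pairwise (Function.onFun Disjoint (shell d)) := by
  intro m n hmn
  exact Set.disjoint_left.2 fun y hm hn => hmn (eq_of_mem_shell hm hn)

lemma hvol_shell_lt_top (n : ℕ) : hvol d (shell d n) < ⊤ := by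
  rw [hvol, withDensity_apply _ (measurableSet_shell n)]
  have hfin : Measure.comap Subtype.val (volume : Measure (EuclideanSpace ℝ (Fin d)))
      (shell d n) < ⊤ := by
    rw [(MeasurableEmbedding.subtype_coe measurableSet_ball).comap_apply]
    refine (measure_mono ?_).trans_lt (measure_ball_lt_top (x := (0 : EuclideanSpace ℝ (Fin d)))
      (r := 1))
    rintro _ ⟨y, _, rfl⟩
    exact y.2
  refine (setLIntegral_mono (measurable_const (a := ENNReal.ofReal ((Real.cosh (n + 1) + 1) ^ d)))
    fun y hy => ?_).trans_lt ?_
  · have := (mem_shell_iff.1 hy).2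
    have h := one_sub_norm_sq_pos y
    refine ENNReal.ofReal_le_ofReal (pow_le_pow_left₀ (by positivity) (by linarith) d)
  · rw [setLIntegral_const]
    exact ENNReal.mul_lt_top ENNReal.ofReal_lt_top hfin

lemma hvol_pos_of_isOpen {U : Set (HSpace d)} (hU : IsOpen U) (hne : U.Nonempty) :
    0 < hvol d U := by
  have hvm : MeasurableEmbedding (Subtype.val : HSpace d → EuclideanSpace ℝ (Fin d)) :=
    MeasurableEmbedding.subtype_coe measurableSet_ball
  rw [pos_iff_ne_zero, hvol, Ne, withDensity_apply_eq_zero (by fun_prop)]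
  have : {y : HSpace d | ENNReal.ofReal
      ((2 / (1 - ‖(y : EuclideanSpace ℝ (Fin d))‖ ^ 2)) ^ d) ≠ 0} = Set.univ := by
    refine Set.eq_univ_of_forall fun y => ?_
    have := one_sub_norm_sq_pos y
    simp only [Set.mem_ofPred_eq, ne_eq, ENNReal.ofReal_eq_zero, not_le]
    positivity
  rw [this, Set.univ_inter, hvm.comap_apply]
  exact ((Metric.isOpen_ball.isOpenMap_subtype_val U hU).measure_pos _ (hne.image _)).ne'

lemma hvol_shell_pos (hd : 1 ≤ d) (n : ℕ) : 0 < hvol d (shell d n) := by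
  have hc : Continuous fun y : HSpace d => 2 / (1 - ‖(y : EuclideanSpace ℝ (Fin d))‖ ^ 2) - 1 := by
    refine Continuous.sub (Continuous.div continuous_const (by fun_prop)
      fun y => (one_sub_norm_sq_pos y).ne') continuous_const
  let U : Set (HSpace d) := (fun y : HSpace d =>
    2 / (1 - ‖(y : EuclideanSpace ℝ (Fin d))‖ ^ 2) - 1) ⁻¹'
      Set.Ioo (Real.cosh n) (Real.cosh (n + 1))
  have hU : IsOpen U := isOpen_Ioo.preimage hc
  have hsub : U ⊆ shell d n := fun y hy => mem_shell_iff.2 ⟨hy.1.le, hy.2⟩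
  refine (hvol_pos_of_isOpen hU ?_).trans_le (measure_mono hsub)
  have hlt : Real.cosh n < Real.cosh (n + 1) := by
    rw [Real.cosh_lt_cosh, abs_of_nonneg (Nat.cast_nonneg n), abs_of_nonneg (by positivity)]
    linarith
  obtain ⟨c, hc1, hc2⟩ := exists_between hlt
  have hc0 : 1 < c := (Real.one_le_cosh _).trans_lt hc1
  -- At Euclidean norm `r` one has 2 / (1 - r²) - 1 = c, so a vector of this length along the first
  -- coordinate lies in `U`.
  set r : ℝ := Real.sqrt (1 - 2 / (c + 1)) with hr
  have h0 : 0 ≤ 1 - 2 / (c + 1) := by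
    rw [sub_nonneg, div_le_one (by linarith)]; linarith
  have hr2 : r ^ 2 = 1 - 2 / (c + 1) := Real.sq_sqrt h0
  have hr1 : r < 1 := by
    have : 0 < 2 / (c + 1) := by positivity
    nlinarith [Real.sqrt_nonneg (1 - 2 / (c + 1))]
  have hn : ‖EuclideanSpace.single (⟨0, hd⟩ : Fin d) r‖ = r := by
    rw [PiLp.norm_single, Real.norm_of_nonneg (Real.sqrt_nonneg _)]
  refine ⟨⟨EuclideanSpace.single ⟨0, hd⟩ r, by rw [mem_ball_zero_iff, hn]; exact hr1⟩, ?_⟩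
  have : 2 / (1 - ‖EuclideanSpace.single (⟨0, hd⟩ : Fin d) r‖ ^ 2) - 1 = c := by
    rw [hn, hr2]; field_simp; ring
  simp only [U, Set.mem_preimage, this]
  exact ⟨hc1, hc2⟩

end HypRCM

end

noncomputable section

namespace HypRCM

variable {d : ℕ}

/-! ### The law of the sample as an iterated integral -/

lemma isProbabilityMeasure_cond_shell (hd : 1 ≤ d) (n : ℕ) :
    IsProbabilityMeasure (ProbabilityTheory.cond (hvol d) (shell d n)) :=
  cond_isProbabilityMeasure_of_finite (hvol_shell_pos hd n).ne' (hvol_shell_lt_top n).ne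

/-- The expected number of points in a shell. -/
def shellMean (d : ℕ) (lam : ℝ≥0) (n : ℕ) : ℝ≥0 := lam * (hvol d (shell d n)).toNNReal

/-- The law of the counts. -/
def countLaw (d : ℕ) (lam : ℝ≥0) : Measure (ℕ → ℕ) :=
  Measure.infinitePi fun n : ℕ => poissonMeasure (shellMean d lam n)

/-- The law of the positions. -/
def posLaw (d : ℕ) : Measure (ℕ × ℕ → HSpace d) :=
  Measure.infinitePi fun p : ℕ × ℕ => ProbabilityTheory.cond (hvol d) (shell d p.1)

/-- The law of the edge marks. -/
def markLaw : Measure (Sym2 (Option (ℕ × ℕ)) → unitInterval) :=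
  Measure.infinitePi fun _ => volume

instance (lam : ℝ≥0) : IsProbabilityMeasure (countLaw d lam) := by
  unfold countLaw; infer_instance

instance : IsProbabilityMeasure markLaw := by
  unfold markLaw; infer_instance

instance : SFinite markLaw :=
  have : SigmaFinite markLaw := IsFiniteMeasure.toSigmaFinite _
  instSFiniteOfSigmaFinite

lemma isProbabilityMeasure_posLaw (hd : 1 ≤ d) : IsProbabilityMeasure (posLaw d) := by
  have := isProbabilityMeasure_cond_shell hd
  unfold posLaw; infer_instance

lemma isProbabilityMeasure_law (hd : 1 ≤ d) (lam : ℝ≥0) : IsProbabilityMeasure (law d lam) := by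
  have := isProbabilityMeasure_posLaw hd
  change IsProbabilityMeasure ((countLaw d lam).prod ((posLaw d).prod markLaw))
  infer_instance

lemma lintegral_law (hd : 1 ≤ d) (lam : ℝ≥0) {f : Sample d → ℝ≥0∞} (hf : Measurable f) :
    ∫⁻ ω, f ω ∂(law d lam) =
      ∫⁻ N, ∫⁻ X, ∫⁻ U, f (N, X, U) ∂markLaw ∂(posLaw d) ∂(countLaw d lam) := by
  have := isProbabilityMeasure_posLaw hd
  change ∫⁻ ω, f ω ∂((countLaw d lam).prod ((posLaw d).prod markLaw)) = _
  rw [lintegral_prod _ hf.aemeasurable]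
  refine lintegral_congr fun N => ?_
  have hN : Measurable fun q : (ℕ × ℕ → HSpace d) × (Sym2 (Option (ℕ × ℕ)) → unitInterval) =>
      f (N, q) := hf.comp measurable_prodMk_left
  rw [lintegral_prod _ hN.aemeasurable]

/-- The volume in the Poisson mean cancels the normalisation of the uniform law. In this form the
shell-by-shell construction recovers the intensity `lam • hvol`. -/
lemma shellMean_mul_lintegral (hd : 1 ≤ d) (lam : ℝ≥0) (n : ℕ) (f : HSpace d → ℝ≥0∞) :
    (shellMean d lam n : ℝ≥0∞) * ∫⁻ x, f x ∂(ProbabilityTheory.cond (hvol d) (shell d n)) =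
      lam * ∫⁻ x in shell d n, f x ∂(hvol d) := by
  have h1 := (hvol_shell_pos hd n).ne'
  have h2 := (hvol_shell_lt_top (d := d) n).ne
  rw [ProbabilityTheory.cond, lintegral_smul_measure, shellMean, ENNReal.coe_mul,
    ENNReal.coe_toNNReal h2, smul_eq_mul, mul_assoc, ← mul_assoc (hvol d (shell d n)),
    ENNReal.mul_inv_cancel h1 h2, one_mul]

lemma tsum_shellMean_mul_lintegral (hd : 1 ≤ d) (lam : ℝ≥0) (f : HSpace d → ℝ≥0∞) :
    ∑' n, (shellMean d lam n : ℝ≥0∞) *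
      ∫⁻ x, f x ∂(ProbabilityTheory.cond (hvol d) (shell d n)) = lam * ∫⁻ x, f x ∂(hvol d) := by
  simp_rw [shellMean_mul_lintegral hd, ENNReal.tsum_mul_left]
  rw [← lintegral_iUnion measurableSet_shell pairwise_disjoint_shell, iUnion_shell,
    Measure.restrict_univ]

lemma lintegral_mark_le (a : unitInterval) :
    ∫⁻ u : unitInterval, (if u ≤ a then 1 else 0) ∂volume = ENNReal.ofReal a := by
  have : (fun u : unitInterval => if u ≤ a then (1 : ℝ≥0∞) else 0) = (Set.Iic a).indicator 1 := by
    ext u; simp [Set.indicator]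
  rw [this, lintegral_indicator_one measurableSet_Iic, unitInterval.volume_Iic]

/-! ### Open self-avoiding label paths

A path from the root is a list of labels whose head is the vertex visited last. -/

/-- Position of an optional label. -/
def pos (X : ℕ × ℕ → HSpace d) (i : Option (ℕ × ℕ)) : HSpace d := i.elim (origin d) X

lemma position_eq_pos (ω : Sample d) (i : Option (ℕ × ℕ)) : position ω i = pos ω.2.1 i := by
  cases i <;> rfl

lemma measurable_pos (i : Option (ℕ × ℕ)) :
    Measurable fun X : ℕ × ℕ → HSpace d => pos X i := by
  cases i with
  | none => exact measurable_const
  | some p => exact measurable_pi_apply p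

/-- Indicator that all labels of the list are vertices and that the list has no repetition. -/
def vtxInd (N : ℕ → ℕ) : List (ℕ × ℕ) → ℝ≥0∞
  | [] => 1
  | p :: l => (if p.2 < N p.1 ∧ p ∉ l then 1 else 0) * vtxInd N l

/-- Indicator that consecutive labels of the path have an edge mark below the connection
probability. -/
def connInd (φ : ConnectionFunction d) (X : ℕ × ℕ → HSpace d)
    (U : Sym2 (Option (ℕ × ℕ)) → unitInterval) : List (ℕ × ℕ) → ℝ≥0∞
  | [] => 1
  | p :: l => (if U s(l.head?, some p) ≤ φ.toFun (pos X l.head?) (X p) then 1 else 0) *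
      connInd φ X U l

/-- The conditional probability of `connInd` given the positions. -/
def connProb (φ : ConnectionFunction d) (X : ℕ × ℕ → HSpace d) : List (ℕ × ℕ) → ℝ≥0∞
  | [] => 1
  | p :: l => φ.prob (pos X l.head?) (X p) * connProb φ X l

/-- The integral over the positions of a path visiting the given shells, with a test function at
the end point. -/
def shellKernel (φ : ConnectionFunction d) : List ℕ → (HSpace d → ℝ≥0∞) → ℝ≥0∞
  | [], g => g (origin d)
  | n :: s, g => shellKernel φ s fun x =>
      ∫⁻ z, φ.prob x z * g z ∂(ProbabilityTheory.cond (hvol d) (shell d n))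

/-- The walk runs towards the root, so that adding its first step adds the head of the label list.
The support clause is what turns the path property into the absence of repeated labels; the end `k`
is a variable with an equation so that induction on the walk applies. -/
lemma exists_path_of_walk (φ : ConnectionFunction d) (ω : Sample d) {i k : Option (ℕ × ℕ)}
    (w : (graph φ ω).Walk i k) (hk : k = none) (hw : w.IsPath) :
    ∃ l : List (ℕ × ℕ), vtxInd ω.1 l = 1 ∧ connInd φ ω.2.1 ω.2.2 l = 1 ∧ l.head? = i ∧
      ∀ q ∈ l, some q ∈ w.support := by
  induction w with
  | nil => exact ⟨[], rfl, rfl, hk.symm, by simp⟩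
  | @cons i j k h w ih =>
    rw [SimpleGraph.Walk.cons_isPath_iff] at hw
    obtain ⟨l, hv, hc, hl, hs⟩ := ih hk hw.1
    cases i with
    | none => exact absurd (hk ▸ w.end_mem_support) hw.2
    | some p =>
      have hp : p ∉ l := fun hpl => hw.2 (hs p hpl)
      obtain ⟨-, h1, -, h2⟩ := h
      refine ⟨p :: l, ?_, ?_, rfl, ?_⟩
      · have : p.2 < ω.1 p.1 := h1
        simp [vtxInd, hv, hp, this]
      · rw [connInd, hc, hl, if_pos, mul_one]
        rw [Sym2.eq_swap, φ.symm, ← position_eq_pos]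
        exact h2
      · intro q hq
        refine List.mem_cons.2 ?_
        rcases List.mem_cons.1 hq with rfl | hq
        · exact Or.inl rfl
        · exact Or.inr (hs q hq)

/-- Sending an open self-avoiding path to its end point covers the cluster. -/
lemma encard_cluster_le (φ : ConnectionFunction d) (ω : Sample d) :
    ((cluster φ ω).encard : ℝ≥0∞) ≤
      ∑' l : List (ℕ × ℕ), vtxInd ω.1 l * connInd φ ω.2.1 ω.2.2 l := by
  set S : Set (List (ℕ × ℕ)) := {l | vtxInd ω.1 l = 1 ∧ connInd φ ω.2.1 ω.2.2 l = 1} with hS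
  have hsub : cluster φ ω ⊆ (fun l : List (ℕ × ℕ) => position ω l.head?) '' S := by
    rintro x ⟨i, hi, rfl⟩
    obtain ⟨w, hw⟩ := hi.symm.exists_isPath
    obtain ⟨l, h1, h2, h3, -⟩ := exists_path_of_walk φ ω w rfl hw
    exact ⟨l, ⟨h1, h2⟩, by simp only [h3]⟩
  have h1 : (cluster φ ω).encard ≤ S.encard :=
    (Set.encard_le_encard hsub).trans (Set.encard_image_le _ _)
  calc ((cluster φ ω).encard : ℝ≥0∞) ≤ (S.encard : ℝ≥0∞) := by exact_mod_cast h1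
    _ = ∑' l, S.indicator (fun _ => (1 : ℝ≥0∞)) l := by
      rw [← ENNReal.tsum_set_one, tsum_subtype S (fun _ => (1 : ℝ≥0∞))]
    _ ≤ _ := by
      refine ENNReal.tsum_le_tsum fun l => ?_
      by_cases hl : l ∈ S
      · rw [Set.indicator_of_mem hl, hl.1, hl.2, one_mul]
      · rw [Set.indicator_of_notMem hl]; exact zero_le

lemma measurable_vtxInd (l : List (ℕ × ℕ)) : Measurable fun N : ℕ → ℕ => vtxInd N l := by
  induction l with
  | nil => exact measurable_const
  | cons p l ih =>
    refine Measurable.mul (Measurable.ite ?_ measurable_const measurable_const) ih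
    exact (measurableSet_lt measurable_const (measurable_pi_apply p.1)).inter
      (MeasurableSet.const _)

lemma measurable_connInd (φ : ConnectionFunction d) (l : List (ℕ × ℕ)) :
    Measurable fun q : (ℕ × ℕ → HSpace d) × (Sym2 (Option (ℕ × ℕ)) → unitInterval) =>
      connInd φ q.1 q.2 l := by
  induction l with
  | nil => exact measurable_const
  | cons p l ih =>
    refine Measurable.mul (Measurable.ite ?_ measurable_const measurable_const) ih
    refine measurableSet_le ((measurable_pi_apply _).comp measurable_snd) ?_
    exact φ.measurable.comp (((measurable_pos _).comp measurable_fst).prodMk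
      ((measurable_pi_apply p).comp measurable_fst))

lemma measurable_connInd_right (φ : ConnectionFunction d) (X : ℕ × ℕ → HSpace d)
    (l : List (ℕ × ℕ)) : Measurable fun U => connInd φ X U l :=
  (measurable_connInd φ l).comp measurable_prodMk_left

lemma measurable_connProb (φ : ConnectionFunction d) (l : List (ℕ × ℕ)) :
    Measurable fun X : ℕ × ℕ → HSpace d => connProb φ X l := by
  induction l with
  | nil => exact measurable_const
  | cons p l ih =>
    exact (φ.measurable_prob.comp ((measurable_pos _).prodMk (measurable_pi_apply p))).mul ih

lemma head?_eq_some_mem {α : Type*} {l : List α} {a : α} (h : l.head? = some a) : a ∈ l :=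
  List.mem_of_mem_head? h

/-- An edge containing a label not on the path is none of the edges of the path. This is where
self-avoidance gives independence of the marks. -/
lemma connInd_update (φ : ConnectionFunction d) (X : ℕ × ℕ → HSpace d)
    (U : Sym2 (Option (ℕ × ℕ)) → unitInterval) {p : ℕ × ℕ} {l : List (ℕ × ℕ)} (hp : p ∉ l)
    (i : Option (ℕ × ℕ)) (u : unitInterval) :
    connInd φ X (Function.update U s(i, some p) u) l = connInd φ X U l := by
  induction l with
  | nil => rfl
  | cons q l ih =>
    rw [List.mem_cons, not_or] at hp
    rw [connInd, connInd, ih hp.2, Function.update_of_ne]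
    rw [Ne, Sym2.eq_iff]
    rintro (⟨-, h⟩ | ⟨h, -⟩)
    · exact hp.1 (Option.some_injective _ h).symm
    · exact hp.2 (head?_eq_some_mem h)

lemma lintegral_connInd (φ : ConnectionFunction d) (X : ℕ × ℕ → HSpace d) {l : List (ℕ × ℕ)}
    (hl : l.Nodup) : ∫⁻ U, connInd φ X U l ∂markLaw = connProb φ X l := by
  induction l with
  | nil => simp [connInd, connProb]
  | cons p l ih =>
    rw [List.nodup_cons] at hl
    rw [markLaw, lintegral_infinitePi_update _ s(l.head?, some p)
      (measurable_connInd_right φ X (p :: l))]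
    simp only [connInd, connInd_update φ X _ hl.1, Function.update_self]
    have : ∀ U : Sym2 (Option (ℕ × ℕ)) → unitInterval,
        ∫⁻ u, (if u ≤ φ.toFun (pos X l.head?) (X p) then 1 else 0) * connInd φ X U l ∂volume =
          φ.prob (pos X l.head?) (X p) * connInd φ X U l := by
      intro U
      rw [lintegral_mul_const _ (Measurable.ite measurableSet_Iic measurable_const
        measurable_const), lintegral_mark_le]
      rfl
    simp only [this]
    rw [lintegral_const_mul _ (measurable_connInd_right φ X l)]
    rw [connProb, ← ih hl.2]
    rfl

lemma pos_update_of_notMem {X : ℕ × ℕ → HSpace d} {p : ℕ × ℕ} {l : List (ℕ × ℕ)} (hp : p ∉ l)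
    (x : HSpace d) : pos (Function.update X p x) l.head? = pos X l.head? := by
  cases h : l.head? with
  | none => rfl
  | some q =>
    have : q ≠ p := by rintro rfl; exact hp (head?_eq_some_mem h)
    simp [pos, Function.update_of_ne this]

lemma connProb_update (φ : ConnectionFunction d) (X : ℕ × ℕ → HSpace d) {p : ℕ × ℕ}
    {l : List (ℕ × ℕ)} (hp : p ∉ l) (x : HSpace d) :
    connProb φ (Function.update X p x) l = connProb φ X l := by
  induction l with
  | nil => rfl
  | cons q l ih =>
    rw [List.mem_cons, not_or] at hp
    rw [connProb, connProb, ih hp.2, pos_update_of_notMem hp.2, Function.update_of_ne]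
    exact fun h => hp.1 h.symm

lemma measurable_prob_mul (φ : ConnectionFunction d) (x : HSpace d)
    {g : HSpace d → ℝ≥0∞} (hg : Measurable g) : Measurable fun z => φ.prob x z * g z :=
  (φ.measurable_prob_left x).mul hg

lemma measurable_lintegral_prob (hd : 1 ≤ d) (φ : ConnectionFunction d) (n : ℕ)
    {g : HSpace d → ℝ≥0∞} (hg : Measurable g) :
    Measurable fun x => ∫⁻ z, φ.prob x z * g z ∂(ProbabilityTheory.cond (hvol d) (shell d n)) := by
  have := isProbabilityMeasure_cond_shell hd n
  exact Measurable.lintegral_prod_right' (f := fun q : HSpace d × HSpace d => φ.prob q.1 q.2 * g q.2)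
    (φ.measurable_prob.mul (hg.comp measurable_snd))

/-- The test function makes the induction work: integrating the position of the head replaces `g` by
x ↦ ∫ φ(x, z) g(z), to be evaluated at the previous vertex. -/
lemma lintegral_connProb (hd : 1 ≤ d) (φ : ConnectionFunction d) {l : List (ℕ × ℕ)}
    (hl : l.Nodup) {g : HSpace d → ℝ≥0∞} (hg : Measurable g) :
    ∫⁻ X, connProb φ X l * g (pos X l.head?) ∂(posLaw d) =
      shellKernel φ (l.map Prod.fst) g := by
  have := isProbabilityMeasure_cond_shell hd
  have := isProbabilityMeasure_posLaw hd
  induction l generalizing g with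
  | nil => simp [connProb, shellKernel, pos]
  | cons p l ih =>
    rw [List.nodup_cons] at hl
    rw [List.map_cons, shellKernel, ← ih hl.2 (measurable_lintegral_prob hd φ p.1 hg), posLaw,
      lintegral_infinitePi_update _ p
      (f := fun X => connProb φ X (p :: l) * g (pos X (p :: l).head?))
      ((measurable_connProb φ _).mul (hg.comp (measurable_pos _)))]
    refine lintegral_congr fun X => ?_
    simp only [connProb, List.head?_cons, connProb_update φ X hl.1, pos_update_of_notMem hl.1,
      Function.update_self]
    rw [← lintegral_const_mul _ (measurable_prob_mul φ _ hg)]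
    refine lintegral_congr fun x => ?_
    simp only [pos, Option.elim_some, Function.update_self]
    ring

lemma nodup_of_vtxInd_ne_zero {N : ℕ → ℕ} {l : List (ℕ × ℕ)} (h : vtxInd N l ≠ 0) :
    l.Nodup ∧ ∀ p ∈ l, p.2 < N p.1 := by
  induction l with
  | nil => simp
  | cons p l ih =>
    rw [vtxInd, mul_ne_zero_iff] at h
    obtain ⟨h1, h2⟩ := ih h.2
    have h3 : p.2 < N p.1 ∧ p ∉ l := by
      by_contra hc
      simp [hc] at h
    refine ⟨List.nodup_cons.2 ⟨h3.2, h1⟩, ?_⟩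
    rintro q hq
    rcases List.mem_cons.1 hq with rfl | hq
    · exact h3.1
    · exact h2 q hq

/-! ### Counting label paths -/

/-- The sum of a function over all lists of given length. -/
def listSum {α : Type*} (k : ℕ) (f : List α → ℝ≥0∞) : ℝ≥0∞ := ∑' v : List.Vector α k, f v.1

lemma tsum_list {α : Type*} (f : List α → ℝ≥0∞) : ∑' l, f l = ∑' k, listSum k f := by
  rw [← (Equiv.sigmaFiberEquiv (List.length (α := α))).tsum_eq f, ENNReal.tsum_sigma']
  rfl

@[simp] lemma listSum_zero {α : Type*} (f : List α → ℝ≥0∞) : listSum 0 f = f [] := by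
  rw [listSum, tsum_eq_single List.Vector.nil]
  · rfl
  · intro v hv; exact absurd (Subsingleton.elim _ _) hv

lemma listSum_succ {α : Type*} (k : ℕ) (f : List α → ℝ≥0∞) :
    listSum (k + 1) f = listSum k fun l => ∑' a, f (a :: l) := by
  let e : List.Vector α k × α ≃ List.Vector α (k + 1) :=
    { toFun := fun q => List.Vector.cons q.2 q.1
      invFun := fun v => (v.tail, v.head)
      left_inv := fun q => by simp
      right_inv := fun v => by simp }
  rw [listSum, ← e.tsum_eq, ENNReal.tsum_prod']
  rfl

lemma listSum_mono {α : Type*} {k : ℕ} {f g : List α → ℝ≥0∞} (h : ∀ l, f l ≤ g l) :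
    listSum k f ≤ listSum k g := ENNReal.tsum_le_tsum fun _ => h _

/-- The number of label lists without repetition that visit the given shells. -/
def pathCount (N : ℕ → ℕ) : List ℕ → ℕ
  | [] => 1
  | n :: s => (N n - s.count n) * pathCount N s

/-- A list without repetition uses exactly `count n` of the `N n` available labels of shell `n`, and
the remaining ones are free for the next step. -/
lemma tsum_fresh_le {N : ℕ → ℕ} {l : List (ℕ × ℕ)} (hl : l.Nodup) (hN : ∀ p ∈ l, p.2 < N p.1)
    (n : ℕ) : ∑' κ : ℕ, (if κ < N n ∧ (n, κ) ∉ l then (1 : ℝ≥0∞) else 0) ≤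
      ((N n - (l.map Prod.fst).count n : ℕ) : ℝ≥0∞) := by
  classical
  set T : Finset ℕ := ((l.filter fun p => p.1 = n).map Prod.snd).toFinset with hT
  have hmem : ∀ κ, κ ∈ T ↔ (n, κ) ∈ l := by
    intro κ
    simp only [hT, List.mem_toFinset, List.mem_map, List.mem_filter, decide_eq_true_eq]
    constructor
    · rintro ⟨⟨a, b⟩, ⟨h1, rfl⟩, rfl⟩; exact h1
    · exact fun h => ⟨_, ⟨h, rfl⟩, rfl⟩
  have hcard : T.card = (l.map Prod.fst).count n := by
    rw [hT, List.toFinset_card_of_nodup, List.length_map, List.count_eq_countP, List.countP_map,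
      List.countP_eq_length_filter]
    · congr 1
    · refine List.Nodup.map_on ?_ (hl.filter _)
      rintro ⟨a, b⟩ h1 ⟨a', b'⟩ h2 h
      simp only [List.mem_filter, decide_eq_true_eq] at h1 h2
      simp only at h
      rw [Prod.mk.injEq]
      exact ⟨h1.2.trans h2.2.symm, h⟩
  have hsub : T ⊆ Finset.range (N n) := fun κ hκ => Finset.mem_range.2 (hN _ ((hmem κ).1 hκ))
  have h1 : ∀ κ : ℕ, (if κ < N n ∧ (n, κ) ∉ l then (1 : ℝ≥0∞) else 0) =
      if κ ∈ Finset.range (N n) \ T then 1 else 0 := by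
    intro κ
    simp [hmem]
  simp only [h1]
  rw [tsum_eq_sum (s := Finset.range (N n) \ T) (fun κ hκ => by simp [hκ])]
  rw [Finset.sum_congr rfl (fun κ hκ => if_pos hκ)]
  simp [Finset.card_sdiff_of_subset hsub, hcard]

lemma listSum_vtxInd_le (N : ℕ → ℕ) (k : ℕ) (B : List ℕ → ℝ≥0∞) :
    listSum k (fun l => vtxInd N l * B (l.map Prod.fst)) ≤
      listSum k fun s => pathCount N s * B s := by
  induction k generalizing B with
  | zero => simp [vtxInd, pathCount]
  | succ k ih =>
    rw [listSum_succ, listSum_succ]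
    -- The choice of the new head is moved into the weight: a shell `n` together with the number of
    -- labels still unused there.
    have h := ih fun s => ∑' n, ((N n - s.count n : ℕ) : ℝ≥0∞) * B (n :: s)
    refine (listSum_mono fun l => ?_).trans (h.trans (listSum_mono fun s => ?_))
    · by_cases h0 : vtxInd N l = 0
      · simp [vtxInd, h0]
      obtain ⟨h1, h2⟩ := nodup_of_vtxInd_ne_zero h0
      simp only [vtxInd, List.map_cons]
      rw [ENNReal.tsum_prod', ← ENNReal.tsum_mul_left]
      refine ENNReal.tsum_le_tsum fun n => ?_
      simp only [mul_assoc]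
      rw [ENNReal.tsum_mul_right]
      calc _ ≤ ((N n - (l.map Prod.fst).count n : ℕ) : ℝ≥0∞) *
            (vtxInd N l * B (n :: l.map Prod.fst)) := by
            gcongr
            exact tsum_fresh_le h1 h2 n
        _ = _ := by ring
    · rw [← ENNReal.tsum_mul_left]
      refine ENNReal.tsum_le_tsum fun n => le_of_eq ?_
      rw [pathCount]
      push_cast
      ring

/-- Grouping the choices by shell produces one falling factorial per shell, so that independence of
the counts and Poisson factorial moments can be used. -/
lemma pathCount_eq_prod (N : ℕ → ℕ) (s : List ℕ) (S : Finset ℕ) (hS : ∀ n ∈ s, n ∈ S) :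
    pathCount N s = ∏ n ∈ S, (N n).descFactorial (s.count n) := by
  induction s with
  | nil => simp [pathCount]
  | cons n s ih =>
    rw [pathCount, ih fun m hm => hS m (List.mem_cons_of_mem _ hm)]
    have hn : n ∈ S := hS n List.mem_cons_self
    rw [← Finset.mul_prod_erase S _ hn, ← Finset.mul_prod_erase S _ hn, List.count_cons_self,
      Nat.descFactorial_succ, mul_assoc]
    congr 2
    refine Finset.prod_congr rfl fun m hm => ?_
    rw [List.count_cons_of_ne (Finset.ne_of_mem_erase hm).symm]

lemma measurable_pathCount (s : List ℕ) :
    Measurable fun N : ℕ → ℕ => (pathCount N s : ℝ≥0∞) := by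
  simp_rw [pathCount_eq_prod _ s s.toFinset fun n hn => List.mem_toFinset.2 hn]
  push_cast
  exact Finset.measurable_prod _ fun n _ =>
    (measurable_of_countable (fun m : ℕ => (m.descFactorial (s.count n) : ℝ≥0∞))).comp
      (measurable_pi_apply n)

lemma lintegral_pathCount (lam : ℝ≥0) (s : List ℕ) :
    ∫⁻ N, (pathCount N s : ℝ≥0∞) ∂(countLaw d lam) =
      (s.map fun n => (shellMean d lam n : ℝ≥0∞)).prod := by
  simp_rw [pathCount_eq_prod _ s s.toFinset fun n hn => List.mem_toFinset.2 hn]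
  push_cast
  rw [countLaw]
  refine (lintegral_prod_eval (fun n : ℕ => poissonMeasure (shellMean d lam n)) s.toFinset
    (fun n (m : ℕ) => (m.descFactorial (s.count n) : ℝ≥0∞))
    (fun _ _ => measurable_of_countable _)).trans ?_
  rw [Finset.prod_list_map_count]
  exact Finset.prod_congr rfl fun n _ => lintegral_descFactorial_poissonMeasure _ _

lemma shellKernel_const_mul (hd : 1 ≤ d) (φ : ConnectionFunction d) (s : List ℕ) (c : ℝ≥0∞)
    {g : HSpace d → ℝ≥0∞} (hg : Measurable g) :
    shellKernel φ s (fun x => c * g x) = c * shellKernel φ s g := by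
  induction s generalizing g with
  | nil => rfl
  | cons n s ih =>
    rw [shellKernel, shellKernel, ← ih (measurable_lintegral_prob hd φ n hg)]
    congr 1
    funext x
    rw [← lintegral_const_mul _ (measurable_prob_mul φ x hg)]
    refine lintegral_congr fun z => ?_
    ring

lemma shellKernel_tsum (hd : 1 ≤ d) (φ : ConnectionFunction d) (s : List ℕ)
    {g : ℕ → HSpace d → ℝ≥0∞} (hg : ∀ i, Measurable (g i)) :
    shellKernel φ s (fun x => ∑' i, g i x) = ∑' i, shellKernel φ s (g i) := by
  induction s generalizing g with
  | nil => rfl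
  | cons n s ih =>
    simp only [shellKernel]
    rw [← ih fun i => measurable_lintegral_prob hd φ n (hg i)]
    congr 1
    funext x
    rw [← lintegral_tsum fun i => (measurable_prob_mul φ x (hg i)).aemeasurable]
    refine lintegral_congr fun z => ?_
    rw [ENNReal.tsum_mul_left]

/-- Summed over the shell of the last vertex, the last step integrates to the constant `lam *
φ.mass`, irrespective of the previous vertex. -/
lemma tsum_shellMean_mul_shellKernel (hd : 1 ≤ d) (φ : ConnectionFunction d) (lam : ℝ≥0)
    (s : List ℕ) :
    ∑' n, (shellMean d lam n : ℝ≥0∞) * shellKernel φ (n :: s) 1 =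
      lam * φ.mass * shellKernel φ s 1 := by
  have h1 : ∀ n, Measurable fun x => (shellMean d lam n : ℝ≥0∞) *
      ∫⁻ z, φ.prob x z * 1 ∂(ProbabilityTheory.cond (hvol d) (shell d n)) := fun n =>
    (measurable_lintegral_prob hd φ n measurable_const).const_mul _
  calc _ = ∑' n, shellKernel φ s (fun x => (shellMean d lam n : ℝ≥0∞) *
      ∫⁻ z, φ.prob x z * 1 ∂(ProbabilityTheory.cond (hvol d) (shell d n))) :=
        tsum_congr fun n => (shellKernel_const_mul hd φ s _
          (measurable_lintegral_prob hd φ n measurable_const)).symm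
    _ = shellKernel φ s (fun x => (lam * φ.mass) * (1 : HSpace d → ℝ≥0∞) x) := by
      rw [← shellKernel_tsum hd φ s h1]
      congr 1
      funext x
      rw [tsum_shellMean_mul_lintegral hd]
      simp [φ.lintegral_prob]
    _ = _ := shellKernel_const_mul hd φ s _ measurable_one

lemma listSum_shellKernel (hd : 1 ≤ d) (φ : ConnectionFunction d) (lam : ℝ≥0) (k : ℕ) :
    listSum k (fun s => (s.map fun n => (shellMean d lam n : ℝ≥0∞)).prod * shellKernel φ s 1) =
      (lam * φ.mass) ^ k := by
  induction k with
  | zero => simp [shellKernel]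
  | succ k ih =>
    rw [listSum_succ, pow_succ', ← ih, listSum, listSum, ← ENNReal.tsum_mul_left]
    refine tsum_congr fun v => ?_
    simp only [List.map_cons, List.prod_cons]
    have h := tsum_shellMean_mul_shellKernel hd φ lam v.1
    calc _ = ∑' n, (v.1.map fun n => (shellMean d lam n : ℝ≥0∞)).prod *
          ((shellMean d lam n : ℝ≥0∞) * shellKernel φ (n :: v.1) 1) :=
          tsum_congr fun n => by ring
      _ = _ := by
          rw [ENNReal.tsum_mul_left, h]
          ring

/-! ### Subcritical bound -/

/-- The number of open label paths. -/
def pathNumber (φ : ConnectionFunction d) (ω : Sample d) : ℝ≥0∞ :=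
  ∑' l : List (ℕ × ℕ), vtxInd ω.1 l * connInd φ ω.2.1 ω.2.2 l

lemma measurable_pathNumber (φ : ConnectionFunction d) : Measurable (pathNumber φ) :=
  Measurable.tsum fun l => ((measurable_vtxInd l).comp measurable_fst).mul
    ((measurable_connInd φ l).comp measurable_snd)

/-- Marks, positions and counts are integrated out in this order. Given the counts, only the shells
visited by a path matter; averaging over the counts reduces the paths of length k to
`listSum_shellKernel`. -/
lemma lintegral_pathNumber_le (hd : 1 ≤ d) (φ : ConnectionFunction d) (lam : ℝ≥0) :
    ∫⁻ ω, pathNumber φ ω ∂(law d lam) ≤ ∑' k : ℕ, (lam * φ.mass) ^ k := by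
  have := isProbabilityMeasure_posLaw hd
  rw [lintegral_law hd lam (measurable_pathNumber φ)]
  have h1 : ∀ N : ℕ → ℕ, ∫⁻ X, ∫⁻ U, pathNumber φ (N, X, U) ∂markLaw ∂(posLaw d) =
      ∑' l : List (ℕ × ℕ), vtxInd N l * shellKernel φ (l.map Prod.fst) 1 := by
    intro N
    have hU : ∀ X : ℕ × ℕ → HSpace d, ∫⁻ U, pathNumber φ (N, X, U) ∂markLaw =
        ∑' l : List (ℕ × ℕ), vtxInd N l * connProb φ X l := by
      intro X
      simp only [pathNumber]
      rw [lintegral_tsum fun l => ((measurable_connInd_right φ X l).const_mul _).aemeasurable]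
      refine tsum_congr fun l => ?_
      by_cases h0 : vtxInd N l = 0
      · simp [h0]
      rw [← lintegral_connInd φ X (nodup_of_vtxInd_ne_zero h0).1]
      exact lintegral_const_mul _ (measurable_connInd_right φ X l)
    simp only [hU]
    rw [lintegral_tsum fun l => ((measurable_connProb φ l).const_mul _).aemeasurable]
    refine tsum_congr fun l => ?_
    by_cases h0 : vtxInd N l = 0
    · simp [h0]
    rw [← lintegral_connProb hd φ (nodup_of_vtxInd_ne_zero h0).1 measurable_one,
      lintegral_const_mul _ (measurable_connProb φ l)]
    simp
  simp only [h1]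
  calc _ ≤ ∫⁻ N, ∑' k : ℕ, listSum k (fun s => pathCount N s * shellKernel φ s 1)
        ∂(countLaw d lam) := by
        refine lintegral_mono fun N => ?_
        rw [tsum_list]
        exact ENNReal.tsum_le_tsum fun k => listSum_vtxInd_le N k _
    _ = _ := by
        have hm : ∀ s : List ℕ, Measurable fun N : ℕ → ℕ =>
            (pathCount N s : ℝ≥0∞) * shellKernel φ s 1 := fun s =>
          (measurable_pathCount s).mul_const _
        have hm' : ∀ k : ℕ, Measurable fun N : ℕ → ℕ =>
            listSum k (fun s => pathCount N s * shellKernel φ s 1) := fun k =>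
          Measurable.tsum fun v : List.Vector ℕ k => hm v.1
        rw [lintegral_tsum fun k => (hm' k).aemeasurable]
        refine tsum_congr fun k => ?_
        rw [← listSum_shellKernel hd φ lam k]
        unfold listSum
        rw [lintegral_tsum fun v : List.Vector ℕ k => (hm v.1).aemeasurable]
        refine tsum_congr fun v => ?_
        beta_reduce
        rw [← lintegral_pathCount, lintegral_mul_const _ (measurable_pathCount v.1)]

lemma lintegral_pathNumber_lt_top (hd : 1 ≤ d) (φ : ConnectionFunction d) {lam : ℝ≥0}
    (h : lam * φ.mass < 1) : ∫⁻ ω, pathNumber φ ω ∂(law d lam) < ⊤ := by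
  refine (lintegral_pathNumber_le hd φ lam).trans_lt ?_
  rw [ENNReal.tsum_geometric, ENNReal.inv_lt_top]
  exact tsub_pos_of_lt h

lemma chi_lt_top_of_mul_mass_lt_one (hd : 1 ≤ d) (φ : ConnectionFunction d) {lam : ℝ≥0}
    (h : lam * φ.mass < 1) : chi φ lam < ⊤ :=
  (lintegral_mono fun ω => encard_cluster_le φ ω).trans_lt (lintegral_pathNumber_lt_top hd φ h)

/-- A path number of finite mean is almost surely finite and dominates the cluster size. The
measurable function `pathNumber` takes the place of the cluster, whose measurability is not needed.
-/
lemma theta_eq_zero_of_mul_mass_lt_one (hd : 1 ≤ d) (φ : ConnectionFunction d) {lam : ℝ≥0}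
    (h : lam * φ.mass < 1) : theta φ lam = 0 := by
  have := ae_lt_top (measurable_pathNumber φ) (lintegral_pathNumber_lt_top hd φ h).ne
  refine measure_mono_null ?_ (ae_iff.1 this)
  intro ω hω
  have hinf : (cluster φ ω).encard = ⊤ := Set.encard_eq_top_iff.2 hω
  have := encard_cluster_le φ ω
  rw [hinf] at this
  simpa [pathNumber] using this

end HypRCM

end

noncomputable section

namespace HypRCM

variable {d : ℕ}

/-! ### Void probabilities -/

/-- The labels of the vertices in finitely many shells. -/
def shellLabels (N : ℕ → ℕ) (S : Finset ℕ) : Finset (ℕ × ℕ) :=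
  (S.sigma fun n => Finset.range (N n)).map (Equiv.sigmaEquivProd ℕ ℕ).toEmbedding

lemma mem_shellLabels {N : ℕ → ℕ} {S : Finset ℕ} {p : ℕ × ℕ} :
    p ∈ shellLabels N S ↔ p.1 ∈ S ∧ p.2 < N p.1 := by
  obtain ⟨n, k⟩ := p
  simp [shellLabels]

lemma prod_shellLabels (N : ℕ → ℕ) (S : Finset ℕ) (t : ℕ → ℝ≥0∞) :
    ∏ p ∈ shellLabels N S, t p.1 = ∏ n ∈ S, t n ^ N n := by
  simp [shellLabels, Finset.prod_sigma]

/-- The common step of both void estimates: if each vertex of shell `n` survives a test with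
probability `t n`, independent Poisson counts make the total survival probability the exponential of
minus the mean number of failures. -/
lemma lintegral_prod_shellLabels (lam : ℝ≥0) (S : Finset ℕ) (t : ℕ → ℝ≥0∞)
    (ht : ∀ n ∈ S, t n ≤ 1) :
    ∫⁻ N, ∏ p ∈ shellLabels N S, t p.1 ∂(countLaw d lam) =
      ENNReal.ofReal (Real.exp (-(∑ n ∈ S, (shellMean d lam n * (1 - t n)).toReal))) := by
  simp only [prod_shellLabels]
  refine (lintegral_prod_eval (fun n : ℕ => poissonMeasure (shellMean d lam n)) S
    (fun n (m : ℕ) => t n ^ m) (fun _ _ => measurable_of_countable _)).trans ?_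
  rw [← Finset.sum_neg_distrib, Real.exp_sum, ENNReal.ofReal_prod_of_nonneg
    (fun n _ => (Real.exp_pos _).le)]
  refine Finset.prod_congr rfl fun n hn => ?_
  have h1 : t n ≠ ⊤ := (ht n hn).trans_lt ENNReal.one_lt_top |>.ne
  have h2 := lintegral_pow_poissonMeasure (shellMean d lam n) (t := (t n).toReal)
    ENNReal.toReal_nonneg
  rw [ENNReal.ofReal_toReal h1] at h2
  rw [h2, ENNReal.toReal_mul, ENNReal.toReal_sub_of_le (ht n hn) ENNReal.one_ne_top]
  rfl

/-! ### Infinite degree -/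

/-- The event that the root has no neighbour in the given shells. -/
def rootIsolated (φ : ConnectionFunction d) (S : Finset ℕ) : Set (Sample d) :=
  {ω | ∀ n ∈ S, ∀ k, k < ω.1 n →
    ¬ ω.2.2 s(none, some (n, k)) ≤ φ.toFun (origin d) (ω.2.1 (n, k))}

lemma measurableSet_rootIsolated (φ : ConnectionFunction d) (S : Finset ℕ) :
    MeasurableSet (rootIsolated φ S) := by
  have : rootIsolated φ S = ⋂ n ∈ S, ⋂ k : ℕ, {ω : Sample d | k < ω.1 n →
      ¬ ω.2.2 s(none, some (n, k)) ≤ φ.toFun (origin d) (ω.2.1 (n, k))} := by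
    ext ω; simp [rootIsolated]
  rw [this]
  refine Finset.measurableSet_biInter _ fun n _ => MeasurableSet.iInter fun k => ?_
  have h1 : Measurable fun ω : Sample d => ω.2.2 s(none, some (n, k)) :=
    (measurable_pi_apply _).comp (measurable_snd.comp measurable_snd)
  have h2 : Measurable fun ω : Sample d => φ.toFun (origin d) (ω.2.1 (n, k)) :=
    φ.measurable.comp (measurable_const.prodMk ((measurable_pi_apply (n, k)).comp
      (measurable_fst.comp measurable_snd)))
  have h3 : MeasurableSet {ω : Sample d | k < ω.1 n} :=
    measurableSet_lt measurable_const ((measurable_pi_apply n).comp measurable_fst)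
  exact h3.imp (measurableSet_le h1 h2).compl

lemma lintegral_mark_not_le (a : unitInterval) :
    ∫⁻ u : unitInterval, (if u ≤ a then 0 else 1) ∂volume = 1 - ENNReal.ofReal a := by
  have : (fun u : unitInterval => if u ≤ a then (0 : ℝ≥0∞) else 1) = (Set.Iic a)ᶜ.indicator 1 := by
    ext u; by_cases h : u ≤ a <;> simp [Set.indicator, h]
  rw [this, lintegral_indicator_one measurableSet_Iic.compl, prob_compl_eq_one_sub measurableSet_Iic,
    unitInterval.volume_Iic]

/-- The neighbours of the root are an independent thinning of the Poisson process, with intensity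
lam · φ(o, x) dx. Given the vertices, the edges at the root have distinct marks, whence the product
in `hU`. -/
lemma law_rootIsolated (hd : 1 ≤ d) (φ : ConnectionFunction d) (lam : ℝ≥0) (S : Finset ℕ) :
    law d lam (rootIsolated φ S) = ENNReal.ofReal (Real.exp (-(∑ n ∈ S,
      (lam * ∫⁻ x in shell d n, φ.prob (origin d) x ∂(hvol d)).toReal))) := by
  have := isProbabilityMeasure_cond_shell hd
  rw [← lintegral_indicator_one (measurableSet_rootIsolated φ S),
    lintegral_law hd lam (measurable_one.indicator (measurableSet_rootIsolated φ S))]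
  have hU : ∀ (N : ℕ → ℕ) (X : ℕ × ℕ → HSpace d),
      ∫⁻ U, (rootIsolated φ S).indicator 1 (N, X, U) ∂markLaw =
        ∏ p ∈ shellLabels N S, (1 - φ.prob (origin d) (X p)) := by
    intro N X
    have h1 : ∀ U, (rootIsolated φ S).indicator (1 : Sample d → ℝ≥0∞) (N, X, U) =
        1 * ∏ p ∈ shellLabels N S,
          (if U s(none, some p) ≤ φ.toFun (origin d) (X p) then 0 else 1) := by
      intro U
      rw [one_mul]
      by_cases h : (N, X, U) ∈ rootIsolated φ S
      · rw [Set.indicator_of_mem h, Finset.prod_eq_one, Pi.one_apply]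
        rintro ⟨n, k⟩ hp
        rw [mem_shellLabels] at hp
        exact if_neg (h n hp.1 k hp.2)
      · rw [Set.indicator_of_notMem h]
        simp only [rootIsolated, Set.mem_ofPred_eq] at h
        push Not at h
        obtain ⟨n, hn, k, hk, hle⟩ := h
        refine (Finset.prod_eq_zero (i := ((n, k) : ℕ × ℕ)) (mem_shellLabels.2 ⟨hn, hk⟩) ?_).symm
        exact if_pos hle
    simp only [h1]
    rw [markLaw, lintegral_mul_prod_update _ (shellLabels N S)
      (fun p => (s(none, some p) : Sym2 (Option (ℕ × ℕ))))]
    · simp only [Function.update_self, lintegral_mark_not_le, one_mul, lintegral_const,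
        measure_univ, mul_one]
      rfl
    · intro p _ q _ hpq
      simpa using hpq
    · intro p _
      exact Measurable.ite (measurableSet_le (measurable_pi_apply _) measurable_const)
        measurable_const measurable_const
    · exact measurable_const
    · exact fun _ _ _ _ => rfl
    · intro p _ q _ hpq U u
      rw [Function.update_of_ne]
      simpa using hpq
  have hX : ∀ N : ℕ → ℕ, ∫⁻ X, ∏ p ∈ shellLabels N S, (1 - φ.prob (origin d) (X p)) ∂(posLaw d) =
      ∏ p ∈ shellLabels N S, (1 - ∫⁻ x, φ.prob (origin d) x
        ∂(ProbabilityTheory.cond (hvol d) (shell d p.1))) := by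
    intro N
    rw [posLaw]
    refine (lintegral_prod_eval (fun p : ℕ × ℕ => ProbabilityTheory.cond (hvol d) (shell d p.1))
      (shellLabels N S) (fun _ x => 1 - φ.prob (origin d) x)
      (fun _ _ => measurable_const.sub (φ.measurable_prob_left _))).trans ?_
    refine Finset.prod_congr rfl fun p _ => ?_
    rw [lintegral_sub (φ.measurable_prob_left _)]
    · simp
    · refine ne_top_of_le_ne_top ENNReal.one_ne_top
        ((lintegral_mono fun x => φ.prob_le_one _ x).trans ?_)
      simp
    · exact Filter.Eventually.of_forall fun x => φ.prob_le_one _ x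
  simp only [hU, hX]
  rw [lintegral_prod_shellLabels lam S (fun n => 1 - ∫⁻ x, φ.prob (origin d) x
        ∂(ProbabilityTheory.cond (hvol d) (shell d n))) (fun n _ => tsub_le_self)]
  congr 4
  funext n
  rw [ENNReal.sub_sub_cancel ENNReal.one_ne_top, shellMean_mul_lintegral hd]
  refine (lintegral_mono fun x => φ.prob_le_one _ x).trans ?_
  simp

lemma ae_mem_shell (hd : 1 ≤ d) (lam : ℝ≥0) :
    ∀ᵐ ω ∂(law d lam), ∀ p, ω.2.1 p ∈ shell d p.1 := by
  have := isProbabilityMeasure_cond_shell hd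
  have := isProbabilityMeasure_posLaw hd
  have h1 : ∀ᵐ X ∂(posLaw d), ∀ p, X p ∈ shell d p.1 := by
    rw [ae_all_iff]
    intro p
    have hm := measurePreserving_eval_infinitePi
      (fun p : ℕ × ℕ => ProbabilityTheory.cond (hvol d) (shell d p.1)) p
    exact hm.quasiMeasurePreserving.ae (ae_cond_mem (measurableSet_shell p.1))
  have h2 : Measure.QuasiMeasurePreserving (fun ω : Sample d => ω.2.1) (law d lam) (posLaw d) := by
    change Measure.QuasiMeasurePreserving (Prod.fst ∘ Prod.snd)
      ((countLaw d lam).prod ((posLaw d).prod markLaw)) (posLaw d)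
    exact Measure.quasiMeasurePreserving_fst.comp Measure.quasiMeasurePreserving_snd
  exact h2.ae h1

/-- Each shell contributes finitely much to the infinite mean degree, so the shells beyond any index
`a` still have infinite mean and contain a neighbour almost surely. Neighbours at unbounded distance
cannot form a finite set of points. -/
lemma ae_infinite_cluster_of_mass_eq_top (hd : 1 ≤ d) (φ : ConnectionFunction d)
    (hφ : φ.mass = ⊤) {lam : ℝ≥0} (hlam : 0 < lam) :
    ∀ᵐ ω ∂(law d lam), (cluster φ ω).Infinite := by
  set x : ℕ → ℝ := fun n => (lam * ∫⁻ x in shell d n, φ.prob (origin d) x ∂(hvol d)).toReal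
    with hx
  have hfin : ∀ n, lam * ∫⁻ x in shell d n, φ.prob (origin d) x ∂(hvol d) ≠ ⊤ := by
    intro n
    refine ENNReal.mul_ne_top ENNReal.coe_ne_top (ne_top_of_le_ne_top
      (hvol_shell_lt_top (d := d) n).ne ((lintegral_mono fun x => φ.prob_le_one _ x).trans ?_))
    simp
  have hns : ¬ Summable x := by
    intro hs
    have h1 : ∑' n, lam * ∫⁻ x in shell d n, φ.prob (origin d) x ∂(hvol d) ≠ ⊤ := by
      have : ∀ n, lam * ∫⁻ x in shell d n, φ.prob (origin d) x ∂(hvol d) =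
          ENNReal.ofReal (x n) := fun n => (ENNReal.ofReal_toReal (hfin n)).symm
      simp_rw [this]
      exact hs.tsum_ofReal_ne_top
    apply h1
    rw [ENNReal.tsum_mul_left, ← lintegral_iUnion measurableSet_shell pairwise_disjoint_shell,
      iUnion_shell, Measure.restrict_univ, φ.lintegral_prob, hφ]
    exact ENNReal.mul_top (by exact_mod_cast hlam.ne')
  have hnull : ∀ a : ℕ, law d lam (⋂ b : ℕ, rootIsolated φ (Finset.Ico a (a + b))) = 0 := by
    intro a
    have hxs : ¬ Summable fun n => x (n + a) := by rwa [summable_nat_add_iff]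
    have htop := (not_summable_iff_tendsto_nat_atTop_of_nonneg
      (fun n => ENNReal.toReal_nonneg)).1 hxs
    have hlim : Filter.Tendsto (fun b : ℕ => ENNReal.ofReal
        (Real.exp (-(∑ n ∈ Finset.range b, x (n + a))))) Filter.atTop (nhds 0) := by
      rw [← ENNReal.ofReal_zero]
      exact ENNReal.tendsto_ofReal (Real.tendsto_exp_neg_atTop_nhds_zero.comp htop)
    refine le_antisymm (ge_of_tendsto' hlim fun b => ?_) zero_le
    refine (measure_mono (Set.iInter_subset _ b)).trans ?_
    rw [law_rootIsolated hd, Finset.sum_Ico_eq_sum_range]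
    simp [hx, add_comm a]
  have hall : ∀ᵐ ω ∂(law d lam), ∀ a : ℕ, ω ∉ ⋂ b : ℕ, rootIsolated φ (Finset.Ico a (a + b)) :=
    ae_all_iff.2 fun a => measure_eq_zero_iff_ae_notMem.1 (hnull a)
  filter_upwards [hall, ae_mem_shell hd lam] with ω h1 h2
  intro hfinite
  obtain ⟨M, hM⟩ := (hfinite.image fun y => ⌊hdist (origin d) y⌋₊).bddAbove
  have h3 := h1 (M + 1)
  simp only [rootIsolated, Set.mem_iInter, Set.mem_ofPred_eq] at h3
  push Not at h3
  obtain ⟨b, n, hn, k, hk, hle⟩ := h3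
  have hmem : ω.2.1 (n, k) ∈ cluster φ ω := by
    refine ⟨some (n, k), SimpleGraph.Adj.reachable ?_, rfl⟩
    exact ⟨by simp, trivial, hk, hle⟩
  have h4 : ⌊hdist (origin d) (ω.2.1 (n, k))⌋₊ ≤ M := hM ⟨_, hmem, rfl⟩
  have h5 : n ≤ ⌊hdist (origin d) (ω.2.1 (n, k))⌋₊ := Nat.le_floor (h2 (n, k)).1
  have h6 := (Finset.mem_Ico.1 hn).1
  omega

/-- A measurable event of positive probability on which the cluster of the origin is infinite
makes both the percolation probability positive and the expected cluster size infinite. -/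
lemma chi_eq_top_and_theta_pos_of_event (φ : ConnectionFunction d) {lam : ℝ≥0}
    {G : Set (Sample d)} (hG : MeasurableSet G) (hpos : 0 < law d lam G)
    (hinf : ∀ ω ∈ G, (cluster φ ω).Infinite) : chi φ lam = ⊤ ∧ 0 < theta φ lam := by
  constructor
  · refine top_le_iff.1 ?_
    calc (⊤ : ℝ≥0∞) = ∫⁻ ω, G.indicator (fun _ => ⊤) ω ∂(law d lam) := by
          rw [lintegral_indicator hG, setLIntegral_const, ENNReal.top_mul hpos.ne']
      _ ≤ chi φ lam := by
          refine lintegral_mono fun ω => ?_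
          by_cases hω : ω ∈ G
          · rw [Set.encard_eq_top_iff.2 (hinf ω hω)]
            exact le_top
          · rw [Set.indicator_of_notMem hω]; exact zero_le
  · exact hpos.trans_le (measure_mono hinf)

lemma chi_eq_top_and_theta_pos_of_mass_eq_top (hd : 1 ≤ d) (φ : ConnectionFunction d)
    (hφ : φ.mass = ⊤) {lam : ℝ≥0} (hlam : 0 < lam) : chi φ lam = ⊤ ∧ 0 < theta φ lam := by
  have := isProbabilityMeasure_law hd lam
  have h := ae_infinite_cluster_of_mass_eq_top hd φ hφ hlam
  -- The complement of a measurable null set containing all exceptional samples; it is measurable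
  -- and has full measure.
  set G : Set (Sample d) :=
    (toMeasurable (law d lam) {ω | ¬ (cluster φ ω).Infinite})ᶜ with hG
  have h0 : law d lam (toMeasurable (law d lam) {ω | ¬ (cluster φ ω).Infinite}) = 0 := by
    rw [measure_toMeasurable]; exact ae_iff.1 h
  refine chi_eq_top_and_theta_pos_of_event φ (G := G) (measurableSet_toMeasurable _ _).compl ?_ ?_
  · rw [prob_compl_eq_one_sub (measurableSet_toMeasurable _ _), h0]
    simp
  · intro ω hω
    by_contra hc
    exact hω (subset_toMeasurable _ _ hc)

end HypRCM

end

noncomputable section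

namespace HypRCM

variable {d : ℕ}

/-! ### Measurability of functions evaluated at a random index -/

lemma measurable_apply_nat {Ω γ : Type*} [MeasurableSpace Ω] [MeasurableSpace γ] {f : Ω → ℕ}
    (hf : Measurable f) {g : ℕ → Ω → γ} (hg : ∀ k, Measurable (g k)) :
    Measurable fun ω => g (f ω) ω := by
  intro s hs
  have : (fun ω => g (f ω) ω) ⁻¹' s = ⋃ k, f ⁻¹' {k} ∩ g k ⁻¹' s := by
    ext ω; simp
  rw [this]
  exact MeasurableSet.iUnion fun k => (hf (measurableSet_singleton k)).inter (hg k hs)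

lemma measurable_nat_sInf {Ω : Type*} [MeasurableSpace Ω] {S : Ω → Set ℕ}
    (hS : ∀ k, MeasurableSet {ω | k ∈ S ω}) : Measurable fun ω => sInf (S ω) := by
  refine measurable_to_countable' fun k => ?_
  -- The second set accounts for the convention sInf ∅ = 0.
  have : (fun ω => sInf (S ω)) ⁻¹' {k} = ({ω | k ∈ S ω} ∩ ⋂ j : ℕ, ⋂ _ : j < k, {ω | j ∈ S ω}ᶜ) ∪
      ((⋂ j : ℕ, {ω | j ∈ S ω}ᶜ) ∩ {_ω | k = 0}) := by
    ext ω
    simp only [Set.mem_preimage, Set.mem_singleton_iff, Set.mem_union, Set.mem_inter_iff,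
      Set.mem_iInter, Set.mem_compl_iff, Set.mem_ofPred_eq]
    constructor
    · intro h
      by_cases hne : (S ω).Nonempty
      · exact Or.inl ⟨h ▸ Nat.sInf_mem hne, fun j hj => Nat.notMem_of_lt_sInf (h ▸ hj)⟩
      · rw [Set.not_nonempty_iff_eq_empty] at hne
        refine Or.inr ⟨fun j => by simp [hne], ?_⟩
        rw [← h, hne, Nat.sInf_empty]
    · rintro (⟨h1, h2⟩ | ⟨h1, h2⟩)
      · refine le_antisymm (Nat.sInf_le h1) ?_
        by_contra hlt
        exact h2 _ (not_le.1 hlt) (Nat.sInf_mem ⟨k, h1⟩)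
      · have : S ω = ∅ := Set.eq_empty_of_forall_notMem h1
        rw [this, Nat.sInf_empty, h2]
  rw [this]
  refine MeasurableSet.union ((hS k).inter (MeasurableSet.iInter fun j =>
    MeasurableSet.iInter fun _ => (hS j).compl)) ((MeasurableSet.iInter fun j => (hS j).compl).inter
    (MeasurableSet.const _))

/-! ### Two marks per item -/

/-- Each item owns two marks and all of them are distinct. Integrating the first family leaves
factors in the second family only, so the items separate. -/
lemma lintegral_marks_pair {κ : Type*} (A : Finset κ) (e₁ e₂ : κ → Sym2 (Option (ℕ × ℕ)))
    (a b : κ → unitInterval) (h₁ : Set.InjOn e₁ A) (h₂ : Set.InjOn e₂ A)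
    (h₁₂ : ∀ p ∈ A, ∀ q ∈ A, e₁ p ≠ e₂ q) :
    ∫⁻ U, ∏ p ∈ A, (if U (e₁ p) ≤ a p ∧ U (e₂ p) ≤ b p then (0 : ℝ≥0∞) else 1) ∂markLaw =
      ∏ p ∈ A, (1 - ENNReal.ofReal (a p) * ENNReal.ofReal (b p)) := by
  have hle : ∀ (e : Sym2 (Option (ℕ × ℕ))) (c : unitInterval),
      MeasurableSet {U : Sym2 (Option (ℕ × ℕ)) → unitInterval | U e ≤ c} := fun e c =>
    measurableSet_le (measurable_pi_apply e) measurable_const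
  have hone : ∀ c : unitInterval, ENNReal.ofReal c ≤ 1 := fun c => by
    rw [← ENNReal.ofReal_one]; exact ENNReal.ofReal_le_ofReal c.2.2
  have step1 := lintegral_mul_prod_update (fun _ : Sym2 (Option (ℕ × ℕ)) =>
    (volume : Measure unitInterval)) A e₁ h₁
    (fun p U => if U (e₁ p) ≤ a p ∧ U (e₂ p) ≤ b p then (0 : ℝ≥0∞) else 1)
    (fun p _ => Measurable.ite ((hle _ _).inter (hle _ _)) measurable_const measurable_const)
    (fun _ => 1) measurable_const (fun _ _ _ _ => rfl) (by
      intro p hp q hq hpq U u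
      rw [Function.update_of_ne (fun h => hpq (h₁ hp hq h)),
        Function.update_of_ne (h₁₂ q hq p hp).symm])
  have step2 := lintegral_mul_prod_update (fun _ : Sym2 (Option (ℕ × ℕ)) =>
    (volume : Measure unitInterval)) A e₂ h₂
    (fun p U => if U (e₂ p) ≤ b p then 1 - ENNReal.ofReal (a p) else 1)
    (fun p _ => Measurable.ite (hle _ _) measurable_const measurable_const)
    (fun _ => 1) measurable_const (fun _ _ _ _ => rfl) (by
      intro p hp q hq hpq U u
      rw [Function.update_of_ne (fun h => hpq (h₂ hp hq h))])
  simp only [one_mul] at step1 step2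
  rw [markLaw, step1]
  have h3 : ∀ U : Sym2 (Option (ℕ × ℕ)) → unitInterval, ∀ p ∈ A,
      ∫⁻ u, (if Function.update U (e₁ p) u (e₁ p) ≤ a p ∧
        Function.update U (e₁ p) u (e₂ p) ≤ b p then (0 : ℝ≥0∞) else 1) ∂volume =
      if U (e₂ p) ≤ b p then 1 - ENNReal.ofReal (a p) else 1 := by
    intro U p hp
    simp only [Function.update_self, Function.update_of_ne (h₁₂ p hp p hp).symm]
    by_cases h : U (e₂ p) ≤ b p
    · simp only [h, and_true, if_true, lintegral_mark_not_le]
    · simp [h]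
  rw [lintegral_congr fun U => Finset.prod_congr rfl (h3 U), step2]
  have h4 : ∀ p, ∫⁻ u : unitInterval, (if u ≤ b p then 1 - ENNReal.ofReal (a p) else 1) ∂volume =
      1 - ENNReal.ofReal (a p) * ENNReal.ofReal (b p) := by
    intro p
    have h5 : ∀ u : unitInterval, (if u ≤ b p then 1 - ENNReal.ofReal (a p) else 1) =
        1 - ENNReal.ofReal (a p) * (if u ≤ b p then 1 else 0) := by
      intro u; by_cases h : u ≤ b p <;> simp [h]
    have h6 : Measurable fun u : unitInterval => if u ≤ b p then (1 : ℝ≥0∞) else 0 :=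
      Measurable.ite measurableSet_Iic measurable_const measurable_const
    simp only [h5]
    rw [lintegral_sub (h6.const_mul _), lintegral_const_mul _ h6, lintegral_mark_le]
    · simp
    · rw [lintegral_const_mul _ h6, lintegral_mark_le]
      exact ENNReal.mul_ne_top ENNReal.ofReal_ne_top ENNReal.ofReal_ne_top
    · refine Filter.Eventually.of_forall fun u => ?_
      by_cases h : u ≤ b p <;> simp [h, hone]
  simp only [Function.update_self, h4, lintegral_const, measure_univ, mul_one]

/-! ### Skeletons

A skeleton is a forest of disjoint regions: the region `B v` is to contain a representative vertex,
which is to be joined to the representative of the parent of `v` (or to the root) by a vertex in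
the region `C v`. -/

/-- A forest of disjoint regions with uniform lower bounds for volumes and two-step connection
intensities. Each region is used only in one shell. -/
structure Skeleton (φ : ConnectionFunction d) (ι : Type*) where
  /-- the parent, `none` standing for the root -/
  par : ι → Option ι
  par_ne : ∀ v, par v ≠ some v
  /-- the regions of the representatives -/
  B : ι → Set (HSpace d)
  /-- the regions of the connecting vertices -/
  C : ι → Set (HSpace d)
  /-- the shell in which a representative is looked for -/
  nB : ι → ℕ
  /-- the shell in which a connecting vertex is looked for -/
  nC : ι → ℕ
  measB : ∀ v, MeasurableSet (B v)
  measC : ∀ v, MeasurableSet (C v)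
  disjB : ∀ v w, v ≠ w → Disjoint (B v) (B w)
  disjC : ∀ v w, v ≠ w → Disjoint (C v) (C w)
  disjBC : ∀ v w, Disjoint (B v) (C w)
  origin_notMem : ∀ v, origin d ∉ B v
  /-- a point of each region -/
  ctr : ι → HSpace d
  ctr_mem : ∀ v, ctr v ∈ B v
  /-- the uniform lower bound -/
  bound : ℝ≥0∞
  le_B : ∀ v, bound ≤ hvol d (B v ∩ shell d (nB v))
  le_C : ∀ v x y, (∀ u, par v = some u → x ∈ B u) → (par v = none → x = origin d) → y ∈ B v →
    bound ≤ ∫⁻ z in C v ∩ shell d (nC v), φ.prob x z * φ.prob z y ∂(hvol d)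

namespace Skeleton

variable {φ : ConnectionFunction d} {ι : Type*} (K : Skeleton φ ι)

/-- The indices of the vertices in the region of a representative. -/
def occ (q : (ℕ → ℕ) × (ℕ × ℕ → HSpace d)) (v : ι) : Set ℕ :=
  {k | k < q.1 (K.nB v) ∧ q.2 (K.nB v, k) ∈ K.B v}

/-- The label of the representative. -/
def repLabel (q : (ℕ → ℕ) × (ℕ × ℕ → HSpace d)) : Option ι → Option (ℕ × ℕ)
  | none => none
  | some v => some (K.nB v, sInf (K.occ q v))

open Classical in
/-- The position of the representative, or a default position. -/
def repPos (q : (ℕ → ℕ) × (ℕ × ℕ → HSpace d)) : Option ι → HSpace d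
  | none => origin d
  | some v => if (K.occ q v).Nonempty then q.2 (K.nB v, sInf (K.occ q v)) else K.ctr v

/-- Whether there is a representative. -/
def Live (q : (ℕ → ℕ) × (ℕ × ℕ → HSpace d)) : Option ι → Prop
  | none => True
  | some v => (K.occ q v).Nonempty

lemma repPos_mem (q : (ℕ → ℕ) × (ℕ × ℕ → HSpace d)) (v : ι) : K.repPos q (some v) ∈ K.B v := by
  rw [repPos]
  split_ifs with h
  · exact (Nat.sInf_mem h).2
  · exact K.ctr_mem v

lemma pos_repLabel {q : (ℕ → ℕ) × (ℕ × ℕ → HSpace d)} {i : Option ι} (h : K.Live q i) :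
    pos q.2 (K.repLabel q i) = K.repPos q i := by
  cases i with
  | none => rfl
  | some v =>
    rw [repPos, if_pos (show (K.occ q v).Nonempty from h)]
    rfl

/-- The vertex with label `(nC v, k)` joins the representatives of `v` and its parent. -/
def Linked (ω : Sample d) (v : ι) (k : ℕ) : Prop :=
  ω.2.2 s(K.repLabel (ω.1, ω.2.1) (K.par v), some (K.nC v, k)) ≤
      φ.toFun (K.repPos (ω.1, ω.2.1) (K.par v)) (ω.2.1 (K.nC v, k)) ∧
    ω.2.2 s(some (K.nC v, k), K.repLabel (ω.1, ω.2.1) (some v)) ≤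
      φ.toFun (ω.2.1 (K.nC v, k)) (K.repPos (ω.1, ω.2.1) (some v))

/-- No representative in the region of `v`. -/
def vacant (v : ι) : Set (Sample d) := {ω | ¬ K.Live (ω.1, ω.2.1) (some v)}

/-- The representatives of `v` and of its parent exist but are not joined. -/
def unlinked (v : ι) : Set (Sample d) :=
  {ω | K.Live (ω.1, ω.2.1) (K.par v) ∧ K.Live (ω.1, ω.2.1) (some v) ∧
    ∀ k, k < ω.1 (K.nC v) → ω.2.1 (K.nC v, k) ∈ K.C v → ¬ K.Linked ω v k}

/-- Failure at `v`. -/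
def bad (v : ι) : Set (Sample d) := K.vacant v ∪ K.unlinked v

lemma live_of_notMem_bad {ω : Sample d} {v : ι} (h : ω ∉ K.bad v) :
    K.Live (ω.1, ω.2.1) (some v) := by
  by_contra hc
  exact h (Or.inl hc)

lemma reachable_of_notMem_bad {ω : Sample d} {v : ι} (h : ω ∉ K.bad v)
    (hpar : K.Live (ω.1, ω.2.1) (K.par v)) :
    (graph φ ω).Reachable (K.repLabel (ω.1, ω.2.1) (K.par v))
      (K.repLabel (ω.1, ω.2.1) (some v)) := by
  have hv := K.live_of_notMem_bad h
  have h1 : ω ∉ K.unlinked v := fun hc => h (Or.inr hc)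
  have h2 : ∃ k, k < ω.1 (K.nC v) ∧ ω.2.1 (K.nC v, k) ∈ K.C v ∧ K.Linked ω v k := by
    by_contra hc
    push Not at hc
    exact h1 ⟨hpar, hv, hc⟩
  obtain ⟨k, hk, hkC, hl1, hl2⟩ := h2
  have hvert : ∀ i, K.Live (ω.1, ω.2.1) i → IsVertex ω (K.repLabel (ω.1, ω.2.1) i) := by
    intro i hi
    cases i with
    | none => trivial
    | some u => exact (Nat.sInf_mem hi).1
  -- Representatives lie in regions `B`, which are disjoint from `C v`; the connecting vertex
  -- therefore differs from both of them.
  have hne : ∀ i, K.Live (ω.1, ω.2.1) i → K.repLabel (ω.1, ω.2.1) i ≠ some (K.nC v, k) := by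
    intro i hi heq
    cases i with
    | none => simp [repLabel] at heq
    | some u =>
      have h3 := (Nat.sInf_mem hi).2
      rw [repLabel, Option.some_inj] at heq
      simp only [heq] at h3
      exact Set.disjoint_left.1 (K.disjBC u v) h3 hkC
  rw [← K.pos_repLabel hpar] at hl1
  rw [← K.pos_repLabel hv] at hl2
  have a1 : (graph φ ω).Adj (K.repLabel (ω.1, ω.2.1) (K.par v)) (some (K.nC v, k)) := by
    refine ⟨hne _ hpar, hvert _ hpar, hk, ?_⟩
    rw [position_eq_pos]
    exact hl1
  have a2 : (graph φ ω).Adj (some (K.nC v, k)) (K.repLabel (ω.1, ω.2.1) (some v)) := by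
    refine ⟨(hne _ hv).symm, hk, hvert _ hv, ?_⟩
    rw [position_eq_pos ω (K.repLabel _ _)]
    exact hl2
  exact a1.reachable.trans a2.reachable

/-! ### Measurability -/

lemma measurableSet_mem_occ (v : ι) (k : ℕ) : MeasurableSet
    {q : (ℕ → ℕ) × (ℕ × ℕ → HSpace d) | k ∈ K.occ q v} :=
  (measurableSet_lt measurable_const ((measurable_pi_apply (K.nB v)).comp measurable_fst)).inter
    ((K.measB v).preimage ((measurable_pi_apply (K.nB v, k)).comp measurable_snd))

lemma measurable_sInf_occ (v : ι) : Measurable fun q : (ℕ → ℕ) × (ℕ × ℕ → HSpace d) =>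
    sInf (K.occ q v) := measurable_nat_sInf (K.measurableSet_mem_occ v)

lemma measurableSet_live (i : Option ι) : MeasurableSet
    {q : (ℕ → ℕ) × (ℕ × ℕ → HSpace d) | K.Live q i} := by
  cases i with
  | none => exact MeasurableSet.const True
  | some v =>
    have : {q : (ℕ → ℕ) × (ℕ × ℕ → HSpace d) | K.Live q (some v)} =
        ⋃ k, {q | k ∈ K.occ q v} := by
      ext q; simp [Live, Set.Nonempty]
    rw [this]
    exact MeasurableSet.iUnion (K.measurableSet_mem_occ v)

lemma measurable_repPos (i : Option ι) : Measurable
    fun q : (ℕ → ℕ) × (ℕ × ℕ → HSpace d) => K.repPos q i := by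
  cases i with
  | none => exact measurable_const
  | some v =>
    refine Measurable.ite (K.measurableSet_live (some v)) ?_ measurable_const
    exact measurable_apply_nat (K.measurable_sInf_occ v)
      (g := fun k (q : (ℕ → ℕ) × (ℕ × ℕ → HSpace d)) => q.2 (K.nB v, k))
      fun k => (measurable_pi_apply _).comp measurable_snd

lemma measurable_config : Measurable fun ω : Sample d => (ω.1, ω.2.1) :=
  measurable_fst.prodMk (measurable_fst.comp measurable_snd)

lemma measurable_mark_repLabel (i : Option ι) (p : ℕ × ℕ) : Measurable fun ω : Sample d =>
    ω.2.2 s(K.repLabel (ω.1, ω.2.1) i, some p) := by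
  cases i with
  | none =>
    have h : Measurable fun ω : Sample d => ω.2.2 s(none, some p) :=
      (measurable_pi_apply _).comp (measurable_snd.comp measurable_snd)
    exact h
  | some v =>
    exact measurable_apply_nat ((K.measurable_sInf_occ v).comp measurable_config)
      (g := fun k (ω : Sample d) => ω.2.2 s(some (K.nB v, k), some p))
      fun k => (measurable_pi_apply _).comp (measurable_snd.comp measurable_snd)

lemma measurableSet_vacant (v : ι) : MeasurableSet (K.vacant v) :=
  ((K.measurableSet_live (some v)).preimage measurable_config).compl

lemma measurableSet_unlinked (v : ι) : MeasurableSet (K.unlinked v) := by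
  have hX : ∀ k, Measurable fun ω : Sample d => ω.2.1 (K.nC v, k) := fun k =>
    (measurable_pi_apply _).comp (measurable_fst.comp measurable_snd)
  have hlink : ∀ k, MeasurableSet {ω : Sample d | K.Linked ω v k} := by
    intro k
    have h1 : Measurable fun ω : Sample d => φ.toFun (K.repPos (ω.1, ω.2.1) (K.par v))
        (ω.2.1 (K.nC v, k)) :=
      φ.measurable.comp (((K.measurable_repPos (K.par v)).comp measurable_config).prodMk (hX k))
    have h2 : Measurable fun ω : Sample d => φ.toFun (ω.2.1 (K.nC v, k))
        (K.repPos (ω.1, ω.2.1) (some v)) :=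
      φ.measurable.comp ((hX k).prodMk ((K.measurable_repPos (some v)).comp measurable_config))
    have h3 : Measurable fun ω : Sample d =>
        ω.2.2 s(some (K.nC v, k), K.repLabel (ω.1, ω.2.1) (some v)) := by
      simp only [Sym2.eq_swap (a := some (K.nC v, k))]
      exact K.measurable_mark_repLabel (some v) (K.nC v, k)
    have h4 := K.measurable_mark_repLabel (K.par v) (K.nC v, k)
    have h5 := measurableSet_le h4 h1
    have h6 := measurableSet_le h3 h2
    exact h5.inter h6
  have : K.unlinked v = {ω | K.Live (ω.1, ω.2.1) (K.par v)} ∩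
      ({ω | K.Live (ω.1, ω.2.1) (some v)} ∩ ⋂ k : ℕ, {ω : Sample d | k < ω.1 (K.nC v) →
        ω.2.1 (K.nC v, k) ∈ K.C v → ¬ K.Linked ω v k}) := by
    ext ω; simp [unlinked]
  rw [this]
  have hl : ∀ i, MeasurableSet {ω : Sample d | K.Live (ω.1, ω.2.1) i} := fun i =>
    (K.measurableSet_live i).preimage measurable_config
  refine (hl _).inter ((hl _).inter (MeasurableSet.iInter fun k => ?_))
  have h3 : MeasurableSet {ω : Sample d | k < ω.1 (K.nC v)} :=
    measurableSet_lt measurable_const ((measurable_pi_apply _).comp measurable_fst)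
  exact h3.imp (((K.measC v).preimage (hX k)).imp (hlink k).compl)

lemma measurableSet_bad (v : ι) : MeasurableSet (K.bad v) :=
  (K.measurableSet_vacant v).union (K.measurableSet_unlinked v)

end Skeleton

end HypRCM

end

noncomputable section

namespace HypRCM

variable {d : ℕ}

namespace Skeleton

variable {φ : ConnectionFunction d} {ι : Type*} (K : Skeleton φ ι)

/-- The union of the regions of the representatives in `V` looked for in shell `n`. -/
def repRegion (V : Finset ι) (n : ℕ) : Set (HSpace d) := ⋃ v ∈ V.filter (K.nB · = n), K.B v

lemma mem_repRegion {V : Finset ι} {n : ℕ} {x : HSpace d} :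
    x ∈ K.repRegion V n ↔ ∃ v ∈ V, K.nB v = n ∧ x ∈ K.B v := by
  simp [repRegion, and_assoc]

lemma measurableSet_repRegion (V : Finset ι) (n : ℕ) : MeasurableSet (K.repRegion V n) :=
  Finset.measurableSet_biUnion _ fun v _ => K.measB v

/-- The probability that a vertex at `x` joins the representatives of `v` and its parent. -/
def linkProb (q : (ℕ → ℕ) × (ℕ × ℕ → HSpace d)) (v : ι) (x : HSpace d) : ℝ≥0∞ :=
  φ.prob (K.repPos q (K.par v)) x * φ.prob x (K.repPos q (some v))

lemma linkProb_le_one (q : (ℕ → ℕ) × (ℕ × ℕ → HSpace d)) (v : ι) (x : HSpace d) :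
    K.linkProb q v x ≤ 1 :=
  mul_le_one' (φ.prob_le_one _ _) (φ.prob_le_one _ _)

/-- The sum over `v` of the probabilities that a vertex at `x` in `C v` is a link. -/
def linkSum (F : Finset ι) (n : ℕ) (q : (ℕ → ℕ) × (ℕ × ℕ → HSpace d)) (x : HSpace d) : ℝ≥0∞ :=
  ∑ v ∈ F.filter (K.nC · = n), (K.C v).indicator (K.linkProb q v) x

lemma linkSum_of_mem {F : Finset ι} {n : ℕ} (q : (ℕ → ℕ) × (ℕ × ℕ → HSpace d)) {x : HSpace d}
    {v : ι} (hv : v ∈ F) (hn : K.nC v = n) (hx : x ∈ K.C v) :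
    K.linkSum F n q x = K.linkProb q v x := by
  rw [linkSum, Finset.sum_eq_single v]
  · rw [Set.indicator_of_mem hx]
  · intro w _ hwv
    exact Set.indicator_of_notMem (fun h => Set.disjoint_left.1 (K.disjC w v hwv) h hx) _
  · intro h
    exact absurd (Finset.mem_filter.2 ⟨hv, hn⟩) h

lemma linkSum_of_notMem {F : Finset ι} {n : ℕ} (q : (ℕ → ℕ) × (ℕ × ℕ → HSpace d)) {x : HSpace d}
    (h : ∀ v ∈ F, K.nC v = n → x ∉ K.C v) : K.linkSum F n q x = 0 :=
  Finset.sum_eq_zero fun v hv => by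
    rw [Finset.mem_filter] at hv
    exact Set.indicator_of_notMem (h v hv.1 hv.2) _

lemma linkSum_le_one (F : Finset ι) (n : ℕ) (q : (ℕ → ℕ) × (ℕ × ℕ → HSpace d)) (x : HSpace d) :
    K.linkSum F n q x ≤ 1 := by
  by_cases h : ∃ v ∈ F, K.nC v = n ∧ x ∈ K.C v
  · obtain ⟨v, hv, hn, hx⟩ := h
    rw [K.linkSum_of_mem q hv hn hx]
    exact K.linkProb_le_one q v x
  · push Not at h
    rw [K.linkSum_of_notMem q h]
    exact zero_le_one

lemma measurable_linkProb (v : ι) : Measurable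
    fun z : ((ℕ → ℕ) × (ℕ × ℕ → HSpace d)) × HSpace d => K.linkProb z.1 v z.2 := by
  have h1 := (K.measurable_repPos (K.par v)).comp
    (measurable_fst : Measurable fun z : ((ℕ → ℕ) × (ℕ × ℕ → HSpace d)) × HSpace d => z.1)
  have h2 := (K.measurable_repPos (some v)).comp
    (measurable_fst : Measurable fun z : ((ℕ → ℕ) × (ℕ × ℕ → HSpace d)) × HSpace d => z.1)
  exact (φ.measurable_prob.comp (h1.prodMk measurable_snd)).mul
    (φ.measurable_prob.comp (measurable_snd.prodMk h2))

lemma measurable_linkProb_right (q : (ℕ → ℕ) × (ℕ × ℕ → HSpace d)) (v : ι) :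
    Measurable (K.linkProb q v) := by
  have : K.linkProb q v =
      fun x => φ.prob (K.repPos q (K.par v)) x * φ.prob (K.repPos q (some v)) x :=
    funext fun x => by rw [linkProb, φ.prob_symm x]
  rw [this]
  exact (φ.measurable_prob_left _).mul (φ.measurable_prob_left _)

lemma measurable_linkSum (F : Finset ι) (n : ℕ) : Measurable
    fun z : ((ℕ → ℕ) × (ℕ × ℕ → HSpace d)) × HSpace d => K.linkSum F n z.1 z.2 := by
  refine Finset.measurable_fun_sum _ fun v _ => ?_
  have : (fun z : ((ℕ → ℕ) × (ℕ × ℕ → HSpace d)) × HSpace d =>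
      (K.C v).indicator (K.linkProb z.1 v) z.2) =
      (Prod.snd ⁻¹' K.C v).indicator fun z => K.linkProb z.1 v z.2 := by
    ext z
    by_cases h : z.2 ∈ K.C v
    · rw [Set.indicator_of_mem h, Set.indicator_of_mem (by exact h)]
    · rw [Set.indicator_of_notMem h, Set.indicator_of_notMem (by exact h)]
  rw [this]
  exact (K.measurable_linkProb v).indicator ((K.measC v).preimage measurable_snd)

lemma measurable_linkSum_right (F : Finset ι) (n : ℕ) (q : (ℕ → ℕ) × (ℕ × ℕ → HSpace d)) :
    Measurable (K.linkSum F n q) := by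
  refine Finset.measurable_fun_sum _ fun v _ => ?_
  exact (K.measurable_linkProb_right q v).indicator (K.measC v)

/-! ### The failure probability given the vertices -/

/-- Given the vertices, vacancy says that no vertex lies in the regions of `F₁`, and a failed link
at `v` says that every vertex in `C v` misses one of its two edges. Both conditions factor over the
vertices: those in representative regions are tested for vacancy, the others for linking. Dropping
the labels outside `S` only enlarges the right-hand side. -/
lemma lintegral_marks_le [Nonempty ι] (F₁ F₂ V : Finset ι) (N : ℕ → ℕ)
    (X : ℕ × ℕ → HSpace d) (S : Finset ℕ) :
    ∫⁻ U, ((⋂ v ∈ F₁, K.vacant v) ∩ ⋂ v ∈ F₂, K.unlinked v).indicator 1 (N, X, U) ∂markLaw ≤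
      ∏ p ∈ shellLabels N S, ((K.repRegion V p.1 ∩ (K.repRegion F₁ p.1)ᶜ).indicator 1 (X p) +
        (K.repRegion V p.1)ᶜ.indicator (fun x => 1 - K.linkSum F₂ p.1 (N, X) x) (X p)) := by
  classical
  by_cases hlive : (∀ v ∈ F₁, ¬ K.Live (N, X) (some v)) ∧
      ∀ v ∈ F₂, K.Live (N, X) (K.par v) ∧ K.Live (N, X) (some v)
  swap
  · have : ∀ U, (N, X, U) ∉ (⋂ v ∈ F₁, K.vacant v) ∩ ⋂ v ∈ F₂, K.unlinked v := by
      intro U hU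
      rw [Set.mem_inter_iff, Set.mem_iInter₂, Set.mem_iInter₂] at hU
      exact hlive ⟨fun v hv => hU.1 v hv, fun v hv => ⟨(hU.2 v hv).1, (hU.2 v hv).2.1⟩⟩
    simp [Set.indicator_of_notMem (this _)]
  obtain ⟨hvac, hliv⟩ := hlive
  -- These vertices could serve as links for an index of `F₂`; each of the remaining ones
  -- contributes a factor 1.
  set A' := (shellLabels N S).filter fun p => X p ∉ K.repRegion V p.1 ∧
    ∃ v ∈ F₂, K.nC v = p.1 ∧ X p ∈ K.C v with hA'
  have hw : ∀ p ∈ A', ∃ v ∈ F₂, K.nC v = p.1 ∧ X p ∈ K.C v := fun p hp =>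
    (Finset.mem_filter.1 hp).2.2
  choose! w hwF hwn hwC using hw
  have hlt : ∀ p ∈ A', p.2 < N p.1 := fun p hp =>
    (mem_shellLabels.1 (Finset.mem_filter.1 hp).1).2
  have hright : ∏ p ∈ shellLabels N S,
      ((K.repRegion V p.1 ∩ (K.repRegion F₁ p.1)ᶜ).indicator 1 (X p) +
        (K.repRegion V p.1)ᶜ.indicator (fun x => 1 - K.linkSum F₂ p.1 (N, X) x) (X p)) =
      ∏ p ∈ A', (1 - K.linkProb (N, X) (w p) (X p)) := by
    rw [hA', Finset.prod_filter]
    refine Finset.prod_congr rfl fun p hp => ?_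
    have hpN := (mem_shellLabels.1 hp).2
    split_ifs with h
    · rw [Set.indicator_of_notMem (fun hc => h.1 hc.1), Set.indicator_of_mem h.1, zero_add,
        K.linkSum_of_mem _ (hwF p (Finset.mem_filter.2 ⟨hp, h⟩))
          (hwn p (Finset.mem_filter.2 ⟨hp, h⟩)) (hwC p (Finset.mem_filter.2 ⟨hp, h⟩))]
    · by_cases hR : X p ∈ K.repRegion V p.1
      · have h2 : X p ∈ (K.repRegion F₁ p.1)ᶜ := by
          intro hc
          obtain ⟨v, hv, hvn, hvB⟩ := K.mem_repRegion.1 hc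
          exact hvac v hv ⟨p.2, by rw [occ]; simp only [hvn]; exact ⟨hpN, hvB⟩⟩
        rw [Set.indicator_of_mem (Set.mem_inter hR h2), Set.indicator_of_notMem (Set.notMem_compl_iff.2 hR)]
        simp
      · have h3 : ∀ v ∈ F₂, K.nC v = p.1 → X p ∉ K.C v := fun v hv hn hx =>
          h ⟨hR, v, hv, hn, hx⟩
        rw [Set.indicator_of_notMem (fun hc => hR hc.1), Set.indicator_of_mem hR,
          K.linkSum_of_notMem _ h3]
        simp
  rw [hright]
  -- representatives and connecting vertices have distinct labels
  have hlab : ∀ i, K.Live (N, X) i → ∀ v p, X p ∈ K.C v →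
      K.repLabel (N, X) i ≠ some p := by
    intro i hi v p hp heq
    cases i with
    | none => simp [repLabel] at heq
    | some u =>
      have h3 := (Nat.sInf_mem hi).2
      rw [repLabel, Option.some_inj] at heq
      simp only [heq] at h3
      exact Set.disjoint_left.1 (K.disjBC u v) h3 hp
  have hrep : ∀ v ∈ F₂, K.repLabel (N, X) (K.par v) ≠ K.repLabel (N, X) (some v) := by
    intro v hv heq
    obtain ⟨hl1, hl2⟩ := hliv v hv
    have hpne := K.par_ne v
    cases hpar : K.par v with
    | none => rw [hpar] at heq; simp [repLabel] at heq
    | some u =>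
      rw [hpar] at heq hl1 hpne
      have h3 := (Nat.sInf_mem hl1).2
      have h4 := (Nat.sInf_mem hl2).2
      rw [repLabel, repLabel, Option.some_inj] at heq
      simp only [heq] at h3
      exact Set.disjoint_left.1 (K.disjB u v fun h => hpne (h ▸ rfl)) h3 h4
  have key := lintegral_marks_pair A' (fun p => s(K.repLabel (N, X) (K.par (w p)), some p))
    (fun p => s(some p, K.repLabel (N, X) (some (w p))))
    (fun p => φ.toFun (K.repPos (N, X) (K.par (w p))) (X p))
    (fun p => φ.toFun (X p) (K.repPos (N, X) (some (w p)))) (by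
      intro p hp q hq heq
      rcases Sym2.eq_iff.1 heq with h | h
      · exact Option.some_inj.1 h.2
      · exact absurd h.1 (hlab _ (hliv _ (hwF p hp)).1 _ _ (hwC q hq))) (by
      intro p hp q hq heq
      rcases Sym2.eq_iff.1 heq with h | h
      · exact Option.some_inj.1 h.1
      · exact absurd h.1.symm (hlab _ (hliv _ (hwF q hq)).2 _ _ (hwC p hp))) (by
      intro p hp q hq heq
      rcases Sym2.eq_iff.1 heq with h | h
      · exact absurd h.1 (hlab _ (hliv _ (hwF p hp)).1 _ _ (hwC q hq))
      · have hpq : p = q := Option.some_inj.1 h.2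
        subst hpq
        exact hrep _ (hwF p hp) h.1)
  refine le_trans (lintegral_mono fun U => ?_) key.le
  by_cases hU : (N, X, U) ∈ (⋂ v ∈ F₁, K.vacant v) ∩ ⋂ v ∈ F₂, K.unlinked v
  · rw [Set.indicator_of_mem hU]
    rw [Set.mem_inter_iff, Set.mem_iInter₂, Set.mem_iInter₂] at hU
    refine le_of_eq (Finset.prod_eq_one fun p hp => if_neg ?_).symm
    have h4 := (hU.2 (w p) (hwF p hp)).2.2 p.2 (by rw [hwn p hp]; exact hlt p hp)
      (by rw [hwn p hp]; exact hwC p hp)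
    rw [Linked, hwn p hp] at h4
    exact h4
  · rw [Set.indicator_of_notMem hU]
    exact zero_le

end Skeleton

end HypRCM

end

noncomputable section

namespace HypRCM

variable {d : ℕ}

namespace Skeleton

variable {φ : ConnectionFunction d} {ι : Type*} (K : Skeleton φ ι)

/-! ### Integrating out the positions -/

/-- A representative, and also its default in case of vacancy, is decided by the vertices inside the
representative regions. This is the locality hypothesis of `lintegral_prod_split_le`. -/
lemma repPos_congr {V : Finset ι} {N : ℕ → ℕ} {S : Finset ℕ} (hS : ∀ v ∈ V, K.nB v ∈ S)
    {X X' : ℕ × ℕ → HSpace d} (h : ∀ q ∈ shellLabels N S, X q ∈ K.repRegion V q.1 ∨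
      X' q ∈ K.repRegion V q.1 → X q = X' q) {v : ι} (hv : v ∈ V) :
    K.repPos (N, X) (some v) = K.repPos (N, X') (some v) := by
  have h1 : ∀ k < N (K.nB v), X (K.nB v, k) ∈ K.B v ∨ X' (K.nB v, k) ∈ K.B v →
      X (K.nB v, k) = X' (K.nB v, k) := by
    intro k hk hor
    refine h _ (mem_shellLabels.2 ⟨hS v hv, hk⟩) (hor.imp ?_ ?_) <;>
      exact fun hx => K.mem_repRegion.2 ⟨v, hv, rfl, hx⟩
  have h2 : K.occ (N, X) v = K.occ (N, X') v := by
    ext k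
    simp only [occ, Set.mem_ofPred_eq]
    refine and_congr_right fun hk => ⟨fun hx => ?_, fun hx => ?_⟩
    · rwa [← h1 k hk (Or.inl hx)]
    · rwa [h1 k hk (Or.inr hx)]
  rw [repPos, repPos, h2]
  split_ifs with hne
  · have h3 := Nat.sInf_mem hne
    exact h1 _ h3.1 (Or.inr h3.2)
  · rfl

/-- The lower bound relative to the volume of the shell. -/
def relBound (n : ℕ) : ℝ≥0∞ := (hvol d (shell d n))⁻¹ * K.bound

lemma relBound_le_B (v : ι) : K.relBound (K.nB v) ≤
    ProbabilityTheory.cond (hvol d) (shell d (K.nB v)) (K.B v) := by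
  rw [cond_apply (measurableSet_shell _), relBound, Set.inter_comm]
  gcongr
  exact K.le_B v

lemma relBound_le_C (q : (ℕ → ℕ) × (ℕ × ℕ → HSpace d)) (v : ι) : K.relBound (K.nC v) ≤
    ∫⁻ x in K.C v, K.linkProb q v x ∂(ProbabilityTheory.cond (hvol d) (shell d (K.nC v))) := by
  rw [ProbabilityTheory.cond, Measure.restrict_smul, lintegral_smul_measure,
    Measure.restrict_restrict (K.measC v), relBound, smul_eq_mul]
  gcongr
  refine K.le_C v _ _ (fun u hu => ?_) (fun hu => ?_) (K.repPos_mem q v)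
  · rw [hu]; exact K.repPos_mem q u
  · rw [hu]; rfl

/-- The regions `C v` avoid all representative regions, so restricting to the complement of the
latter loses none of the linking probability. -/
lemma card_mul_relBound_le (F V : Finset ι) (n : ℕ) (q : (ℕ → ℕ) × (ℕ × ℕ → HSpace d)) :
    ((F.filter (K.nC · = n)).card : ℝ≥0∞) * K.relBound n ≤
      ∫⁻ x in (K.repRegion V n)ᶜ, K.linkSum F n q x
        ∂(ProbabilityTheory.cond (hvol d) (shell d n)) := by
  simp only [linkSum]
  rw [lintegral_finsetSum _ fun v _ => (K.measurable_linkProb_right q v).indicator (K.measC v),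
    ← nsmul_eq_mul, ← Finset.sum_const]
  refine Finset.sum_le_sum fun v hv => ?_
  obtain rfl := (Finset.mem_filter.1 hv).2
  rw [lintegral_indicator (K.measC v), Measure.restrict_restrict (K.measC v),
    Set.inter_eq_self_of_subset_left]
  · exact K.relBound_le_C q v
  · intro x hx hc
    obtain ⟨u, _, _, hu⟩ := K.mem_repRegion.1 hc
    exact Set.disjoint_left.1 (K.disjBC u v) hu hx

/-- The bound for the failure factor of one vertex of shell `n`. -/
def failFactor (F₁ F₂ V : Finset ι) (n : ℕ) : ℝ≥0∞ :=
  ProbabilityTheory.cond (hvol d) (shell d n) (K.repRegion V n ∩ (K.repRegion F₁ n)ᶜ) +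
    (ProbabilityTheory.cond (hvol d) (shell d n) (K.repRegion V n)ᶜ -
      ((F₂.filter (K.nC · = n)).card : ℝ≥0∞) * K.relBound n)

lemma measurable_one_sub_linkSum (F : Finset ι) (n : ℕ) (N : ℕ → ℕ) : Measurable
    (Function.uncurry fun (X : ℕ × ℕ → HSpace d) (x : HSpace d) => 1 - K.linkSum F n (N, X) x) := by
  have h3 : Measurable fun z : (ℕ × ℕ → HSpace d) × HSpace d =>
      (((N, z.1), z.2) : ((ℕ → ℕ) × (ℕ × ℕ → HSpace d)) × HSpace d) :=
    (measurable_const.prodMk measurable_fst).prodMk measurable_snd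
  have h4 := (K.measurable_linkSum F n).comp h3
  simp only [Function.comp_def] at h4
  have h5 := (measurable_const (a := (1 : ℝ≥0∞))).sub h4
  exact h5

/-- The set `V` contains the parents, so the vertices in its regions determine both ends of every
link considered. The origin lies in no region `B` and serves as the frozen value. -/
lemma lintegral_pos_le (hd : 1 ≤ d) {F₁ F₂ V : Finset ι} (h2 : F₂ ⊆ V)
    (hp : ∀ v ∈ F₂, ∀ u, K.par v = some u → u ∈ V) {S : Finset ℕ} (hS : ∀ v ∈ V, K.nB v ∈ S)
    (N : ℕ → ℕ) :
    ∫⁻ X, ∏ p ∈ shellLabels N S, ((K.repRegion V p.1 ∩ (K.repRegion F₁ p.1)ᶜ).indicator 1 (X p) +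
        (K.repRegion V p.1)ᶜ.indicator (fun x => 1 - K.linkSum F₂ p.1 (N, X) x) (X p)) ∂(posLaw d) ≤
      ∏ p ∈ shellLabels N S, K.failFactor F₁ F₂ V p.1 := by
  have := isProbabilityMeasure_cond_shell hd
  refine lintegral_prod_split_le (fun p : ℕ × ℕ => ProbabilityTheory.cond (hvol d) (shell d p.1))
    (shellLabels N S) (fun p => K.repRegion V p.1) (fun p => (K.repRegion F₁ p.1)ᶜ)
    (fun p => K.measurableSet_repRegion V p.1) (fun p => (K.measurableSet_repRegion F₁ p.1).compl)
    (origin d) (fun p X x => 1 - K.linkSum F₂ p.1 (N, X) x) ?_ ?_ ?_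
    (fun p => ProbabilityTheory.cond (hvol d) (shell d p.1) (K.repRegion V p.1)ᶜ -
      ((F₂.filter (K.nC · = p.1)).card : ℝ≥0∞) * K.relBound p.1) ?_
  · intro p _
    exact K.measurable_one_sub_linkSum F₂ p.1 N
  · intro p _ X X' h
    funext x
    congr 1
    refine Finset.sum_congr rfl fun v hv => ?_
    have hv2 := (Finset.mem_filter.1 hv).1
    have h3 : K.repPos (N, X) (K.par v) = K.repPos (N, X') (K.par v) := by
      cases hpar : K.par v with
      | none => rfl
      | some u => exact K.repPos_congr hS h (hp v hv2 u hpar)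
    have h4 : K.linkProb (N, X) v = K.linkProb (N, X') v := by
      funext y
      rw [linkProb, linkProb, h3, K.repPos_congr hS h (h2 hv2)]
    rw [h4]
  · intro p _ hc
    obtain ⟨v, _, _, hv⟩ := K.mem_repRegion.1 hc
    exact K.origin_notMem v hv
  · intro p _ X
    rw [lintegral_sub (K.measurable_linkSum_right F₂ p.1 (N, X))]
    · rw [setLIntegral_one]
      exact tsub_le_tsub_left (K.card_mul_relBound_le F₂ V p.1 (N, X)) _
    · refine ne_top_of_le_ne_top ENNReal.one_ne_top ((lintegral_mono fun x =>
        K.linkSum_le_one F₂ p.1 (N, X) x).trans ?_)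
      rw [setLIntegral_one]
      exact prob_le_one
    · exact Filter.Eventually.of_forall fun x => K.linkSum_le_one F₂ p.1 (N, X) x

/-- The total mass 1 splits along `repRegion V n`. Inside, vacancy removes at least `relBound` for
each index of `F₁` in this shell; outside, linking removes as much for each index of `F₂`. -/
lemma failFactor_add_le (hd : 1 ≤ d) {F₁ F₂ V : Finset ι} (h1 : F₁ ⊆ V) (n : ℕ) :
    K.failFactor F₁ F₂ V n + (((F₁.filter (K.nB · = n)).card : ℝ≥0∞) * K.relBound n +
      ((F₂.filter (K.nC · = n)).card : ℝ≥0∞) * K.relBound n) ≤ 1 := by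
  have := isProbabilityMeasure_cond_shell (d := d) hd
  have hsub : K.repRegion F₁ n ⊆ K.repRegion V n := by
    intro x hx
    obtain ⟨v, hv, h⟩ := K.mem_repRegion.1 hx
    exact K.mem_repRegion.2 ⟨v, h1 hv, h⟩
  set μ := ProbabilityTheory.cond (hvol d) (shell d n) with hμ
  have hJ : ((F₁.filter (K.nB · = n)).card : ℝ≥0∞) * K.relBound n ≤ μ (K.repRegion F₁ n) := by
    rw [repRegion, measure_biUnion_finset (fun v _ w _ hvw => K.disjB v w hvw)
      fun v _ => K.measB v, ← nsmul_eq_mul, ← Finset.sum_const]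
    refine Finset.sum_le_sum fun v hv => ?_
    obtain rfl := (Finset.mem_filter.1 hv).2
    exact K.relBound_le_B v
  -- This makes the truncated subtraction in `failFactor` a genuine one.
  have hC : ((F₂.filter (K.nC · = n)).card : ℝ≥0∞) * K.relBound n ≤ μ (K.repRegion V n)ᶜ := by
    refine (K.card_mul_relBound_le F₂ V n (fun _ => 0, fun _ => origin d)).trans ?_
    refine (lintegral_mono fun x => K.linkSum_le_one F₂ n _ x).trans ?_
    rw [setLIntegral_one]
  calc K.failFactor F₁ F₂ V n + (((F₁.filter (K.nB · = n)).card : ℝ≥0∞) * K.relBound n +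
        ((F₂.filter (K.nC · = n)).card : ℝ≥0∞) * K.relBound n)
      = (((F₁.filter (K.nB · = n)).card : ℝ≥0∞) * K.relBound n +
        μ (K.repRegion V n ∩ (K.repRegion F₁ n)ᶜ)) + ((μ (K.repRegion V n)ᶜ -
        ((F₂.filter (K.nC · = n)).card : ℝ≥0∞) * K.relBound n) +
        ((F₂.filter (K.nC · = n)).card : ℝ≥0∞) * K.relBound n) := by
        rw [failFactor]; ring
    _ ≤ (μ (K.repRegion F₁ n) + μ (K.repRegion V n ∩ (K.repRegion F₁ n)ᶜ)) +
        μ (K.repRegion V n)ᶜ := by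
        rw [tsub_add_cancel_of_le hC]
        gcongr
    _ = μ (K.repRegion V n) + μ (K.repRegion V n)ᶜ := by
        congr 1
        have := measure_inter_add_sdiff (μ := μ) (K.repRegion V n) (K.measurableSet_repRegion F₁ n)
        rw [Set.inter_eq_self_of_subset_right hsub] at this
        exact this
    _ = 1 := by
        rw [measure_add_measure_compl (K.measurableSet_repRegion V n), measure_univ]

lemma bound_ne_top [Nonempty ι] : K.bound ≠ ⊤ := by
  obtain ⟨v⟩ := ‹Nonempty ι›
  exact ((K.le_B v).trans (measure_mono Set.inter_subset_right)).trans_lt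
    (hvol_shell_lt_top _) |>.ne

/-- Averaging `failFactor` over the Poisson counts exponentiates its defect. The cost of each
failing index is lam · bound in every shell, because the shell volume cancels between `shellMean`
and `relBound`. -/
lemma law_vacant_unlinked_le [Nonempty ι] (hd : 1 ≤ d) (lam : ℝ≥0) (F₁ F₂ : Finset ι) :
    law d lam ((⋂ v ∈ F₁, K.vacant v) ∩ ⋂ v ∈ F₂, K.unlinked v) ≤
      ENNReal.ofReal (Real.exp (-(lam * K.bound.toReal))) ^ (F₁.card + F₂.card) := by
  classical
  -- Parents are included because links depend on their representatives as well; `Finset.eraseNone`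
  -- drops the root, whose position is fixed.
  set V : Finset ι := F₁ ∪ F₂ ∪ Finset.eraseNone (F₂.image K.par) with hV
  set S : Finset ℕ := V.image K.nB ∪ F₂.image K.nC with hSdef
  have h1 : F₁ ⊆ V := fun v hv => by simp [hV, hv]
  have h2 : F₂ ⊆ V := fun v hv => by simp [hV, hv]
  have hp : ∀ v ∈ F₂, ∀ u, K.par v = some u → u ∈ V := fun v hv u hu => by
    simp only [hV, Finset.mem_union, Finset.mem_eraseNone, Finset.mem_image]
    exact Or.inr ⟨v, hv, hu⟩
  have hS : ∀ v ∈ V, K.nB v ∈ S := fun v hv =>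
    Finset.mem_union_left _ (Finset.mem_image_of_mem _ hv)
  have hSC : ∀ v ∈ F₂, K.nC v ∈ S := fun v hv =>
    Finset.mem_union_right _ (Finset.mem_image_of_mem _ hv)
  have hmeas : MeasurableSet ((⋂ v ∈ F₁, K.vacant v) ∩ ⋂ v ∈ F₂, K.unlinked v) :=
    (Finset.measurableSet_biInter _ fun v _ => K.measurableSet_vacant v).inter
      (Finset.measurableSet_biInter _ fun v _ => K.measurableSet_unlinked v)
  rw [← lintegral_indicator_one hmeas, lintegral_law hd lam (measurable_one.indicator hmeas)]
  have hle : ∀ n, K.failFactor F₁ F₂ V n ≤ 1 := fun n =>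
    le_self_add.trans (K.failFactor_add_le hd (F₂ := F₂) h1 n)
  refine (lintegral_mono fun N => (lintegral_mono fun X =>
    K.lintegral_marks_le F₁ F₂ V N X S).trans (K.lintegral_pos_le hd h2 hp hS N)).trans ?_
  rw [lintegral_prod_shellLabels lam S _ fun n _ => hle n, ← ENNReal.ofReal_pow (Real.exp_pos _).le,
    ← Real.exp_nat_mul]
  refine ENNReal.ofReal_le_ofReal (Real.exp_le_exp.2 ?_)
  rw [mul_neg, neg_le_neg_iff]
  have hcard : ((F₁.card + F₂.card : ℕ) : ℝ) = ∑ n ∈ S, (((F₁.filter (K.nB · = n)).card : ℝ) +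
      ((F₂.filter (K.nC · = n)).card : ℝ)) := by
    rw [Finset.sum_add_distrib, Finset.card_eq_sum_card_fiberwise (f := K.nB) (t := S)
      fun v hv => hS v (h1 hv), Finset.card_eq_sum_card_fiberwise (f := K.nC) (t := S)
      fun v hv => hSC v hv]
    push_cast
    rfl
  rw [hcard, Finset.sum_mul]
  refine Finset.sum_le_sum fun n _ => ?_
  have h3 : (((F₁.filter (K.nB · = n)).card : ℝ≥0∞) + ((F₂.filter (K.nC · = n)).card : ℝ≥0∞)) *
      (lam * K.bound) ≤ shellMean d lam n * (1 - K.failFactor F₁ F₂ V n) := by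
    have h4 : (lam : ℝ≥0∞) * K.bound = shellMean d lam n * K.relBound n := by
      have h5 := (hvol_shell_pos hd n).ne'
      have h6 := (hvol_shell_lt_top (d := d) n).ne
      rw [shellMean, relBound, ENNReal.coe_mul, ENNReal.coe_toNNReal h6, mul_assoc,
        ← mul_assoc (hvol d (shell d n)), ENNReal.mul_inv_cancel h5 h6, one_mul]
    rw [h4, mul_left_comm, add_mul]
    gcongr
    exact ENNReal.le_sub_of_add_le_left ((hle n).trans_lt ENNReal.one_lt_top).ne
      (K.failFactor_add_le hd h1 n)
  have h7 := ENNReal.toReal_mono (ENNReal.mul_ne_top ENNReal.coe_ne_top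
    (ne_top_of_le_ne_top ENNReal.one_ne_top tsub_le_self)) h3
  rw [ENNReal.toReal_mul, ENNReal.toReal_mul, ENNReal.toReal_add (by simp) (by simp)] at h7
  simpa using h7

/-- Each failure is a vacancy or a missing link, and the union bound over these alternatives costs a
factor 2 per index. -/
lemma law_biInter_bad_le [Nonempty ι] (hd : 1 ≤ d) (lam : ℝ≥0) (F : Finset ι) :
    law d lam (⋂ v ∈ F, K.bad v) ≤
      (2 * ENNReal.ofReal (Real.exp (-(lam * K.bound.toReal)))) ^ F.card := by
  classical
  have hsub : ⋂ v ∈ F, K.bad v ⊆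
      ⋃ G ∈ F.powerset, ((⋂ v ∈ G, K.vacant v) ∩ ⋂ v ∈ F \ G, K.unlinked v) := by
    intro ω hω
    rw [Set.mem_iInter₂] at hω
    simp only [Set.mem_iUnion, Finset.mem_powerset]
    refine ⟨F.filter (ω ∈ K.vacant ·), Finset.filter_subset _ _, ?_, ?_⟩
    · rw [Set.mem_iInter₂]
      exact fun v hv => (Finset.mem_filter.1 hv).2
    · rw [Set.mem_iInter₂]
      intro v hv
      simp only [Finset.mem_sdiff, Finset.mem_filter, not_and] at hv
      exact (hω v hv.1).resolve_left (hv.2 hv.1)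
  refine (measure_mono hsub).trans ((measure_biUnion_finset_le _ _).trans ?_)
  refine (Finset.sum_le_sum fun G _ => K.law_vacant_unlinked_le hd lam G (F \ G)).trans ?_
  rw [Finset.sum_congr rfl fun G hG => by
    rw [add_comm, Finset.card_sdiff_add_card_eq_card (Finset.mem_powerset.1 hG)], Finset.sum_const,
    Finset.card_powerset, nsmul_eq_mul, mul_pow]
  push_cast
  rfl

end Skeleton

end HypRCM

end

noncomputable section

namespace HypRCM

variable {d : ℕ}

/-! ### Percolation on the binary tree

Nodes of the tree are lists of booleans, the children of `σ` being `true :: σ` and `false :: σ`.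
The edge from `σ` to `i :: σ` is denoted by `(σ, i)`. -/

section BinaryTree

variable {Ω : Type*}

/-- The event that no descending path of length `n` from `σ` avoids the failing edges `b`. -/
def treeFail (b : List Bool × Bool → Set Ω) : ℕ → List Bool → Set Ω
  | 0, _ => ∅
  | n + 1, σ => ⋂ i, (b (σ, i) ∪ treeFail b n (i :: σ))

lemma treeFail_mono (b : List Bool × Bool → Set Ω) (n : ℕ) (σ : List Bool) :
    treeFail b n σ ⊆ treeFail b (n + 1) σ := by
  induction n generalizing σ with
  | zero => exact Set.empty_subset _
  | succ n ih => exact Set.iInter_mono fun i => Set.union_subset_union_right _ (ih _)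

lemma measurableSet_treeFail [MeasurableSpace Ω] {b : List Bool × Bool → Set Ω}
    (hb : ∀ e, MeasurableSet (b e)) (n : ℕ) (σ : List Bool) : MeasurableSet (treeFail b n σ) := by
  induction n generalizing σ with
  | zero => exact MeasurableSet.empty
  | succ n ih => exact MeasurableSet.iInter fun i => (hb _).union (ih _)

/-- Below each node of `A`, either an outgoing edge is bad or its child fails in turn. The
alternatives for the 2|A| edges number 4^|A|, and each has |F| + 2|A| failures in the next
generation, so the induction closes because 4 · 8⁻² ≤ 8⁻¹. The length conditions keep new bad edges
distinct from those in `F`. -/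
lemma measure_treeFail_le [MeasurableSpace Ω] (μ : Measure Ω) {b : List Bool × Bool → Set Ω}
    (hb : ∀ F : Finset (List Bool × Bool), μ (⋂ e ∈ F, b e) ≤ (8 : ℝ≥0∞)⁻¹ ^ F.card) (n : ℕ) :
    ∀ (L : ℕ) (F : Finset (List Bool × Bool)) (A : Finset (List Bool)),
      (∀ e ∈ F, e.1.length < L) → (∀ a ∈ A, a.length = L) →
      μ ((⋂ e ∈ F, b e) ∩ ⋂ a ∈ A, treeFail b n a) ≤ (8 : ℝ≥0∞)⁻¹ ^ (F.card + A.card) := by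
  induction n with
  | zero =>
    intro L F A _ _
    rcases A.eq_empty_or_nonempty with rfl | ⟨a, ha⟩
    · simpa using hb F
    · have : (⋂ e ∈ F, b e) ∩ ⋂ a ∈ A, treeFail b 0 a ⊆ ∅ := by
        rintro ω ⟨_, h⟩
        exact Set.mem_iInter₂.1 h a ha
      rw [Set.subset_empty_iff.1 this, measure_empty]
      exact zero_le
  | succ n ih =>
    intro L F A hF hA
    set P : Finset (List Bool × Bool) := A ×ˢ Finset.univ with hP
    have hsub : (⋂ e ∈ F, b e) ∩ ⋂ a ∈ A, treeFail b (n + 1) a ⊆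
        ⋃ G ∈ P.powerset, ((⋂ e ∈ F ∪ G, b e) ∩
          ⋂ a ∈ (P \ G).image (fun e => e.2 :: e.1), treeFail b n a) := by
      classical
      rintro ω ⟨h1, h2⟩
      rw [Set.mem_iInter₂] at h1 h2
      simp only [Set.mem_iUnion, Finset.mem_powerset]
      refine ⟨P.filter (ω ∈ b ·), Finset.filter_subset _ _, ?_, ?_⟩
      · rw [Set.mem_iInter₂]
        intro e he
        rcases Finset.mem_union.1 he with h | h
        · exact h1 e h
        · exact (Finset.mem_filter.1 h).2
      · rw [Set.mem_iInter₂]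
        intro a ha
        obtain ⟨e, he, rfl⟩ := Finset.mem_image.1 ha
        simp only [Finset.mem_sdiff, Finset.mem_filter, not_and] at he
        have h3 := h2 e.1 (Finset.mem_product.1 he.1).1
        rw [treeFail, Set.mem_iInter] at h3
        exact (h3 e.2).resolve_left (he.2 he.1)
    refine (measure_mono hsub).trans ((measure_biUnion_finset_le _ _).trans ?_)
    have hPc : P.card = 2 * A.card := by
      rw [hP, Finset.card_product, Finset.card_univ, Fintype.card_bool, mul_comm]
    have hPA : ∀ e ∈ P, e.1.length = L := fun e he => hA _ (Finset.mem_product.1 he).1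
    have hterm : ∀ G ∈ P.powerset, μ ((⋂ e ∈ F ∪ G, b e) ∩
        ⋂ a ∈ (P \ G).image (fun e => e.2 :: e.1), treeFail b n a) ≤
        (8 : ℝ≥0∞)⁻¹ ^ (F.card + 2 * A.card) := by
      intro G hG
      rw [Finset.mem_powerset] at hG
      have hlen1 : ∀ e ∈ F ∪ G, e.1.length < L + 1 := by
        intro e he
        rcases Finset.mem_union.1 he with h | h
        · exact (hF e h).trans (Nat.lt_succ_self L)
        · rw [hPA e (hG h)]; exact Nat.lt_succ_self L
      have hlen2 : ∀ a ∈ (P \ G).image (fun e => e.2 :: e.1), a.length = L + 1 := by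
        intro a ha
        obtain ⟨e, he, rfl⟩ := Finset.mem_image.1 ha
        rw [List.length_cons, hPA e (Finset.mem_sdiff.1 he).1]
      have hdisj : Disjoint F G := Finset.disjoint_left.2 fun e h1 h2 =>
        (hF e h1).ne (hPA e (hG h2))
      have hinj : Function.Injective fun e : List Bool × Bool => e.2 :: e.1 := by
        rintro ⟨a, i⟩ ⟨a', i'⟩ h
        simp only [List.cons.injEq] at h
        rw [h.1, h.2]
      have hcard : (F ∪ G).card + ((P \ G).image fun e => e.2 :: e.1).card =
          F.card + 2 * A.card := by
        rw [Finset.card_union_of_disjoint hdisj, Finset.card_image_of_injective _ hinj,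
          add_assoc, add_comm G.card, Finset.card_sdiff_add_card_eq_card hG, hPc]
      have key := ih (L + 1) (F ∪ G) _ hlen1 hlen2
      rwa [hcard] at key
    refine (Finset.sum_le_sum hterm).trans ?_
    rw [Finset.sum_const, Finset.card_powerset, hPc, nsmul_eq_mul, pow_add, pow_add,
      mul_left_comm]
    gcongr
    rw [pow_mul, pow_mul]
    push_cast
    rw [← mul_pow]
    gcongr
    calc (4 : ℝ≥0∞) * 8⁻¹ ^ 2 = (4 * 8⁻¹) * 8⁻¹ := by
          rw [sq (8⁻¹ : ℝ≥0∞), ← mul_assoc]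
      _ ≤ (8 * 8⁻¹) * 8⁻¹ := by gcongr; norm_num
      _ = 8⁻¹ := by rw [ENNReal.mul_inv_cancel (by norm_num) (by norm_num), one_mul]

lemma measure_iUnion_treeFail_le [MeasurableSpace Ω] (μ : Measure Ω) {b : List Bool × Bool → Set Ω}
    (hb : ∀ F : Finset (List Bool × Bool), μ (⋂ e ∈ F, b e) ≤ (8 : ℝ≥0∞)⁻¹ ^ F.card) :
    μ (⋃ n, treeFail b n []) ≤ 8⁻¹ := by
  rw [Monotone.measure_iUnion (monotone_nat_of_le_succ fun n => treeFail_mono b n [])]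
  refine iSup_le fun n => ?_
  have := measure_treeFail_le μ hb n 0 ∅ {[]} (by simp) (by simp)
  simpa using this

lemma exists_path_of_notMem_treeFail {b : List Bool × Bool → Set Ω} {ω : Ω}
    {P : List Bool → Prop} (hP : ∀ σ i, P σ → ω ∉ b (σ, i) → P (i :: σ)) (n : ℕ) (σ : List Bool)
    (hσ : P σ) (h : ω ∉ treeFail b n σ) : ∃ τ, τ.length = n + σ.length ∧ P τ := by
  induction n generalizing σ with
  | zero => exact ⟨σ, by simp, hσ⟩
  | succ n ih =>
    rw [treeFail, Set.mem_iInter] at h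
    push Not at h
    obtain ⟨i, hi⟩ := h
    rw [Set.mem_union, not_or] at hi
    obtain ⟨τ, hτ, hPτ⟩ := ih (i :: σ) (hP σ i hσ hi.1) hi.2
    exact ⟨τ, by rw [hτ, List.length_cons]; omega, hPτ⟩

end BinaryTree

/-! ### Skeletons over the subdivided binary tree -/

/-- The last vertex on the subdivided edge leading to a node. -/
def nodeEnd (k : ℕ) : List Bool → Option (List Bool × Bool × Fin (k + 1))
  | [] => none
  | i :: σ => some (σ, i, Fin.last k)

/-- The parent of a vertex of the subdivided binary tree. -/
def treePar {k : ℕ} : List Bool × Bool × Fin (k + 1) → Option (List Bool × Bool × Fin (k + 1))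
  | (σ, _, ⟨0, _⟩) => nodeEnd k σ
  | (σ, i, ⟨j + 1, h⟩) => some (σ, i, ⟨j, by omega⟩)

lemma treePar_ne {k : ℕ} (v : List Bool × Bool × Fin (k + 1)) : treePar v ≠ some v := by
  obtain ⟨σ, i, j, hj⟩ := v
  cases j with
  | zero =>
    cases σ with
    | nil => simp [treePar, nodeEnd]
    | cons i' σ =>
      intro h
      simp only [treePar, nodeEnd, Option.some.injEq, Prod.mk.injEq] at h
      have := congrArg List.length h.1
      simp at this
  | succ j => simp [treePar]

namespace Skeleton

variable {φ : ConnectionFunction d} {k : ℕ} (K : Skeleton φ (List Bool × Bool × Fin (k + 1)))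

/-- Failure on a subdivided edge. -/
def edgeBad (e : List Bool × Bool) : Set (Sample d) := ⋃ j, K.bad (e.1, e.2, j)

/-- A bad subdivided edge has a bad link, with k + 1 possibilities for its place; links chosen on
distinct edges are distinct. -/
lemma law_biInter_edgeBad_le (hd : 1 ≤ d) (lam : ℝ≥0) (F : Finset (List Bool × Bool)) :
    law d lam (⋂ e ∈ F, K.edgeBad e) ≤
      ((k + 1 : ℕ) * (2 * ENNReal.ofReal (Real.exp (-(lam * K.bound.toReal))))) ^ F.card := by
  classical
  have hsub : ⋂ e ∈ F, K.edgeBad e ⊆ ⋃ J ∈ (Finset.univ : Finset (F → Fin (k + 1))),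
      ⋂ v ∈ F.attach.image (fun e => (e.1.1, e.1.2, J e)), K.bad v := by
    intro ω hω
    rw [Set.mem_iInter₂] at hω
    have h1 : ∀ e : F, ∃ j, ω ∈ K.bad (e.1.1, e.1.2, j) := fun e => Set.mem_iUnion.1 (hω e.1 e.2)
    choose J hJ using h1
    simp only [Set.mem_iUnion]
    refine ⟨J, Finset.mem_univ _, ?_⟩
    rw [Set.mem_iInter₂]
    intro v hv
    obtain ⟨e, _, rfl⟩ := Finset.mem_image.1 hv
    exact hJ e
  refine (measure_mono hsub).trans ((measure_biUnion_finset_le _ _).trans ?_)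
  have hcard : ∀ J : F → Fin (k + 1),
      (F.attach.image (fun e => (e.1.1, e.1.2, J e))).card = F.card := by
    intro J
    rw [Finset.card_image_of_injective, Finset.card_attach]
    intro e e' h
    simp only [Prod.mk.injEq] at h
    exact Subtype.ext (Prod.ext h.1 h.2.1)
  refine (Finset.sum_le_sum fun J _ => K.law_biInter_bad_le hd lam _).trans ?_
  rw [Finset.sum_congr rfl fun J _ => by rw [hcard J], Finset.sum_const, Finset.card_univ,
    Fintype.card_fun, Fintype.card_fin, Fintype.card_coe, nsmul_eq_mul, mul_pow (((k + 1 : ℕ)) : ℝ≥0∞)]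
  push_cast
  rfl

/-- The representative exists and is connected to the root. -/
def Reached (ω : Sample d) (i : Option (List Bool × Bool × Fin (k + 1))) : Prop :=
  K.Live (ω.1, ω.2.1) i ∧ (graph φ ω).Reachable none (K.repLabel (ω.1, ω.2.1) i)

lemma reached_of_notMem_edgeBad (hpar : ∀ v, K.par v = treePar v) {ω : Sample d} {σ : List Bool}
    {i : Bool} (hσ : K.Reached ω (nodeEnd k σ)) (h : ω ∉ K.edgeBad (σ, i)) :
    K.Reached ω (nodeEnd k (i :: σ)) := by
  have hgood : ∀ j, ω ∉ K.bad (σ, i, j) := fun j hj => h (Set.mem_iUnion.2 ⟨j, hj⟩)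
  have step : ∀ v, ω ∉ K.bad v → K.Reached ω (treePar v) → K.Reached ω (some v) := by
    intro v hv hr
    rw [← hpar v] at hr
    exact ⟨K.live_of_notMem_bad hv, hr.2.trans (K.reachable_of_notMem_bad hv hr.1)⟩
  have hall : ∀ (j : ℕ) (hj : j < k + 1), K.Reached ω (some (σ, i, ⟨j, hj⟩)) := by
    intro j
    induction j with
    | zero => exact fun hj => step _ (hgood _) hσ
    | succ j ih => exact fun hj => step _ (hgood _) (ih (by omega))
  exact hall k (Nat.lt_succ_self k)

/-- Nodes of every generation are reached, and their representatives are different points because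
the regions are disjoint. Paths of length n + 1 are used because the empty word corresponds to the
root and has no region. -/
lemma infinite_cluster (hpar : ∀ v, K.par v = treePar v) {ω : Sample d}
    (h : ω ∉ ⋃ n, treeFail K.edgeBad n []) : (cluster φ ω).Infinite := by
  rw [Set.mem_iUnion, not_exists] at h
  have h1 : ∀ n, ∃ τ : List Bool, τ.length = n + 1 ∧ K.Reached ω (nodeEnd k τ) := fun n => by
    obtain ⟨τ, hτ, hr⟩ := exists_path_of_notMem_treeFail (b := K.edgeBad)
      (P := fun σ => K.Reached ω (nodeEnd k σ))
      (fun σ i hσ hb => K.reached_of_notMem_edgeBad hpar hσ hb) (n + 1) []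
      ⟨trivial, SimpleGraph.Reachable.refl _⟩ (h (n + 1))
    exact ⟨τ, by simpa using hτ, hr⟩
  have h2 : ∀ n, ∃ v : List Bool × Bool × Fin (k + 1), v.1.length = n ∧ K.Reached ω (some v) := by
    intro n
    obtain ⟨τ, hτ, hr⟩ := h1 n
    cases τ with
    | nil => simp at hτ
    | cons i σ => exact ⟨(σ, i, Fin.last k), by simpa using hτ, hr⟩
  choose v hv hr using h2
  refine Set.infinite_of_injective_forall_mem (f := fun n => K.repPos (ω.1, ω.2.1) (some (v n)))
    ?_ ?_
  · intro m n hmn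
    by_contra hne
    have hvne : v m ≠ v n := fun hc => hne (by rw [← hv m, ← hv n, hc])
    refine Set.disjoint_left.1 (K.disjB _ _ hvne) (K.repPos_mem (ω.1, ω.2.1) (v m)) ?_
    simp only at hmn
    rw [hmn]
    exact K.repPos_mem _ _
  · intro n
    refine ⟨_, (hr n).2, ?_⟩
    rw [position_eq_pos]
    exact K.pos_repLabel (hr n).1

theorem exists_chi_eq_top_and_theta_pos (hd : 1 ≤ d) (hpar : ∀ v, K.par v = treePar v)
    (hb : K.bound ≠ 0) : ∃ lam : ℝ≥0, 0 < lam ∧ chi φ lam = ⊤ ∧ 0 < theta φ lam := by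
  have hpos : 0 < K.bound.toReal := ENNReal.toReal_pos hb K.bound_ne_top
  obtain ⟨lam, hlam, hle⟩ : ∃ lam : ℝ≥0, 0 < lam ∧
      ((k + 1 : ℕ) : ℝ≥0∞) * (2 * ENNReal.ofReal (Real.exp (-(lam * K.bound.toReal)))) ≤ 8⁻¹ := by
    -- This makes the exponent 16(k + 1), and exp(-x) ≤ 1/x then bounds the failure rate of an edge
    -- by 2(k + 1) / (16(k + 1)) = 1/8.
    refine ⟨Real.toNNReal ((16 * (k + 1)) / K.bound.toReal), ?_, ?_⟩
    · rw [Real.toNNReal_pos]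
      exact div_pos (by positivity) hpos
    · rw [Real.coe_toNNReal _ (by positivity), div_mul_cancel₀ _ hpos.ne']
      have h1 : Real.exp (-(16 * (k + 1 : ℝ))) ≤ 1 / (16 * (k + 1)) := by
        rw [Real.exp_neg, ← one_div]
        refine one_div_le_one_div_of_le (by positivity) ?_
        linarith [Real.add_one_le_exp (16 * (k + 1 : ℝ))]
      calc ((k + 1 : ℕ) : ℝ≥0∞) * (2 * ENNReal.ofReal (Real.exp (-(16 * (k + 1 : ℝ)))))
          = ENNReal.ofReal ((k + 1 : ℕ) * (2 * Real.exp (-(16 * (k + 1 : ℝ))))) := by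
            rw [ENNReal.ofReal_mul (by positivity), ENNReal.ofReal_mul (by norm_num),
              ENNReal.ofReal_natCast]
            norm_num
        _ ≤ ENNReal.ofReal 8⁻¹ := by
            refine ENNReal.ofReal_le_ofReal ?_
            push_cast
            calc ((k : ℝ) + 1) * (2 * Real.exp (-(16 * (k + 1 : ℝ))))
                ≤ ((k : ℝ) + 1) * (2 * (1 / (16 * (k + 1)))) := by gcongr
              _ = 8⁻¹ := by field_simp; norm_num
        _ = 8⁻¹ := by rw [ENNReal.ofReal_inv_of_pos (by norm_num)]; norm_num
  have hprob := isProbabilityMeasure_law (d := d) hd lam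
  have hmeas : ∀ e, MeasurableSet (K.edgeBad e) := fun e =>
    MeasurableSet.iUnion fun j => K.measurableSet_bad _
  have hT : MeasurableSet (⋃ n, treeFail K.edgeBad n []) :=
    MeasurableSet.iUnion fun n => measurableSet_treeFail hmeas n []
  have hT1 : law d lam (⋃ n, treeFail K.edgeBad n []) ≤ 8⁻¹ :=
    measure_iUnion_treeFail_le _ fun F => (K.law_biInter_edgeBad_le hd lam F).trans
      (by gcongr)
  refine ⟨lam, hlam, chi_eq_top_and_theta_pos_of_event φ hT.compl ?_
    fun ω hω => K.infinite_cluster hpar hω⟩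
  rw [prob_compl_eq_one_sub hT]
  refine tsub_pos_of_lt (hT1.trans_lt ?_)
  rw [ENNReal.inv_lt_one]
  norm_num

end Skeleton

end HypRCM

end

noncomputable section

namespace HypRCM

/-! ### Ping-pong -/

section PingPong

variable {X : Type*}

/-- The map of a word; the first letter acts first. -/
def wordMap (E : Bool → X → X) : List Bool → X → X
  | [] => id
  | i :: σ => wordMap E σ ∘ E i

lemma wordMap_append_singleton (E : Bool → X → X) (σ : List Bool) (i : Bool) :
    wordMap E (σ ++ [i]) = E i ∘ wordMap E σ := by
  induction σ with
  | nil => rfl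
  | cons j σ ih => rw [List.cons_append, wordMap, ih, wordMap]; rfl

/-- The last letter of a word acts last and places the image in the attracting set `W i` of that
letter. Different last letters, or one empty word, give disjointness at once; a common last letter
is removed by injectivity. Only forward words occur, so no repelling sets are needed. -/
lemma disjoint_image_wordMap {J : Type*} {E : Bool → X → X} (hE : ∀ i, Function.Injective (E i))
    {P : J → Set X} {W : Bool → Set X} (hPP : ∀ j j', j ≠ j' → Disjoint (P j) (P j'))
    (hPW : ∀ j i, Disjoint (P j) (W i)) (hWW : ∀ i i', i ≠ i' → Disjoint (W i) (W i'))
    (hEP : ∀ i j, ∀ x ∈ P j, E i x ∈ W i) (hEW : ∀ i i', ∀ x ∈ W i', E i x ∈ W i)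
    (σ τ : List Bool) (j j' : J) (hne : (σ, j) ≠ (τ, j')) :
    Disjoint (wordMap E σ '' P j) (wordMap E τ '' P j') := by
  have hW : ∀ (σ : List Bool) (j : J) (i : Bool), ∀ x ∈ P j, E i (wordMap E σ x) ∈ W i := by
    intro σ j
    induction σ using List.reverseRecOn with
    | nil => exact fun i x hx => hEP i j x hx
    | append_singleton σ i' ih =>
      intro i x hx
      rw [wordMap_append_singleton]
      exact hEW i i' _ (ih i' x hx)
  have hmem : ∀ (σ : List Bool) (i : Bool) (j : J),
      wordMap E (σ ++ [i]) '' P j ⊆ W i := by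
    rintro σ i j _ ⟨x, hx, rfl⟩
    rw [wordMap_append_singleton]
    exact hW σ j i x hx
  induction σ using List.reverseRecOn generalizing τ with
  | nil =>
    rcases List.eq_nil_or_concat' τ with rfl | ⟨τ', i, rfl⟩
    · simp only [wordMap, Set.image_id]
      exact hPP j j' fun h => hne (by rw [h])
    · simp only [wordMap, Set.image_id]
      exact (hPW j i).mono_right (hmem τ' i j')
  | append_singleton σ i ih =>
    rcases List.eq_nil_or_concat' τ with rfl | ⟨τ', i', rfl⟩
    · simp only [wordMap, Set.image_id]
      exact (hPW j' i).symm.mono_left (hmem σ i j)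
    · by_cases hii : i = i'
      · subst hii
        rw [wordMap_append_singleton, wordMap_append_singleton, Set.image_comp, Set.image_comp]
        refine Set.disjoint_image_of_injective (hE i) (ih τ' fun h => hne ?_)
        rw [Prod.mk.injEq] at h ⊢
        exact ⟨by rw [h.1], h.2⟩
      · exact (hWW i i' hii).mono (hmem σ i j) (hmem τ' i' j')

end PingPong

/-! ### Horospherical coordinates along an axis -/

variable {d : ℕ}

/-- The quotient `‖x + e‖² / (1 - ‖x‖²)` for a unit vector `e`. -/
def horo (e : EuclideanSpace ℝ (Fin d)) (x : HSpace d) : ℝ :=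
  (1 + ‖(x : EuclideanSpace ℝ (Fin d))‖ ^ 2 + 2 * inner ℝ (x : EuclideanSpace ℝ (Fin d)) e) /
    (1 - ‖(x : EuclideanSpace ℝ (Fin d))‖ ^ 2)

lemma abs_inner_le_norm_of_norm_eq_one {E : Type*} [NormedAddCommGroup E] [InnerProductSpace ℝ E]
    {e : E} (he : ‖e‖ = 1) (x : E) : |inner ℝ x e| ≤ ‖x‖ := by
  simpa [he] using abs_real_inner_le_norm x e

lemma horo_pos {e : EuclideanSpace ℝ (Fin d)} (he : ‖e‖ = 1) (x : HSpace d) : 0 < horo e x := by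
  refine div_pos ?_ (one_sub_norm_sq_pos x)
  have h1 := (abs_le.1 (abs_inner_le_norm_of_norm_eq_one he
    (x : EuclideanSpace ℝ (Fin d)))).1
  nlinarith [norm_coe_lt x, sq_nonneg (1 - ‖(x : EuclideanSpace ℝ (Fin d))‖)]

/-- The function `horo e` is the reciprocal of the Poisson kernel at the ideal point -e, which
translations along this diameter fix; they multiply it by a constant, namely its value at the image
of the origin. -/
lemma horo_mobiusAdd {e : EuclideanSpace ℝ (Fin d)} (he : ‖e‖ = 1) {a : HSpace d} {r : ℝ}
    (ha : (a : EuclideanSpace ℝ (Fin d)) = r • e) (hr : |r| < 1) (x : HSpace d) :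
    horo e (mobiusAdd a x) = (1 + r) / (1 - r) * horo e x := by
  obtain ⟨hr1, hr2⟩ := abs_lt.1 hr
  have hD := (mobDen_pos a x).ne'
  have hn : ‖(a : EuclideanSpace ℝ (Fin d))‖ ^ 2 = r ^ 2 := by
    rw [ha, norm_smul, he, mul_one, Real.norm_eq_abs, sq_abs]
  have hin : inner ℝ (a : EuclideanSpace ℝ (Fin d)) (x : EuclideanSpace ℝ (Fin d)) =
      r * inner ℝ (x : EuclideanSpace ℝ (Fin d)) e := by
    rw [ha, inner_smul_left, real_inner_comm]; rfl
  have hae : inner ℝ (a : EuclideanSpace ℝ (Fin d)) e = r := by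
    rw [ha, inner_smul_left, real_inner_self_eq_norm_sq, he]; simp
  have hX := (one_sub_norm_sq_pos x).ne'
  have h1 : (1 - r) ≠ 0 := by linarith
  have h2 : (1 + r) ≠ 0 := by linarith
  have h3 : inner ℝ (mobVec (a : EuclideanSpace ℝ (Fin d)) x) e =
      ((1 + 2 * inner ℝ (a : EuclideanSpace ℝ (Fin d)) (x : EuclideanSpace ℝ (Fin d)) +
        ‖(x : EuclideanSpace ℝ (Fin d))‖ ^ 2) * r +
        (1 - r ^ 2) * inner ℝ (x : EuclideanSpace ℝ (Fin d)) e) /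
        mobDen (a : EuclideanSpace ℝ (Fin d)) x := by
    rw [mobVec, inner_smul_left, inner_add_left, inner_smul_left, inner_smul_left, hae, hn]
    simp only [conj_trivial]
    rw [inv_mul_eq_div]
  rw [horo, one_sub_norm_sq_mobiusAdd, coe_mobiusAdd, norm_sq_mobVec hD, h3, horo]
  have h4 : mobDen (a : EuclideanSpace ℝ (Fin d)) x =
      1 + 2 * (r * inner ℝ (x : EuclideanSpace ℝ (Fin d)) e) +
        r ^ 2 * ‖(x : EuclideanSpace ℝ (Fin d))‖ ^ 2 := by
    rw [mobDen, hin, hn]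
  rw [hn, hin]
  generalize mobDen (a : EuclideanSpace ℝ (Fin d)) x = D at hD h4
  have h5 : (1 - r ^ 2) ≠ 0 := by
    rw [show 1 - r ^ 2 = (1 - r) * (1 + r) by ring]; exact mul_ne_zero h1 h2
  field_simp
  rw [h4]
  ring

end HypRCM

end

noncomputable section

namespace HypRCM

variable {d : ℕ}

/-! ### Cones in the Klein model -/

/-- The point of the Klein model corresponding to a point of the Poincaré model. -/
def klein (x : HSpace d) : EuclideanSpace ℝ (Fin d) :=
  (2 / (1 + ‖(x : EuclideanSpace ℝ (Fin d))‖ ^ 2)) • (x : EuclideanSpace ℝ (Fin d))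

lemma norm_sq_klein (x : HSpace d) : ‖klein x‖ ^ 2 =
    4 * ‖(x : EuclideanSpace ℝ (Fin d))‖ ^ 2 / (1 + ‖(x : EuclideanSpace ℝ (Fin d))‖ ^ 2) ^ 2 := by
  rw [klein, norm_smul, mul_pow, Real.norm_eq_abs, sq_abs, div_pow, div_mul_eq_mul_div]
  norm_num

lemma norm_sq_klein_le_one (x : HSpace d) : ‖klein x‖ ^ 2 ≤ 1 := by
  rw [norm_sq_klein, div_le_one (by positivity)]
  nlinarith [sq_nonneg (1 - ‖(x : EuclideanSpace ℝ (Fin d))‖ ^ 2)]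

lemma inner_klein (x : HSpace d) (e : EuclideanSpace ℝ (Fin d)) : inner ℝ (klein x) e =
    2 * inner ℝ (x : EuclideanSpace ℝ (Fin d)) e /
      (1 + ‖(x : EuclideanSpace ℝ (Fin d))‖ ^ 2) := by
  rw [klein, inner_smul_left]
  simp only [conj_trivial]
  ring

lemma inner_klein_eq_horo (x : HSpace d) (e : EuclideanSpace ℝ (Fin d)) :
    inner ℝ (klein x) e = (horo e x - horo (-e) x) / (horo e x + horo (-e) x) := by
  have h1 := (one_sub_norm_sq_pos x).ne'
  have h2 : 1 + ‖(x : EuclideanSpace ℝ (Fin d))‖ ^ 2 ≠ 0 := by positivity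
  rw [inner_klein, horo, horo, inner_neg_right, ← sub_div, ← add_div, div_div_div_cancel_right₀ h1,
    div_eq_div_iff h2 (by intro h; apply h2; linarith)]
  ring

/-- Translations along the axis multiply `horo e` and `horo (-e)` by inverse factors, so their
product is invariant. It controls the distance of the Klein point from the axis uniformly over all
translates of a cell. -/
lemma norm_sq_klein_sub_le {e : EuclideanSpace ℝ (Fin d)} (he : ‖e‖ = 1) (x : HSpace d) :
    ‖klein x‖ ^ 2 - inner ℝ (klein x) e ^ 2 ≤ horo e x * horo (-e) x - 1 := by
  have h1 := one_sub_norm_sq_pos x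
  have hs := abs_inner_le_norm_of_norm_eq_one he (x : EuclideanSpace ℝ (Fin d))
  have hs2 := sq_le_sq' (by linarith [(abs_le.1 hs).1]) (abs_le.1 hs).2
  rw [inner_klein, norm_sq_klein, horo, horo, inner_neg_right, div_pow, ← sub_div,
    div_mul_div_comm, div_sub_one (mul_pos h1 h1).ne']
  set X := ‖(x : EuclideanSpace ℝ (Fin d))‖ ^ 2 with hX
  set s := inner ℝ (x : EuclideanSpace ℝ (Fin d)) e with hs'
  have hX0 : 0 ≤ X := by positivity
  have h3 : (1 + X + 2 * s) * (1 + X + 2 * -s) - (1 - X) * (1 - X) = 4 * X - (2 * s) ^ 2 := by ring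
  rw [h3]
  refine div_le_div_of_nonneg_left (by nlinarith) (mul_pos h1 h1) (by nlinarith)

/-- With α and β the two horospherical coordinates, the left side is 4αβ / (α + β)². A large ratio
α/β thus puts the Klein point near the end of the axis. -/
lemma one_sub_sq_inner_klein_le {e : EuclideanSpace ℝ (Fin d)} (he : ‖e‖ = 1) (x : HSpace d) :
    1 - inner ℝ (klein x) e ^ 2 ≤ 4 * horo (-e) x / horo e x := by
  have ha := horo_pos he x
  have hb := horo_pos (e := -e) (by rwa [norm_neg]) x
  rw [inner_klein_eq_horo, div_pow, one_sub_div (by positivity), div_le_div_iff₀ (by positivity) ha]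
  nlinarith [mul_pos ha hb, mul_pos (mul_pos hb hb) ha, mul_pos (mul_pos hb hb) hb]

/-- A cone around the ray spanned by the unit vector `e`. -/
def cone (e : EuclideanSpace ℝ (Fin d)) (q δ : ℝ) : Set (HSpace d) :=
  {x | q * horo (-e) x ≤ horo e x ∧ ‖klein x‖ ^ 2 - inner ℝ (klein x) e ^ 2 ≤ δ ^ 2}

lemma le_inner_klein_of_mem_cone {e : EuclideanSpace ℝ (Fin d)} (he : ‖e‖ = 1) {q δ : ℝ}
    (hq : 1 < q) {x : HSpace d} (hx : x ∈ cone e q δ) :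
    (q - 1) / (q + 1) ≤ inner ℝ (klein x) e := by
  have ha := horo_pos he x
  have hb := horo_pos (e := -e) (by rwa [norm_neg]) x
  rw [inner_klein_eq_horo, div_le_div_iff₀ (by linarith) (by linarith)]
  nlinarith [hx.1]

lemma abs_inner_sub_le {E : Type*} [NormedAddCommGroup E] [InnerProductSpace ℝ E] {u e e' : E}
    (he : ‖e‖ = 1) (he' : ‖e'‖ = 1) {δ : ℝ} (hδ : 0 ≤ δ)
    (h : ‖u‖ ^ 2 - inner ℝ u e ^ 2 ≤ δ ^ 2) :
    |inner ℝ u e' - inner ℝ u e * inner ℝ e e'| ≤ δ := by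
  have h1 : inner ℝ u e' - inner ℝ u e * inner ℝ e e' = inner ℝ (u - inner ℝ u e • e) e' := by
    rw [inner_sub_left, inner_smul_left]; rfl
  rw [h1]
  refine (abs_inner_le_norm_of_norm_eq_one he' _).trans (abs_le_of_sq_le_sq' ?_ hδ).2
  rw [norm_sub_sq_real, inner_smul_right, norm_smul, he, mul_one, Real.norm_eq_abs, sq_abs]
  linarith

/-- With c the inner product of the axes, a common Klein point u would satisfy u·e' ≤ c(u·e) + δ and
u·e ≤ c(u·e') + δ, hence (1 - c²)(u·e) ≤ 2δ; but u·e is at least (q - 1)/(q + 1). -/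
lemma disjoint_cone {e e' : EuclideanSpace ℝ (Fin d)} (he : ‖e‖ = 1) (he' : ‖e'‖ = 1) {q δ : ℝ}
    (hq : 1 < q) (hδ : 0 ≤ δ) (hc0 : 0 ≤ inner ℝ e e') (hc1 : inner ℝ e e' < 1)
    (hδq : 2 * δ < (q - 1) / (q + 1) * (1 - inner ℝ e e' ^ 2)) :
    Disjoint (cone e q δ) (cone e' q δ) := by
  rw [Set.disjoint_left]
  intro x hx hx'
  have h1 := le_inner_klein_of_mem_cone he hq hx
  have h3 := (abs_le.1 (abs_inner_sub_le he he' hδ hx.2)).2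
  have h4 := (abs_le.1 (abs_inner_sub_le he' he hδ hx'.2)).2
  rw [real_inner_comm e e'] at h4
  have h5 : 0 < 1 - inner ℝ e e' ^ 2 := by nlinarith
  nlinarith [mul_le_mul_of_nonneg_left h3 hc0, mul_le_mul_of_nonneg_right h1 h5.le]

/-- As the angle between the axes is at most π/2, a thin cone around one axis cannot reach far in
the negative direction of the other. -/
lemma horo_neg_lt_of_mem_cone {e e' : EuclideanSpace ℝ (Fin d)} (he : ‖e‖ = 1) (he' : ‖e'‖ = 1)
    {q δ : ℝ} (hq : 1 < q) (hδ : 0 ≤ δ) (hc0 : 0 ≤ inner ℝ e e') (hδq : δ < (q - 1) / (q + 1))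
    {x : HSpace d} (hx : x ∈ cone e q δ) : horo (-e') x < q * horo e' x := by
  have h1 := le_inner_klein_of_mem_cone he hq hx
  have h2 := (abs_le.1 (abs_inner_sub_le he he' hδ hx.2)).1
  have h3 : -((q - 1) / (q + 1)) < inner ℝ (klein x) e' := by
    have : 0 ≤ inner ℝ (klein x) e * inner ℝ e e' :=
      mul_nonneg ((div_pos (by linarith) (by linarith)).le.trans h1) hc0
    linarith
  have ha := horo_pos he' x
  have hb := horo_pos (e := -e') (by rwa [norm_neg]) x
  rw [inner_klein_eq_horo, ← neg_div, div_lt_div_iff₀ (by linarith) (by linarith)] at h3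
  nlinarith

/-- The Euclidean ball of radius `r` around the origin. -/
def cell (d : ℕ) (r : ℝ) : Set (HSpace d) := {x | ‖(x : EuclideanSpace ℝ (Fin d))‖ < r}

lemma isOpen_cell (r : ℝ) : IsOpen (cell d r) :=
  isOpen_lt (by fun_prop) continuous_const

lemma origin_mem_cell {r : ℝ} (hr : 0 < r) : origin d ∈ cell d r := by
  simpa [cell] using hr

lemma horo_lt_of_mem_cell {e : EuclideanSpace ℝ (Fin d)} (he : ‖e‖ = 1) {q r : ℝ} (hq : 1 < q)
    (hr : 2 * r ≤ (q - 1) / (q + 1)) {x : HSpace d} (hx : x ∈ cell d r) :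
    horo e x < q * horo (-e) x := by
  have ha := horo_pos he x
  have hb := horo_pos (e := -e) (by rwa [norm_neg]) x
  have h3 : inner ℝ (klein x) e < (q - 1) / (q + 1) := by
    have h1 := (abs_le.1 (abs_inner_le_norm_of_norm_eq_one he (x : EuclideanSpace ℝ (Fin d)))).2
    have h2 : ‖(x : EuclideanSpace ℝ (Fin d))‖ < r := hx
    have h4 := norm_nonneg (x : EuclideanSpace ℝ (Fin d))
    rw [inner_klein]
    refine lt_of_lt_of_le ?_ hr
    rw [div_lt_iff₀ (by positivity)]
    nlinarith [sq_nonneg ‖(x : EuclideanSpace ℝ (Fin d))‖]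
  rw [inner_klein_eq_horo, div_lt_div_iff₀ (by linarith) (by linarith)] at h3
  nlinarith

lemma horo_mul_sub_le_of_mem_cell {e : EuclideanSpace ℝ (Fin d)} {r : ℝ}
    (hr : r ≤ 1 / 4) {x : HSpace d} (hx : x ∈ cell d r) :
    horo e x * horo (-e) x - 1 ≤ (4 * r) ^ 2 := by
  have h1 := one_sub_norm_sq_pos x
  have h2 : ‖(x : EuclideanSpace ℝ (Fin d))‖ < r := hx
  have h3 := norm_nonneg (x : EuclideanSpace ℝ (Fin d))
  rw [horo, horo, inner_neg_right, div_mul_div_comm, div_sub_one (mul_pos h1 h1).ne',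
    div_le_iff₀ (mul_pos h1 h1)]
  set X := ‖(x : EuclideanSpace ℝ (Fin d))‖ with hX
  set s := inner ℝ (x : EuclideanSpace ℝ (Fin d)) e with hs'
  have h4 : X ^ 2 ≤ r ^ 2 := by nlinarith
  have h5 : X ^ 2 ≤ 1 / 16 := by nlinarith
  have h6 : 1 / 4 ≤ (1 - X ^ 2) * (1 - X ^ 2) := by nlinarith
  have h7 : (4 * r) ^ 2 * (1 / 4) ≤ (4 * r) ^ 2 * ((1 - X ^ 2) * (1 - X ^ 2)) :=
    mul_le_mul_of_nonneg_left h6 (sq_nonneg _)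
  nlinarith [sq_nonneg s]

end HypRCM

end

noncomputable section

namespace HypRCM

variable {d : ℕ}

/-! ### Translations along two axes -/

/-- Two translations along distinct diameters, at an angle of at most `π / 2`. -/
structure AxisPair (d : ℕ) where
  /-- the images of the origin -/
  pt : Bool → HSpace d
  /-- the directions of the axes -/
  dir : Bool → EuclideanSpace ℝ (Fin d)
  /-- the Euclidean distances from the origin to its images -/
  len : Bool → ℝ
  norm_dir : ∀ i, ‖dir i‖ = 1
  len_pos : ∀ i, 0 < len i
  len_lt_one : ∀ i, len i < 1
  coe_pt : ∀ i, (pt i : EuclideanSpace ℝ (Fin d)) = len i • dir i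
  inner_nonneg : ∀ i j, 0 ≤ inner ℝ (dir i) (dir j)
  inner_lt_one : ∀ i j, i ≠ j → inner ℝ (dir i) (dir j) < 1

namespace AxisPair

variable (Q : AxisPair d)

/-- The multiplier of a translation. -/
def mult (i : Bool) : ℝ := (1 + Q.len i) / (1 - Q.len i)

lemma one_lt_mult (i : Bool) : 1 < Q.mult i := by
  rw [mult, one_lt_div (by linarith [Q.len_lt_one i])]
  linarith [Q.len_pos i]

/-- The translation along an axis. -/
def trans (i : Bool) : HSpace d → HSpace d := mobiusAdd (Q.pt i)

lemma horo_trans (i : Bool) (x : HSpace d) :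
    horo (Q.dir i) (Q.trans i x) = Q.mult i * horo (Q.dir i) x :=
  horo_mobiusAdd (Q.norm_dir i) (Q.coe_pt i)
    (abs_lt.2 ⟨by linarith [Q.len_pos i], Q.len_lt_one i⟩) x

lemma horo_neg_trans (i : Bool) (x : HSpace d) :
    horo (-Q.dir i) (Q.trans i x) = (Q.mult i)⁻¹ * horo (-Q.dir i) x := by
  rw [trans, horo_mobiusAdd (e := -Q.dir i) (r := -Q.len i) (by rw [norm_neg, Q.norm_dir])
    (by rw [Q.coe_pt, neg_smul_neg]) (by
      rw [abs_neg]; exact abs_lt.2 ⟨by linarith [Q.len_pos i], Q.len_lt_one i⟩), mult, inv_div,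
    sub_neg_eq_add, ← sub_eq_add_neg]

lemma horo_iterate_trans (i : Bool) (n : ℕ) (x : HSpace d) :
    horo (Q.dir i) ((Q.trans i)^[n] x) = Q.mult i ^ n * horo (Q.dir i) x := by
  induction n with
  | zero => simp
  | succ n ih => rw [Function.iterate_succ_apply', horo_trans, ih]; ring

lemma horo_neg_iterate_trans (i : Bool) (n : ℕ) (x : HSpace d) :
    Q.mult i ^ n * horo (-Q.dir i) ((Q.trans i)^[n] x) = horo (-Q.dir i) x := by
  have h := (one_pos.trans (Q.one_lt_mult i)).ne'
  induction n with
  | zero => simp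
  | succ n ih =>
    rw [Function.iterate_succ_apply', horo_neg_trans, ← ih]
    field_simp
    ring

lemma trans_injective (i : Bool) : Function.Injective (Q.trans i) := mobiusAdd_injective _

/-- The pieces of the fundamental domain: the cell at the origin and its translates along the
two axes. -/
def piece (k : ℕ) (r : ℝ) : Option (Bool × Fin (2 * k + 1)) → Set (HSpace d)
  | none => cell d r
  | some (i, j) => (Q.trans i)^[j + 1] '' cell d r

/-- The generators of the free semigroup. -/
def gen (k : ℕ) (i : Bool) : HSpace d → HSpace d := (Q.trans i)^[2 * k + 2]

/-- The n-th translate multiplies the ratio of the two horospherical coordinates by mult^(2n) and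
preserves their product. On the initial cell the ratio lies between 1/q and q, so it locates the
translate along the axis up to a factor q on either side. -/
lemma mem_tube {q r : ℝ} (hq : 1 < q) (hr : 2 * r ≤ (q - 1) / (q + 1)) (hr4 : r ≤ 1 / 4) (i : Bool)
    (n : ℕ) {x : HSpace d} (hx : x ∈ (Q.trans i)^[n] '' cell d r) :
    Q.mult i ^ (2 * n) * horo (-Q.dir i) x < q * horo (Q.dir i) x ∧
      horo (Q.dir i) x < q * (Q.mult i ^ (2 * n) * horo (-Q.dir i) x) ∧
      ‖klein x‖ ^ 2 - inner ℝ (klein x) (Q.dir i) ^ 2 ≤ (4 * r) ^ 2 := by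
  obtain ⟨y, hy, rfl⟩ := hx
  have h0 := one_pos.trans (Q.one_lt_mult i)
  have hpow : 0 < Q.mult i ^ n := by positivity
  have h1 := Q.horo_iterate_trans i n y
  have h2 := Q.horo_neg_iterate_trans i n y
  have h3 := horo_lt_of_mem_cell (Q.norm_dir i) hq hr hy
  have h4 := horo_lt_of_mem_cell (e := -Q.dir i) (by rw [norm_neg, Q.norm_dir]) hq hr hy
  rw [neg_neg] at h4
  have h5 := horo_mul_sub_le_of_mem_cell (e := Q.dir i) hr4 hy
  have h6 : Q.mult i ^ (2 * n) * horo (-Q.dir i) ((Q.trans i)^[n] y) =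
      Q.mult i ^ n * horo (-Q.dir i) y := by
    rw [← h2]; ring
  refine ⟨?_, ?_, (norm_sq_klein_sub_le (Q.norm_dir i) _).trans ?_⟩
  · rw [h6, h1]; nlinarith
  · rw [h6, h1]; nlinarith
  · rw [h1, mul_assoc, mul_left_comm, h2]; linarith

/-- Ping-pong with attracting set `W i` the points beyond translate 2k + 2 on axis `i`, up to the
tolerance q. Different axes are separated by thin cones, different translates on one axis by the
ratio of horospherical coordinates. -/
lemma exists_disjoint_pieces : ∃ δ > 0, ∃ k : ℕ, ∀ r, 0 < r → r ≤ δ → ∀ (σ τ : List Bool)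
    (j j' : Option (Bool × Fin (2 * k + 1))), (σ, j) ≠ (τ, j') →
    Disjoint (wordMap (Q.gen k) σ '' Q.piece k r j) (wordMap (Q.gen k) τ '' Q.piece k r j') := by
  set q := min (Q.mult true) (Q.mult false) with hqdef
  have hq : 1 < q := lt_min (Q.one_lt_mult _) (Q.one_lt_mult _)
  have hq0 : 0 < q := one_pos.trans hq
  have hqm : ∀ i, q ≤ Q.mult i := by
    rintro (_ | _)
    · exact min_le_right _ _
    · exact min_le_left _ _
  set s := (q - 1) / (q + 1) with hs
  have hs0 : 0 < s := div_pos (by linarith) (by linarith)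
  have hs1 : s < 1 := by rw [hs, div_lt_one (by linarith)]; linarith
  set c := inner ℝ (Q.dir true) (Q.dir false) with hc
  have hc0 : 0 ≤ c := Q.inner_nonneg _ _
  have hc1 : c < 1 := Q.inner_lt_one _ _ (by simp)
  have hc2 : 0 < 1 - c ^ 2 := by nlinarith
  have hcc : ∀ i i', i ≠ i' → inner ℝ (Q.dir i) (Q.dir i') = c := by
    rintro (_ | _) (_ | _) h
    · exact absurd rfl h
    · rw [real_inner_comm]
    · rfl
    · exact absurd rfl h
  -- Small enough that cones of width δ around the two axes are disjoint; the bound on `r` makes the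
  -- tubes equally thin, since 4r ≤ δ.
  set δ := s * (1 - c ^ 2) / 4 with hδ
  have hδ0 : 0 < δ := by positivity
  have hδs : δ ≤ s / 4 := by
    rw [hδ]; nlinarith [sq_nonneg c]
  -- The power is large enough for the attracting sets to lie in cones of width δ.
  obtain ⟨k, hk⟩ : ∃ k : ℕ, 4 * q / δ ^ 2 ≤ q ^ (2 * (2 * k + 2)) := by
    obtain ⟨n, hn⟩ := pow_unbounded_of_one_lt (4 * q / δ ^ 2) hq
    exact ⟨n, hn.le.trans (pow_le_pow_right₀ hq.le (by omega))⟩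
  rw [div_le_iff₀ (by positivity)] at hk
  refine ⟨δ / 4, by positivity, k, fun r hr hrδ => ?_⟩
  have hr2 : 2 * r ≤ (q - 1) / (q + 1) := by rw [← hs]; linarith
  have hr4 : r ≤ 1 / 4 := by linarith
  have h4r : (4 * r) ^ 2 ≤ δ ^ 2 := pow_le_pow_left₀ (by positivity) (by linarith) 2
  have hα : ∀ i (x : HSpace d), 0 < horo (Q.dir i) x := fun i x => horo_pos (Q.norm_dir i) x
  have hβ : ∀ i (x : HSpace d), 0 < horo (-Q.dir i) x := fun i x =>
    horo_pos (by rw [norm_neg, Q.norm_dir]) x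
  have hm0 : ∀ i, 0 < Q.mult i := fun i => one_pos.trans (Q.one_lt_mult i)
  -- the attracting regions
  set W : Bool → Set (HSpace d) := fun i => {x | Q.mult i ^ (2 * (2 * k + 2)) * horo (-Q.dir i) x <
    q * horo (Q.dir i) x} with hW
  have hqq : ∀ i (n : ℕ), 1 ≤ n → q * q ≤ Q.mult i ^ (2 * n) := by
    intro i n hn
    calc q * q = q ^ 2 := by ring
      _ ≤ Q.mult i ^ 2 := pow_le_pow_left₀ hq0.le (hqm i) 2
      _ ≤ Q.mult i ^ (2 * n) := pow_le_pow_right₀ (Q.one_lt_mult i).le (by omega)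
  have hfst : ∀ i (n : ℕ), 1 ≤ n → ∀ x : HSpace d,
      Q.mult i ^ (2 * n) * horo (-Q.dir i) x < q * horo (Q.dir i) x →
      q * horo (-Q.dir i) x ≤ horo (Q.dir i) x := by
    intro i n hn x hx
    have h1 := mul_le_mul_of_nonneg_right (hqq i n hn) (hβ i x).le
    have h2 : q * (q * horo (-Q.dir i) x) < q * horo (Q.dir i) x := by
      rw [← mul_assoc]; exact h1.trans_lt hx
    exact (lt_of_mul_lt_mul_left h2 hq0.le).le
  have hWcone : ∀ i, W i ⊆ cone (Q.dir i) q δ := by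
    intro i x hx
    refine ⟨hfst i (2 * k + 2) (by omega) x hx, ?_⟩
    have h1 := one_sub_sq_inner_klein_le (Q.norm_dir i) x
    have h2 : 4 * horo (-Q.dir i) x / horo (Q.dir i) x ≤ δ ^ 2 := by
      rw [div_le_iff₀ (hα i x)]
      have h3 : q ^ (2 * (2 * k + 2)) ≤ Q.mult i ^ (2 * (2 * k + 2)) :=
        pow_le_pow_left₀ hq0.le (hqm i) _
      have h4 : Q.mult i ^ (2 * (2 * k + 2)) * horo (-Q.dir i) x < q * horo (Q.dir i) x := hx
      have h5 : 4 * q * horo (-Q.dir i) x ≤ q * (δ ^ 2 * horo (Q.dir i) x) := by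
        calc 4 * q * horo (-Q.dir i) x
            ≤ q ^ (2 * (2 * k + 2)) * δ ^ 2 * horo (-Q.dir i) x :=
              mul_le_mul_of_nonneg_right hk (hβ i x).le
          _ = δ ^ 2 * (q ^ (2 * (2 * k + 2)) * horo (-Q.dir i) x) := by ring
          _ ≤ δ ^ 2 * (Q.mult i ^ (2 * (2 * k + 2)) * horo (-Q.dir i) x) := by
              have := (hβ i x).le
              gcongr
          _ ≤ δ ^ 2 * (q * horo (Q.dir i) x) := by gcongr
          _ = q * (δ ^ 2 * horo (Q.dir i) x) := by ring
      refine le_of_mul_le_mul_left ?_ hq0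
      linarith
    linarith [norm_sq_klein_le_one x]
  have htube : ∀ i (n : ℕ), 1 ≤ n → (Q.trans i)^[n] '' cell d r ⊆ cone (Q.dir i) q δ := by
    intro i n hn x hx
    have h := Q.mem_tube hq hr2 hr4 i n hx
    exact ⟨hfst i n hn x h.1, h.2.2.trans h4r⟩
  have hcones : ∀ i i', i ≠ i' → Disjoint (cone (Q.dir i) q δ) (cone (Q.dir i') q δ) := by
    intro i i' hne
    refine disjoint_cone (Q.norm_dir i) (Q.norm_dir i') hq hδ0.le (Q.inner_nonneg _ _)
      (Q.inner_lt_one _ _ hne) ?_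
    rw [hcc i i' hne, ← hs]
    linarith [hδ]
  have hcell : ∀ i, Disjoint (cell d r) (cone (Q.dir i) q δ) := by
    intro i
    rw [Set.disjoint_left]
    intro x hx hx'
    exact absurd (horo_lt_of_mem_cell (Q.norm_dir i) hq hr2 hx) (not_lt.2 hx'.1)
  -- The ratio windows of translates n < n' do not overlap: a tolerance q on each side is absorbed
  -- by q² ≤ mult².
  have hexp : ∀ i (n n' : ℕ) (x : HSpace d), n < n' →
      horo (Q.dir i) x < q * (Q.mult i ^ (2 * n) * horo (-Q.dir i) x) →
      ¬ Q.mult i ^ (2 * n') * horo (-Q.dir i) x < q * horo (Q.dir i) x := by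
    intro i n n' x hnn h1 h2
    have hb := (hβ i x).le
    have h3 : Q.mult i ^ (2 * n) * (q * q) ≤ Q.mult i ^ (2 * n') := by
      calc Q.mult i ^ (2 * n) * (q * q) ≤ Q.mult i ^ (2 * n) * Q.mult i ^ (2 * 1) := by
            have := (hm0 i).le
            have := hqq i 1 le_rfl
            gcongr
        _ = Q.mult i ^ (2 * (n + 1)) := by ring
        _ ≤ Q.mult i ^ (2 * n') := pow_le_pow_right₀ (Q.one_lt_mult i).le (by omega)
    have h4 := mul_le_mul_of_nonneg_right h3 hb
    have h5 := mul_lt_mul_of_pos_left h1 hq0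
    nlinarith
  have hV : ∀ i, (∀ x ∈ cell d r, horo (-Q.dir i) x < q * horo (Q.dir i) x) := by
    intro i x hx
    have := horo_lt_of_mem_cell (e := -Q.dir i) (by rw [norm_neg, Q.norm_dir]) hq hr2 hx
    rwa [neg_neg] at this
  have hVc : ∀ i i', ∀ x ∈ cone (Q.dir i') q δ, horo (-Q.dir i) x < q * horo (Q.dir i) x := by
    intro i i' x hx
    refine horo_neg_lt_of_mem_cone (Q.norm_dir i') (Q.norm_dir i) hq hδ0.le (Q.inner_nonneg _ _)
      ?_ hx
    rw [← hs]; linarith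
  -- The generator sends the whole region outside the repelling end of its axis into `W i`; the
  -- cells and both cones lie in that region.
  have hVW : ∀ i (x : HSpace d), horo (-Q.dir i) x < q * horo (Q.dir i) x → Q.gen k i x ∈ W i := by
    intro i x hx
    have h1 := Q.horo_iterate_trans i (2 * k + 2) x
    have h2 := Q.horo_neg_iterate_trans i (2 * k + 2) x
    have h3 : Q.mult i ^ (2 * (2 * k + 2)) * horo (-Q.dir i) ((Q.trans i)^[2 * k + 2] x) =
        Q.mult i ^ (2 * k + 2) * horo (-Q.dir i) x := by
      rw [← h2]; ring
    have h4 : 0 < Q.mult i ^ (2 * k + 2) := pow_pos (hm0 i) _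
    simp only [hW, gen, Set.mem_ofPred_eq]
    rw [h3, h1]
    nlinarith
  refine disjoint_image_wordMap (fun i => (Q.trans_injective i).iterate _) (W := W) ?_ ?_ ?_ ?_ ?_
  · have hns : ∀ i (j : Fin (2 * k + 1)), Disjoint (Q.piece k r none) (Q.piece k r (some (i, j))) :=
      fun i j => (hcell i).mono_right (htube i (j + 1) (by omega))
    have hlt : ∀ i (j j' : Fin (2 * k + 1)), j < j' →
        Disjoint (Q.piece k r (some (i, j))) (Q.piece k r (some (i, j'))) := by
      intro i j j' hjj
      rw [Set.disjoint_left]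
      intro x hx hx'
      have h1 := Q.mem_tube hq hr2 hr4 i (j + 1) hx
      have h2 := Q.mem_tube hq hr2 hr4 i (j' + 1) hx'
      exact hexp i _ _ x (by have : (j : ℕ) < j' := hjj; omega) h1.2.1 h2.1
    rintro (_ | ⟨i, j⟩) (_ | ⟨i', j'⟩) hne
    · exact absurd rfl hne
    · exact hns i' j'
    · exact (hns i j).symm
    · by_cases hii : i = i'
      · subst hii
        rcases lt_trichotomy j j' with h | h | h
        · exact hlt i j j' h
        · exact absurd (by rw [h]) hne
        · exact (hlt i j' j h).symm
      · exact (hcones i i' hii).mono (htube i _ (by omega)) (htube i' _ (by omega))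
  · rintro (_ | ⟨i, j⟩) i'
    · exact (hcell i').mono_right (hWcone i')
    · by_cases hii : i = i'
      · subst hii
        rw [Set.disjoint_left]
        intro x hx hx'
        have h1 := Q.mem_tube hq hr2 hr4 i (j + 1) hx
        exact hexp i _ (2 * k + 2) x (by omega) h1.2.1 hx'
      · exact (hcones i i' hii).mono (htube i _ (by omega)) (hWcone i')
  · exact fun i i' hii => (hcones i i' hii).mono (hWcone i) (hWcone i')
  · rintro i (_ | ⟨i', j⟩) x hx
    · exact hVW i x (hV i x hx)
    · exact hVW i x (hVc i i' x (htube i' _ (by omega) hx))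
  · exact fun i i' x hx => hVW i x (hVc i i' x (hWcone i' hx))

end AxisPair

end HypRCM

end

noncomputable section

namespace HypRCM

variable {d : ℕ}

/-! ### Motions -/

/-- A measurable bijection preserving volume, distances and connection functions. -/
structure IsMotion (h : HSpace d → HSpace d) : Prop where
  exists_equiv : ∃ e : HSpace d ≃ᵐ HSpace d, ⇑e = h
  measurePreserving : MeasurePreserving h (hvol d) (hvol d)
  pointPair_eq : ∀ x y, pointPair (h x) (h y) = pointPair x y
  prob_eq : ∀ (φ : ConnectionFunction d) (x y), φ.prob (h x) (h y) = φ.prob x y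

lemma IsMotion.id : IsMotion (id : HSpace d → HSpace d) :=
  ⟨⟨MeasurableEquiv.refl _, rfl⟩, MeasurePreserving.id _, fun _ _ => rfl, fun _ _ _ => rfl⟩

lemma IsMotion.comp {g h : HSpace d → HSpace d} (hg : IsMotion g) (hh : IsMotion h) :
    IsMotion (g ∘ h) := by
  obtain ⟨e, he⟩ := hg.exists_equiv
  obtain ⟨f, hf⟩ := hh.exists_equiv
  refine ⟨⟨f.trans e, by rw [MeasurableEquiv.coe_trans, he, hf]⟩,
    hg.measurePreserving.comp hh.measurePreserving, fun x y => ?_, fun φ x y => ?_⟩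
  · exact (hg.pointPair_eq _ _).trans (hh.pointPair_eq _ _)
  · exact (hg.prob_eq φ _ _).trans (hh.prob_eq φ _ _)

lemma isMotion_mobiusAdd (a : HSpace d) : IsMotion (mobiusAdd a) :=
  ⟨⟨mobiusEquiv a, rfl⟩, measurePreserving_mobiusAdd a, pointPair_mobiusAdd a,
    fun φ x y => φ.prob_mobiusAdd a x y⟩

lemma IsMotion.iterate {h : HSpace d → HSpace d} (hh : IsMotion h) (n : ℕ) : IsMotion h^[n] := by
  induction n with
  | zero => exact IsMotion.id
  | succ n ih => rw [Function.iterate_succ]; exact ih.comp hh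

lemma IsMotion.wordMap {E : Bool → HSpace d → HSpace d} (hE : ∀ i, IsMotion (E i))
    (σ : List Bool) : IsMotion (wordMap E σ) := by
  induction σ with
  | nil => exact IsMotion.id
  | cons i σ ih => exact ih.comp (hE i)

lemma IsMotion.injective {h : HSpace d → HSpace d} (hh : IsMotion h) : Function.Injective h := by
  obtain ⟨e, rfl⟩ := hh.exists_equiv
  exact e.injective

lemma IsMotion.measurableSet_image {h : HSpace d → HSpace d} (hh : IsMotion h)
    {s : Set (HSpace d)} (hs : MeasurableSet s) : MeasurableSet (h '' s) := by
  obtain ⟨e, rfl⟩ := hh.exists_equiv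
  exact e.measurableSet_image.2 hs

lemma IsMotion.hvol_image {h : HSpace d → HSpace d} (hh : IsMotion h)
    {s : Set (HSpace d)} (hs : MeasurableSet s) : hvol d (h '' s) = hvol d s := by
  rw [← hh.measurePreserving.measure_preimage (hh.measurableSet_image hs).nullMeasurableSet,
    Set.preimage_image_eq _ hh.injective]

/-! ### Small cells meet few shells -/

/-- With X and Y the norms, the arithmetic-geometric mean inequality gives 2|Y - X| ≤ ε((1 - X²) +
(1 - Y²)), while (1 - X²) - (1 - Y²) = (Y - X)(Y + X) with Y + X < 2. -/
lemma one_sub_norm_sq_le_of_pointPair_le {ε : ℝ} (hε : 0 ≤ ε) {x y : HSpace d}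
    (h : pointPair x y ≤ ε ^ 2) :
    (1 - ε) * (1 - ‖(x : EuclideanSpace ℝ (Fin d))‖ ^ 2) ≤
      (1 + ε) * (1 - ‖(y : EuclideanSpace ℝ (Fin d))‖ ^ 2) := by
  have hx := one_sub_norm_sq_pos x
  have hy := one_sub_norm_sq_pos y
  rw [pointPair, div_le_iff₀ (mul_pos hx hy)] at h
  have h1 := norm_coe_lt x
  have h2 := norm_coe_lt y
  have h3 := norm_nonneg (x : EuclideanSpace ℝ (Fin d))
  have h4 := norm_nonneg (y : EuclideanSpace ℝ (Fin d))
  have h5 : |‖(x : EuclideanSpace ℝ (Fin d))‖ - ‖(y : EuclideanSpace ℝ (Fin d))‖| ^ 2 ≤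
      ‖(x : EuclideanSpace ℝ (Fin d)) - y‖ ^ 2 :=
    pow_le_pow_left₀ (abs_nonneg _) (abs_norm_sub_norm_le _ _) 2
  rw [sq_abs] at h5
  set X := ‖(x : EuclideanSpace ℝ (Fin d))‖
  set Y := ‖(y : EuclideanSpace ℝ (Fin d))‖
  have h6 : (2 * (Y - X)) ^ 2 ≤ (ε * ((1 - X ^ 2) + (1 - Y ^ 2))) ^ 2 := by
    have h7 : 4 * ((1 - X ^ 2) * (1 - Y ^ 2)) ≤ ((1 - X ^ 2) + (1 - Y ^ 2)) ^ 2 := by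
      nlinarith [sq_nonneg ((1 - X ^ 2) - (1 - Y ^ 2))]
    calc (2 * (Y - X)) ^ 2 = 4 * (X - Y) ^ 2 := by ring
      _ ≤ 4 * (ε ^ 2 * ((1 - X ^ 2) * (1 - Y ^ 2))) := by linarith
      _ = ε ^ 2 * (4 * ((1 - X ^ 2) * (1 - Y ^ 2))) := by ring
      _ ≤ ε ^ 2 * ((1 - X ^ 2) + (1 - Y ^ 2)) ^ 2 := by gcongr
      _ = _ := by ring
  have h8 := (abs_le_of_sq_le_sq' h6 (mul_nonneg hε (by linarith))).2
  have h9 : (1 - X ^ 2) - (1 - Y ^ 2) ≤ ε * ((1 - X ^ 2) + (1 - Y ^ 2)) := by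
    by_cases hxy : X ≤ Y
    · nlinarith
    · push Not at hxy
      have : 0 ≤ ε * ((1 - X ^ 2) + (1 - Y ^ 2)) := mul_nonneg hε (by linarith)
      nlinarith
  linarith

lemma pointPair_comm (x y : HSpace d) : pointPair x y = pointPair y x := by
  rw [pointPair, pointPair, norm_sub_rev, mul_comm (1 - ‖(x : EuclideanSpace ℝ (Fin d))‖ ^ 2)]

lemma cosh_add_one_ge {s : ℝ} (hs : 0 ≤ s) : 5 / 4 * (Real.cosh s + 1) ≤ Real.cosh (s + 1) + 1 := by
  have h1 : (3 / 2 : ℝ) ≤ Real.cosh 1 := by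
    rw [Real.cosh_eq]
    linarith [Real.exp_one_gt_d9, Real.exp_neg_one_gt_d9]
  have h2 := Real.one_le_cosh s
  have h3 : 0 ≤ Real.sinh s * Real.sinh 1 :=
    mul_nonneg (Real.sinh_nonneg_iff.2 hs) (Real.sinh_nonneg_iff.2 zero_le_one)
  rw [Real.cosh_add]
  nlinarith

/-- The constant 1/9 makes the comparison factor (1 + ε)/(1 - ε) equal to 5/4, which
`cosh_add_one_ge` absorbs in one unit of distance. -/
lemma shell_index_le_of_pointPair_le {x y : HSpace d} (h : pointPair x y ≤ (1 / 9) ^ 2) {m n : ℕ}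
    (hx : x ∈ shell d m) (hy : y ∈ shell d n) : n ≤ m + 1 := by
  have hx' := one_sub_norm_sq_pos x
  have hy' := one_sub_norm_sq_pos y
  have h1 := one_sub_norm_sq_le_of_pointPair_le (by norm_num) h
  rw [mem_shell_iff] at hx hy
  have h2 : 2 / (1 - ‖(y : EuclideanSpace ℝ (Fin d))‖ ^ 2) ≤
      5 / 4 * (2 / (1 - ‖(x : EuclideanSpace ℝ (Fin d))‖ ^ 2)) := by
    rw [← mul_div_assoc, div_le_div_iff₀ hy' hx']
    linarith
  have h3 := cosh_add_one_ge (s := (m : ℝ) + 1) (by positivity)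
  have h4 : Real.cosh (n : ℝ) < Real.cosh ((m : ℝ) + 1 + 1) := by linarith [hx.2, hy.1]
  rw [Real.cosh_lt_cosh, abs_of_nonneg (by positivity), abs_of_nonneg (by positivity)] at h4
  have h5 : n < m + 2 := by exact_mod_cast (by linarith : (n : ℝ) < m + 2)
  omega

lemma measurableSet_cell (r : ℝ) : MeasurableSet (cell d r) := (isOpen_cell r).measurableSet

/-- A moved cell meets at most three consecutive shells, and one of these contains a third of its
volume. Each region can therefore be served by the labels of a single shell. -/
lemma exists_shell_le {r : ℝ} (hr : 0 < r) (hr1 : r ≤ 1 / 10) {h : HSpace d → HSpace d}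
    (hh : IsMotion h) : ∃ n, hvol d (cell d r) ≤ 3 * hvol d (h '' cell d r ∩ shell d n) := by
  obtain ⟨m, hm⟩ := exists_mem_shell (h (origin d))
  -- For m = 0 the index m - 1 repeats m, so the set has at most three elements, which suffices.
  have hcov : h '' cell d r ⊆ ⋃ n ∈ ({m - 1, m, m + 1} : Finset ℕ), h '' cell d r ∩ shell d n := by
    rintro _ ⟨x, hx, rfl⟩
    obtain ⟨n, hn⟩ := exists_mem_shell (h x)
    have hx' : ‖(x : EuclideanSpace ℝ (Fin d))‖ < r := hx
    have h1 : pointPair (h x) (h (origin d)) ≤ (1 / 9) ^ 2 := by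
      rw [hh.pointPair_eq, pointPair, coe_origin, sub_zero, norm_zero,
        div_le_iff₀ (mul_pos (one_sub_norm_sq_pos x) (by norm_num))]
      nlinarith [norm_nonneg (x : EuclideanSpace ℝ (Fin d))]
    have h2 := shell_index_le_of_pointPair_le h1 hn hm
    have h3 := shell_index_le_of_pointPair_le (by rwa [pointPair_comm]) hm hn
    simp only [Set.mem_iUnion]
    refine ⟨n, ?_, ⟨x, hx, rfl⟩, hn⟩
    simp only [Finset.mem_insert, Finset.mem_singleton]
    omega
  have hle := (measure_mono hcov).trans (measure_biUnion_finset_le (μ := hvol d) _ _)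
  rw [hh.hvol_image (measurableSet_cell r)] at hle
  by_contra hc
  push Not at hc
  have hsum : (∑ n ∈ ({m - 1, m, m + 1} : Finset ℕ), hvol d (h '' cell d r ∩ shell d n)) * 3 <
      hvol d (cell d r) * 3 := by
    calc (∑ n ∈ ({m - 1, m, m + 1} : Finset ℕ), hvol d (h '' cell d r ∩ shell d n)) * 3
        = ∑ n ∈ ({m - 1, m, m + 1} : Finset ℕ), 3 * hvol d (h '' cell d r ∩ shell d n) := by
          rw [Finset.sum_mul]; exact Finset.sum_congr rfl fun _ _ => mul_comm _ _
      _ < ∑ n ∈ ({m - 1, m, m + 1} : Finset ℕ), hvol d (cell d r) :=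
          ENNReal.sum_lt_sum_of_nonempty (by simp) fun n _ => hc n
      _ ≤ hvol d (cell d r) * 3 := by
          rw [Finset.sum_const, nsmul_eq_mul, mul_comm]
          gcongr
          exact_mod_cast Finset.card_le_three
  exact absurd hsum (not_lt.2 (by gcongr))

end HypRCM

end

noncomputable section

namespace HypRCM

variable {d : ℕ}

/-! ### Comparison of hyperbolic and Lebesgue volume -/

lemma measurableEmbedding_coe :
    MeasurableEmbedding (Subtype.val : HSpace d → EuclideanSpace ℝ (Fin d)) :=
  MeasurableEmbedding.subtype_coe measurableSet_ball

lemma volume_image_le_hvol {A : Set (HSpace d)} (hA : MeasurableSet A) :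
    (volume : Measure (EuclideanSpace ℝ (Fin d))) (Subtype.val '' A) ≤ hvol d A := by
  rw [hvol, withDensity_apply _ hA, ← measurableEmbedding_coe.comap_apply, ← setLIntegral_one]
  refine lintegral_mono fun y => ?_
  have h := one_sub_norm_sq_pos y
  rw [← ENNReal.ofReal_one]
  refine ENNReal.ofReal_le_ofReal (one_le_pow₀ ?_)
  rw [one_le_div h]
  nlinarith [norm_nonneg (y : EuclideanSpace ℝ (Fin d))]

lemma hvol_le_mul_volume_image {A : Set (HSpace d)} (hA : MeasurableSet A) {ρ : ℝ} (hρ : ρ < 1)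
    (hle : ∀ y ∈ A, ‖(y : EuclideanSpace ℝ (Fin d))‖ ≤ ρ) :
    hvol d A ≤ ENNReal.ofReal ((2 / (1 - ρ ^ 2)) ^ d) *
      (volume : Measure (EuclideanSpace ℝ (Fin d))) (Subtype.val '' A) := by
  rw [hvol, withDensity_apply _ hA, ← measurableEmbedding_coe.comap_apply, ← setLIntegral_const]
  refine setLIntegral_mono measurable_const fun y hy => ?_
  have h := one_sub_norm_sq_pos y
  have h1 := hle y hy
  have h0 := norm_nonneg (y : EuclideanSpace ℝ (Fin d))
  refine ENNReal.ofReal_le_ofReal (pow_le_pow_left₀ (by positivity) ?_ d)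
  refine div_le_div_of_nonneg_left (by norm_num) (by nlinarith) ?_
  nlinarith

lemma volume_image_pos_of_hvol_pos {A : Set (HSpace d)} (h : 0 < hvol d A) :
    0 < (volume : Measure (EuclideanSpace ℝ (Fin d))) (Subtype.val '' A) := by
  rw [pos_iff_ne_zero]
  intro h0
  refine h.ne' (withDensity_absolutelyContinuous _ _ ?_)
  rw [measurableEmbedding_coe.comap_apply, h0]

/-! ### Displacement estimates -/

lemma norm_mobVec_sub_left_le {E : Type*} [NormedAddCommGroup E] [InnerProductSpace ℝ E] {p y : E}
    (hp : ‖p‖ < 1) (hy : ‖y‖ < 1) : ‖mobVec p y - p‖ ≤ 2 * ‖y‖ := by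
  have h0 : mobVec p (0 : E) = p := by simp [mobVec, mobDen]
  have hD : 0 < mobDen p y := mobius_den_pos hp hy
  have h1 := norm_sq_mobVec_sub (a := p) (x := y) (y := 0) hD.ne' (by simp [mobDen])
  rw [h0, sub_zero] at h1
  refine (abs_le_of_sq_le_sq' ?_ (by positivity)).2
  rw [h1, div_le_iff₀ (by simpa [mobDen] using hD)]
  have h2 : (mobDen p (0 : E)) = 1 := by simp [mobDen]
  rw [h2, mul_one, mul_pow]
  have h3 : (1 - ‖p‖) ^ 2 ≤ mobDen p y := by
    have := (abs_le.1 (abs_real_inner_le_norm p y)).1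
    have hpy : ‖p‖ * ‖y‖ ≤ ‖p‖ := by nlinarith [norm_nonneg p]
    have hpy0 : 0 ≤ ‖p‖ * ‖y‖ := by positivity
    rw [mobDen]
    nlinarith
  have h4 : (1 - ‖p‖ ^ 2) ^ 2 ≤ 2 ^ 2 * (1 - ‖p‖) ^ 2 := by
    have h5 : (1 + ‖p‖) ^ 2 ≤ 2 ^ 2 := pow_le_pow_left₀ (by positivity) (by linarith) 2
    calc (1 - ‖p‖ ^ 2) ^ 2 = (1 + ‖p‖) ^ 2 * (1 - ‖p‖) ^ 2 := by ring
      _ ≤ _ := by gcongr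
  nlinarith [sq_nonneg ‖y‖]

/-- The denominator is at least 1/4 and the numerator of the displacement at most 8‖a‖. This bounds,
uniformly over the ball, the Euclidean displacement caused by moving a nearby point to the origin.
-/
lemma norm_mobVec_sub_right_le {E : Type*} [NormedAddCommGroup E] [InnerProductSpace ℝ E] {a y : E}
    (ha : ‖a‖ ≤ 1 / 2) (hy : ‖y‖ < 1) : ‖mobVec a y - y‖ ≤ 32 * ‖a‖ := by
  have hD : 0 < mobDen a y := mobius_den_pos (by linarith) hy
  have hs := abs_le.1 (abs_real_inner_le_norm a y)
  have ha0 := norm_nonneg a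
  have hy0 := norm_nonneg y
  have hay : ‖a‖ * ‖y‖ ≤ ‖a‖ := by nlinarith
  have hD4 : 1 / 4 ≤ mobDen a y := by
    have hay0 : 0 ≤ ‖a‖ * ‖y‖ := by positivity
    rw [mobDen]
    nlinarith
  have h1 : mobVec a y - y = (mobDen a y)⁻¹ • ((1 + 2 * inner ℝ a y + ‖y‖ ^ 2) • a +
      (-(‖a‖ ^ 2) - 2 * inner ℝ a y - ‖a‖ ^ 2 * ‖y‖ ^ 2) • y) := by
    have h2 : y = (mobDen a y)⁻¹ • (mobDen a y • y) := by rw [inv_smul_smul₀ hD.ne']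
    conv_lhs => rhs; rw [h2]
    rw [mobVec, ← smul_sub, add_sub_assoc, ← sub_smul]
    congr 3
    rw [mobDen]
    ring
  rw [h1, norm_smul, norm_inv, Real.norm_of_nonneg hD.le, inv_mul_le_iff₀ hD]
  refine (norm_add_le _ _).trans ?_
  rw [norm_smul, norm_smul, Real.norm_eq_abs, Real.norm_eq_abs]
  have h3 : |1 + 2 * inner ℝ a y + ‖y‖ ^ 2| ≤ 4 := by
    rw [abs_le]; constructor <;> nlinarith
  have h4 : |-(‖a‖ ^ 2) - 2 * inner ℝ a y - ‖a‖ ^ 2 * ‖y‖ ^ 2| ≤ 4 * ‖a‖ := by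
    have h5 : ‖a‖ ^ 2 * ‖y‖ ^ 2 ≤ ‖a‖ := by nlinarith [mul_nonneg ha0 hy0]
    have h6 : ‖a‖ ^ 2 ≤ ‖a‖ := by nlinarith
    have h7 : 0 ≤ ‖a‖ ^ 2 * ‖y‖ ^ 2 := by positivity
    rw [abs_le]; constructor <;> nlinarith
  calc _ ≤ 4 * ‖a‖ + 4 * ‖a‖ * 1 := by gcongr
    _ = 1 / 4 * (32 * ‖a‖) := by ring
    _ ≤ mobDen a y * (32 * ‖a‖) := by gcongr

/-! ### Density points -/

namespace ConnectionFunction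

variable (φ : ConnectionFunction d)

/-- Translating by `x` turns φ(o, -x) into φ(x, o). No rotational symmetry of φ is available, but
this symmetry suffices for the return step from p and for the choice of the angle. -/
lemma prob_antipode (x : HSpace d) : φ.prob (origin d) (antipode x) = φ.prob (origin d) x := by
  have h := φ.prob_mobiusAdd x (origin d) (antipode x)
  have h1 : mobiusAdd x (antipode x) = origin d := by
    simpa using mobiusAdd_cancel_antipode x (origin d)
  rw [mobiusAdd_origin_right, h1] at h
  rw [← h, φ.prob_symm]

/-- The superlevel sets of the connection function at the origin. -/
def level (a : ℝ≥0∞) : Set (HSpace d) := {x | a ≤ φ.prob (origin d) x}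

lemma measurableSet_level (a : ℝ≥0∞) : MeasurableSet (φ.level a) :=
  measurableSet_le measurable_const (φ.measurable_prob_left _)

/-- The points where the complement of a superlevel set has Lebesgue density zero. -/
def IsDensityPoint (a : ℝ≥0∞) (p : EuclideanSpace ℝ (Fin d)) : Prop :=
  Filter.Tendsto (fun R => volume ((Subtype.val '' φ.level a)ᶜ ∩ Metric.closedBall p R) /
    volume (Metric.closedBall p R)) (nhdsWithin 0 (Set.Ioi 0)) (nhds 0)

lemma neg_mem_image_level {a : ℝ≥0∞} {y : EuclideanSpace ℝ (Fin d)} :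
    -y ∈ Subtype.val '' φ.level a ↔ y ∈ Subtype.val '' φ.level a := by
  have key : ∀ y : EuclideanSpace ℝ (Fin d), y ∈ Subtype.val '' φ.level a →
      -y ∈ Subtype.val '' φ.level a := by
    rintro _ ⟨x, hx, rfl⟩
    refine ⟨antipode x, ?_, rfl⟩
    simp only [level, Set.mem_ofPred_eq] at hx ⊢
    rwa [φ.prob_antipode]
  exact ⟨fun h => by simpa using key _ h, key y⟩

lemma IsDensityPoint.neg {a : ℝ≥0∞} {p : EuclideanSpace ℝ (Fin d)} (h : φ.IsDensityPoint a p) :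
    φ.IsDensityPoint a (-p) := by
  have hball : ∀ R, volume (Metric.closedBall (-p) R) = volume (Metric.closedBall p R) := by
    intro R
    rw [Measure.addHaar_closedBall_center, Measure.addHaar_closedBall_center volume p]
  have hset : ∀ R, volume ((Subtype.val '' φ.level a)ᶜ ∩ Metric.closedBall (-p) R) =
      volume ((Subtype.val '' φ.level a)ᶜ ∩ Metric.closedBall p R) := by
    intro R
    rw [← Measure.measure_preimage_neg]
    congr 1
    ext y
    simp only [Set.mem_preimage, Set.mem_inter_iff, Set.mem_compl_iff, φ.neg_mem_image_level,
      Metric.mem_closedBall, dist_neg_neg]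
  unfold IsDensityPoint at h ⊢
  simpa only [hball, hset] using h

lemma ae_isDensityPoint (a : ℝ≥0∞) : ∀ᵐ p ∂(volume : Measure (EuclideanSpace ℝ (Fin d))),
    p ∈ Subtype.val '' φ.level a → φ.IsDensityPoint a p := by
  have hm : MeasurableSet (Subtype.val '' φ.level a : Set (EuclideanSpace ℝ (Fin d)))ᶜ :=
    (measurableEmbedding_coe.measurableSet_image.2 (φ.measurableSet_level a)).compl
  filter_upwards [Besicovitch.ae_tendsto_measure_inter_div_of_measurableSet volume hm] with p hp hpS
  rwa [Set.indicator_of_notMem (Set.notMem_compl_iff.2 hpS)] at hp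

/-- Most points of the cell at `p` are well connected to every point of the cell at the origin. -/
def GoodAt (a : ℝ≥0∞) (r : ℝ) (p : HSpace d) : Prop :=
  ∀ x ∈ cell d r, 12 * hvol d {z | z ∈ mobiusAdd p '' cell d r ∧ φ.prob x z < a} ≤
    hvol d (cell d r)

/-- Moving `x` to the origin takes the badly connected points to the complement of the superlevel
set, within Euclidean distance 40r of `p`. By density they have volume o(r^d), uniformly in `x`,
whereas the cell has volume of order r^d. -/
lemma IsDensityPoint.eventually_goodAt (hd : 1 ≤ d) {a : ℝ≥0∞} {p : HSpace d}
    (h : φ.IsDensityPoint a p) : ∀ᶠ r in nhdsWithin 0 (Set.Ioi 0), φ.GoodAt a r p := by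
  have : NeZero d := ⟨by omega⟩
  have hp := norm_coe_lt p
  set ρ : ℝ := (1 + ‖(p : EuclideanSpace ℝ (Fin d))‖) / 2 with hρ
  have hρ1 : ρ < 1 := by linarith
  have hρ0 : 0 ≤ ρ := by positivity
  set M : ℝ≥0∞ := ENNReal.ofReal ((2 / (1 - ρ ^ 2)) ^ d) with hM
  have hM0 : M ≠ 0 := by
    rw [hM, Ne, ENNReal.ofReal_eq_zero, not_le]
    have : 0 < 1 - ρ ^ 2 := by nlinarith
    positivity
  -- The density on the ball of radius 40r is required below c⁻¹, which exactly compensates the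
  -- factor 12 in `GoodAt`, the comparison `M` of volumes and the scaling 40^d. The number 40
  -- exceeds 32 + 2, the sum of the displacement constants.
  set c : ℝ≥0∞ := 12 * M * ENNReal.ofReal (40 ^ d) with hc
  have hc0 : c ≠ 0 := by
    simp only [hc, ne_eq, mul_eq_zero, hM0, or_false, ENNReal.ofReal_eq_zero, not_or, not_le]
    exact ⟨by norm_num, by positivity⟩
  have hct : c ≠ ⊤ := ENNReal.mul_ne_top (ENNReal.mul_ne_top (by norm_num) ENNReal.ofReal_ne_top)
    ENNReal.ofReal_ne_top
  have hev : ∀ᶠ R in nhdsWithin (0 : ℝ) (Set.Ioi 0),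
      volume ((Subtype.val '' φ.level a)ᶜ ∩ Metric.closedBall (p : EuclideanSpace ℝ (Fin d)) R) /
        volume (Metric.closedBall (p : EuclideanSpace ℝ (Fin d)) R) < c⁻¹ :=
    h.eventually (gt_mem_nhds (ENNReal.inv_pos.2 hct))
  have hscale : Filter.Tendsto (fun r : ℝ => 40 * r) (nhdsWithin 0 (Set.Ioi 0))
      (nhdsWithin 0 (Set.Ioi 0)) := by
    refine tendsto_nhdsWithin_of_tendsto_nhds_of_eventually_within _ ?_ ?_
    · have : Filter.Tendsto (fun r : ℝ => 40 * r) (nhds 0) (nhds (40 * 0)) :=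
        (continuous_const.mul continuous_id).tendsto 0
      rw [mul_zero] at this
      exact this.mono_left nhdsWithin_le_nhds
    · filter_upwards [self_mem_nhdsWithin] with r hr
      have : (0 : ℝ) < r := hr
      exact Set.mem_Ioi.2 (by positivity)
  have hsmall : ∀ᶠ r in nhdsWithin (0 : ℝ) (Set.Ioi 0),
      r < min (1 / 10) ((1 - ‖(p : EuclideanSpace ℝ (Fin d))‖) / 80) :=
    nhdsWithin_le_nhds (gt_mem_nhds (lt_min (by norm_num) (by linarith)))
  filter_upwards [hscale.eventually hev, hsmall, self_mem_nhdsWithin] with r hr1 hr2 hr3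
  have hr0 : 0 < r := hr3
  obtain ⟨hr4, hr5⟩ := lt_min_iff.1 hr2
  intro x hx
  have hxr : ‖(x : EuclideanSpace ℝ (Fin d))‖ < r := hx
  set A : Set (HSpace d) := {z | z ∈ mobiusAdd p '' cell d r ∧ φ.prob x z < a} with hA
  have hAm : MeasurableSet A :=
    ((isMotion_mobiusAdd p).measurableSet_image (measurableSet_cell r)).inter
      (measurableSet_lt (φ.measurable_prob_left x) measurable_const)
  have hmot := isMotion_mobiusAdd (antipode x)
  have hball : ∀ w ∈ mobiusAdd (antipode x) '' A,
      ‖(w : EuclideanSpace ℝ (Fin d)) - p‖ ≤ 40 * r := by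
    rintro _ ⟨_, ⟨⟨y, hy, rfl⟩, _⟩, rfl⟩
    have hyr : ‖(y : EuclideanSpace ℝ (Fin d))‖ < r := hy
    have h1 : ‖(mobiusAdd (antipode x) (mobiusAdd p y) : EuclideanSpace ℝ (Fin d)) -
        mobiusAdd p y‖ ≤ 32 * ‖(x : EuclideanSpace ℝ (Fin d))‖ := by
      have := norm_mobVec_sub_right_le (a := (antipode x : EuclideanSpace ℝ (Fin d)))
        (y := (mobiusAdd p y : EuclideanSpace ℝ (Fin d))) (by
          rw [coe_antipode, norm_neg]; linarith) (norm_coe_lt _)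
      rwa [coe_antipode, norm_neg] at this
    have h2 : ‖(mobiusAdd p y : EuclideanSpace ℝ (Fin d)) - p‖ ≤
        2 * ‖(y : EuclideanSpace ℝ (Fin d))‖ :=
      norm_mobVec_sub_left_le hp (norm_coe_lt y)
    have h3 := norm_sub_le_norm_sub_add_norm_sub
      (mobiusAdd (antipode x) (mobiusAdd p y) : EuclideanSpace ℝ (Fin d)) (mobiusAdd p y) p
    linarith
  have hsub : Subtype.val '' (mobiusAdd (antipode x) '' A) ⊆
      (Subtype.val '' φ.level a)ᶜ ∩
        Metric.closedBall (p : EuclideanSpace ℝ (Fin d)) (40 * r) := by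
    rintro _ ⟨w, hw, rfl⟩
    refine ⟨?_, by rw [Metric.mem_closedBall, dist_eq_norm]; exact hball w hw⟩
    rintro ⟨w', hw', heq⟩
    obtain rfl := Subtype.ext heq
    obtain ⟨z, hz, rfl⟩ := hw
    have h4 : φ.prob (origin d) (mobiusAdd (antipode x) z) = φ.prob x z := by
      rw [← φ.prob_mobiusAdd (antipode x) x z]
      congr 1
      simpa using (mobiusAdd_antipode_cancel x (origin d)).symm
    simp only [level, Set.mem_ofPred_eq, h4] at hw'
    exact absurd hw' (not_le.2 hz.2)
  have hnorm : ∀ w ∈ mobiusAdd (antipode x) '' A, ‖(w : EuclideanSpace ℝ (Fin d))‖ ≤ ρ := by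
    intro w hw
    have h5 := hball w hw
    have h6 := norm_le_norm_add_norm_sub' (w : EuclideanSpace ℝ (Fin d)) p
    rw [hρ]
    linarith
  have hcell : volume (Metric.ball (0 : EuclideanSpace ℝ (Fin d)) r) ≤ hvol d (cell d r) := by
    refine le_trans (measure_mono ?_) (volume_image_le_hvol (measurableSet_cell r))
    intro y hy
    rw [mem_ball_zero_iff] at hy
    exact ⟨⟨y, mem_ball_zero_iff.2 (by linarith)⟩, hy, rfl⟩
  have hb0 : volume (Metric.closedBall (p : EuclideanSpace ℝ (Fin d)) (40 * r)) ≠ 0 :=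
    (Metric.measure_closedBall_pos _ _ (by positivity)).ne'
  have hbt : volume (Metric.closedBall (p : EuclideanSpace ℝ (Fin d)) (40 * r)) ≠ ⊤ :=
    measure_closedBall_lt_top.ne
  have hr6 := ((ENNReal.div_lt_iff (Or.inl hb0) (Or.inl hbt)).1 hr1).le
  calc 12 * hvol d A = 12 * hvol d (mobiusAdd (antipode x) '' A) := by rw [hmot.hvol_image hAm]
    _ ≤ 12 * (M * volume (Subtype.val '' (mobiusAdd (antipode x) '' A))) := by
        gcongr
        exact hvol_le_mul_volume_image (hmot.measurableSet_image hAm) hρ1 hnorm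
    _ ≤ 12 * (M * (c⁻¹ * volume (Metric.closedBall (p : EuclideanSpace ℝ (Fin d)) (40 * r)))) := by
        gcongr
        exact (measure_mono hsub).trans hr6
    _ = c * c⁻¹ * volume (Metric.ball (0 : EuclideanSpace ℝ (Fin d)) r) := by
        rw [Measure.addHaar_closedBall_mul_of_pos volume _ (by norm_num) r,
          finrank_euclideanSpace_fin, Measure.addHaar_closedBall_eq_addHaar_ball, hc]
        ring
    _ = volume (Metric.ball (0 : EuclideanSpace ℝ (Fin d)) r) := by
        rw [ENNReal.mul_inv_cancel hc0 hct, one_mul]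
    _ ≤ hvol d (cell d r) := hcell

end ConnectionFunction

end HypRCM

end

noncomputable section

namespace HypRCM

variable {d : ℕ}

/-! ### Choice of the axes -/

lemma AxisPair.exists_pt_eq (P : Bool → HSpace d)
    (h0 : ∀ i, (P i : EuclideanSpace ℝ (Fin d)) ≠ 0)
    (hin : 0 ≤ inner ℝ (P true : EuclideanSpace ℝ (Fin d)) (P false : EuclideanSpace ℝ (Fin d)))
    (hspan : (P false : EuclideanSpace ℝ (Fin d)) ∉
      Submodule.span ℝ {(P true : EuclideanSpace ℝ (Fin d))}) :
    ∃ Q : AxisPair d, Q.pt = P := by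
  have hpos : ∀ i, 0 < ‖(P i : EuclideanSpace ℝ (Fin d))‖ := fun i => norm_pos_iff.2 (h0 i)
  set e : Bool → EuclideanSpace ℝ (Fin d) := fun i =>
    ‖(P i : EuclideanSpace ℝ (Fin d))‖⁻¹ • (P i : EuclideanSpace ℝ (Fin d)) with he
  have hnorm : ∀ i, ‖e i‖ = 1 := fun i => by
    rw [he, norm_smul, norm_inv, norm_norm, inv_mul_cancel₀ (hpos i).ne']
  have hP : ∀ i, (P i : EuclideanSpace ℝ (Fin d)) = ‖(P i : EuclideanSpace ℝ (Fin d))‖ • e i :=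
    fun i => by rw [he, smul_inv_smul₀ (hpos i).ne']
  have htf : 0 ≤ inner ℝ (e true) (e false) := by
    rw [he, inner_smul_left, inner_smul_right]
    simp only [conj_trivial]
    have := (hpos true).le
    have := (hpos false).le
    positivity
  have hlt : inner ℝ (e true) (e false) < 1 := by
    have hle := (abs_le.1 (abs_inner_le_norm_of_norm_eq_one (hnorm false) (e true))).2
    rw [hnorm] at hle
    refine lt_of_le_of_ne hle fun heq => hspan ?_
    rw [inner_eq_one_iff_of_norm_eq_one (hnorm _) (hnorm _)] at heq
    rw [hP false, ← heq, he]
    exact Submodule.smul_mem _ _ (Submodule.smul_mem _ _ (Submodule.mem_span_singleton_self _))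
  refine ⟨⟨P, e, fun i => ‖(P i : EuclideanSpace ℝ (Fin d))‖, hnorm, hpos, fun i => norm_coe_lt _,
    hP, ?_, ?_⟩, rfl⟩
  · rintro (_ | _) (_ | _)
    · rw [real_inner_self_eq_norm_sq]; positivity
    · rwa [real_inner_comm]
    · exact htf
    · rw [real_inner_self_eq_norm_sq]; positivity
  · rintro (_ | _) (_ | _) h
    · exact absurd rfl h
    · rwa [real_inner_comm]
    · exact hlt
    · exact absurd rfl h

namespace ConnectionFunction

variable (φ : ConnectionFunction d)

lemma exists_hvol_level_pos (h : 0 < φ.mass) : ∃ a : ℝ≥0∞, 0 < a ∧ a ≤ 1 ∧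
    0 < hvol d (φ.level a) := by
  have h1 : ∃ a : ℝ≥0∞, 0 < a ∧ 0 < hvol d (φ.level a) := by
    by_contra hc
    push Not at hc
    refine h.ne' ((lintegral_eq_zero_iff (φ.measurable_prob_left (origin d))).2 ?_)
    have h2 : hvol d (⋃ n : ℕ, φ.level ((n : ℝ≥0∞)⁻¹)) = 0 :=
      measure_iUnion_null fun n => le_antisymm
        (hc _ (ENNReal.inv_pos.2 (ENNReal.natCast_ne_top n))) zero_le
    refine measure_mono_null (fun x hx => ?_) h2
    obtain ⟨n, hn⟩ := ENNReal.exists_inv_nat_lt (a := φ.prob (origin d) x) hx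
    exact Set.mem_iUnion.2 ⟨n, hn.le⟩
  obtain ⟨a, ha, hpos⟩ := h1
  refine ⟨a, ha, ?_, hpos⟩
  obtain ⟨x, hx⟩ := nonempty_of_measure_ne_zero hpos.ne'
  exact le_trans hx (φ.prob_le_one _ _)

lemma exists_isDensityPoint_notMem {a : ℝ≥0∞} (h : 0 < hvol d (φ.level a))
    {Z : Set (EuclideanSpace ℝ (Fin d))} (hZ : volume Z = 0) :
    ∃ p : HSpace d, φ.IsDensityPoint a p ∧ (p : EuclideanSpace ℝ (Fin d)) ∉ Z := by
  have h1 : ∃ᵐ p ∂(volume : Measure (EuclideanSpace ℝ (Fin d))), p ∈ Subtype.val '' φ.level a :=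
    frequently_ae_mem_iff.2 (volume_image_pos_of_hvol_pos h).ne'
  obtain ⟨p, ⟨hp, hdens⟩, hpZ⟩ := ((h1.and_eventually (φ.ae_isDensityPoint a)).and_eventually
    (measure_eq_zero_iff_ae_notMem.1 hZ)).exists
  obtain ⟨x, hx, rfl⟩ := hp
  exact ⟨x, hdens ⟨x, hx, rfl⟩, hpZ⟩

/-- Almost every point of a superlevel set of positive volume is a density point, so a second one
can be chosen off the line through the first. This is the step that needs d ≥ 2. -/
lemma exists_axisPair (hd : 2 ≤ d) (h : 0 < φ.mass) : ∃ a : ℝ≥0∞, 0 < a ∧ a ≤ 1 ∧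
    ∃ Q : AxisPair d, ∀ i, φ.IsDensityPoint a (Q.pt i) := by
  have : NeZero d := ⟨by omega⟩
  obtain ⟨a, ha, ha1, hpos⟩ := φ.exists_hvol_level_pos h
  obtain ⟨p, hp, hp0⟩ := φ.exists_isDensityPoint_notMem hpos
    (measure_singleton (0 : EuclideanSpace ℝ (Fin d)))
  have hspan : Submodule.span ℝ {(p : EuclideanSpace ℝ (Fin d))} ≠ ⊤ := by
    intro htop
    have h1 := finrank_span_le_card (R := ℝ) {(p : EuclideanSpace ℝ (Fin d))}
    rw [htop, finrank_top, finrank_euclideanSpace_fin] at h1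
    simp at h1
    omega
  obtain ⟨q, hq, hqs⟩ := φ.exists_isDensityPoint_notMem hpos
    (Measure.addHaar_submodule volume _ hspan)
  obtain ⟨q', hq', hqs', hin⟩ : ∃ q' : HSpace d, φ.IsDensityPoint a q' ∧
      (q' : EuclideanSpace ℝ (Fin d)) ∉ Submodule.span ℝ {(p : EuclideanSpace ℝ (Fin d))} ∧
      0 ≤ inner ℝ (p : EuclideanSpace ℝ (Fin d)) (q' : EuclideanSpace ℝ (Fin d)) := by
    rcases le_total 0 (inner ℝ (p : EuclideanSpace ℝ (Fin d)) (q : EuclideanSpace ℝ (Fin d)))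
      with h1 | h1
    · exact ⟨q, hq, hqs, h1⟩
    -- The antipode is again a density point, and replacing `q` by it makes the angle at most π/2.
    · refine ⟨antipode q, hq.neg, ?_, ?_⟩
      · rw [coe_antipode, Submodule.neg_mem_iff]; exact hqs
      · rw [coe_antipode, inner_neg_right]; linarith
  obtain ⟨Q, hQ⟩ := AxisPair.exists_pt_eq (fun i => if i then p else q') (by
    rintro (_ | _)
    · intro h0
      simp only [Bool.false_eq_true, if_false] at h0
      rw [h0] at hqs'
      exact hqs' (Submodule.zero_mem _)
    · simpa using hp0) (by simpa using hin) (by simpa using hqs')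
  refine ⟨a, ha, ha1, Q, ?_⟩
  rw [hQ]
  rintro (_ | _)
  · simpa using hq'
  · simpa using hp

/-- Two steps along a translation, with the intermediate vertex in one shell. -/
lemma two_step_le {a : ℝ≥0∞} {r : ℝ} {p : HSpace d} (hg : φ.GoodAt a r p)
    (hg' : φ.GoodAt a r (antipode p)) (hfin : hvol d (cell d r) ≠ ⊤) {h : HSpace d → HSpace d}
    (hh : IsMotion h) {x y : HSpace d} (hx : x ∈ h '' cell d r)
    (hy : y ∈ (h ∘ mobiusAdd p ∘ mobiusAdd p) '' cell d r) {n : ℕ}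
    (hn : hvol d (cell d r) ≤ 3 * hvol d ((h ∘ mobiusAdd p) '' cell d r ∩ shell d n)) :
    a * a * (hvol d (cell d r) / 6) ≤ ∫⁻ z in (h ∘ mobiusAdd p) '' cell d r ∩ shell d n,
      φ.prob x z * φ.prob z y ∂(hvol d) := by
  obtain ⟨x₀, hx₀, rfl⟩ := hx
  obtain ⟨y₀, hy₀, rfl⟩ := hy
  have hT := isMotion_mobiusAdd p
  have hhT := hh.comp hT
  set A := (h ∘ mobiusAdd p) '' cell d r ∩ shell d n with hA
  have hAm : MeasurableSet A :=
    (hhT.measurableSet_image (measurableSet_cell r)).inter (measurableSet_shell n)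
  set x := h x₀
  set y := (h ∘ mobiusAdd p ∘ mobiusAdd p) y₀
  have hmx : Measurable (φ.prob x) := φ.measurable_prob_left x
  have hmy : Measurable fun z => φ.prob z y := by
    simp only [φ.prob_symm _ y]
    exact φ.measurable_prob_left y
  set G := {z | z ∈ A ∧ a ≤ φ.prob x z ∧ a ≤ φ.prob z y} with hG
  have hGm : MeasurableSet G := hAm.inter
    ((measurableSet_le measurable_const hmx).inter (measurableSet_le measurable_const hmy))
  have hm1 : MeasurableSet {z | z ∈ mobiusAdd p '' cell d r ∧ φ.prob x₀ z < a} :=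
    (hT.measurableSet_image (measurableSet_cell r)).inter
      (measurableSet_lt (φ.measurable_prob_left x₀) measurable_const)
  have hm2 : MeasurableSet {z | z ∈ mobiusAdd (antipode p) '' cell d r ∧ φ.prob y₀ z < a} :=
    ((isMotion_mobiusAdd _).measurableSet_image (measurableSet_cell r)).inter
      (measurableSet_lt (φ.measurable_prob_left y₀) measurable_const)
  -- Points of `A` badly connected to `x` or to `y` fill at most a twelfth of the cell volume each.
  -- Since `A` has at least a third of it, `G` keeps at least a sixth.
  have hcov : A ⊆ G ∪ (h '' {z | z ∈ mobiusAdd p '' cell d r ∧ φ.prob x₀ z < a} ∪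
      (h ∘ mobiusAdd p ∘ mobiusAdd p) ''
        {z | z ∈ mobiusAdd (antipode p) '' cell d r ∧ φ.prob y₀ z < a}) := by
    intro z hz
    by_cases h1 : a ≤ φ.prob x z
    · by_cases h2 : a ≤ φ.prob z y
      · exact Or.inl ⟨hz, h1, h2⟩
      · push Not at h2
        obtain ⟨z₀, hz₀, rfl⟩ := hz.1
        -- Seen from `y`, the middle cell is reached by the inverse translation, hence the
        -- hypothesis of good connection at the antipode.
        refine Or.inr (Or.inr ⟨mobiusAdd (antipode p) z₀, ⟨⟨z₀, hz₀, rfl⟩, ?_⟩, ?_⟩)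
        · have h3 := (hhT.comp hT).prob_eq φ y₀ (mobiusAdd (antipode p) z₀)
          simp only [Function.comp_apply, mobiusAdd_cancel_antipode] at h3
          rw [← h3, φ.prob_symm]
          exact h2
        · simp
    · push Not at h1
      obtain ⟨z₀, hz₀, rfl⟩ := hz.1
      refine Or.inr (Or.inl ⟨mobiusAdd p z₀, ⟨⟨z₀, hz₀, rfl⟩, ?_⟩, rfl⟩)
      rwa [← hh.prob_eq φ]
  have hvolG : hvol d (cell d r) / 6 ≤ hvol d G := by
    have h1 := (measure_mono hcov).trans ((measure_union_le (μ := hvol d) _ _).trans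
      (add_le_add_right (measure_union_le _ _) _))
    rw [hh.hvol_image hm1, (hh.comp (hT.comp hT)).hvol_image hm2] at h1
    have h2 := hg x₀ hx₀
    have h3 := hg' y₀ hy₀
    have h4 : 2 * hvol d (cell d r) ≤ 6 * hvol d G + hvol d (cell d r) := by
      calc 2 * hvol d (cell d r) ≤ 2 * (3 * hvol d A) := by gcongr
        _ = 6 * hvol d A := by rw [← mul_assoc]; norm_num
        _ ≤ 6 * (hvol d G + (hvol d {z | z ∈ mobiusAdd p '' cell d r ∧ φ.prob x₀ z < a} +
            hvol d {z | z ∈ mobiusAdd (antipode p) '' cell d r ∧ φ.prob y₀ z < a})) := by gcongr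
        _ = 6 * hvol d G + (12 * hvol d {z | z ∈ mobiusAdd p '' cell d r ∧ φ.prob x₀ z < a} +
            12 * hvol d {z | z ∈ mobiusAdd (antipode p) '' cell d r ∧ φ.prob y₀ z < a}) / 2 := by
          rw [← mul_add 12, mul_add 6, ENNReal.mul_div_right_comm,
            show (12 : ℝ≥0∞) / 2 = 6 by
              rw [show (12 : ℝ≥0∞) = 6 * 2 by norm_num,
                ENNReal.mul_div_cancel_right (by norm_num) (by norm_num)]]
        _ ≤ 6 * hvol d G + (hvol d (cell d r) + hvol d (cell d r)) / 2 := by gcongr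
        _ = 6 * hvol d G + hvol d (cell d r) := by
          rw [ENNReal.add_div, ENNReal.add_halves]
    rw [two_mul] at h4
    refine ENNReal.div_le_of_le_mul' ?_
    exact (ENNReal.add_le_add_iff_right hfin).1 h4
  calc a * a * (hvol d (cell d r) / 6) ≤ a * a * hvol d G := by gcongr
    _ = ∫⁻ _ in G, a * a ∂(hvol d) := by rw [setLIntegral_const]
    _ ≤ ∫⁻ z in G, φ.prob x z * φ.prob z y ∂(hvol d) :=
        setLIntegral_mono (hmx.mul hmy) fun z hz => mul_le_mul' hz.2.1 hz.2.2
    _ ≤ ∫⁻ z in A, φ.prob x z * φ.prob z y ∂(hvol d) := lintegral_mono_set fun z hz => hz.1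

end ConnectionFunction

end HypRCM

end

noncomputable section

namespace HypRCM

variable {d : ℕ}

/-! ### The skeleton of a free semigroup of translations -/

namespace AxisPair

variable (Q : AxisPair d) (k : ℕ)

lemma isMotion_trans (i : Bool) : IsMotion (Q.trans i) := isMotion_mobiusAdd _

/-- The motion taking the cell at the origin to the cell of the parent of `v`. -/
def base (v : List Bool × Bool × Fin (k + 1)) : HSpace d → HSpace d :=
  wordMap (Q.gen k) v.1 ∘ (Q.trans v.2.1)^[2 * v.2.2]

lemma isMotion_base (v : List Bool × Bool × Fin (k + 1)) : IsMotion (Q.base k v) :=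
  (IsMotion.wordMap (fun i => (Q.isMotion_trans i).iterate _) v.1).comp
    ((Q.isMotion_trans v.2.1).iterate _)

/-- The motion taking the cell at the origin to the region of the connecting vertex of `v`. -/
def linkMotion (v : List Bool × Bool × Fin (k + 1)) : HSpace d → HSpace d :=
  Q.base k v ∘ Q.trans v.2.1

/-- The motion taking the cell at the origin to the region of the representative of `v`. -/
def repMotion (v : List Bool × Bool × Fin (k + 1)) : HSpace d → HSpace d :=
  Q.base k v ∘ Q.trans v.2.1 ∘ Q.trans v.2.1

lemma isMotion_linkMotion (v : List Bool × Bool × Fin (k + 1)) : IsMotion (Q.linkMotion k v) :=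
  (Q.isMotion_base k v).comp (Q.isMotion_trans _)

lemma isMotion_repMotion (v : List Bool × Bool × Fin (k + 1)) : IsMotion (Q.repMotion k v) :=
  (Q.isMotion_base k v).comp ((Q.isMotion_trans _).comp (Q.isMotion_trans _))

/-- The word and the piece of the region of the connecting vertex of `v`. -/
def linkIndex (v : List Bool × Bool × Fin (k + 1)) :
    List Bool × Option (Bool × Fin (2 * k + 1)) :=
  (v.1, some (v.2.1, ⟨2 * v.2.2, by omega⟩))

/-- The word and the piece of the region of the representative of `v`. -/
def repIndex (v : List Bool × Bool × Fin (k + 1)) :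
    List Bool × Option (Bool × Fin (2 * k + 1)) :=
  if h : (v.2.2 : ℕ) < k then (v.1, some (v.2.1, ⟨2 * v.2.2 + 1, by omega⟩))
  else (v.2.1 :: v.1, none)

lemma image_linkMotion (r : ℝ) (v : List Bool × Bool × Fin (k + 1)) :
    Q.linkMotion k v '' cell d r = wordMap (Q.gen k) (linkIndex k v).1 ''
      Q.piece k r (linkIndex k v).2 := by
  rw [linkIndex, piece, ← Set.image_comp]
  rfl

lemma image_repMotion (r : ℝ) (v : List Bool × Bool × Fin (k + 1)) :
    Q.repMotion k v '' cell d r = wordMap (Q.gen k) (repIndex k v).1 ''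
      Q.piece k r (repIndex k v).2 := by
  rw [repIndex]
  split_ifs with h
  · rw [piece, ← Set.image_comp]
    rfl
  -- For j = k the translations add up to 2k + 2, a full generator, and the region is the base cell
  -- of the longer word.
  · obtain ⟨σ, i, j, hj⟩ := v
    obtain rfl : j = k := by simp only at h; omega
    rfl

lemma linkIndex_injective : Function.Injective (linkIndex k) := by
  rintro ⟨σ, i, j, hj⟩ ⟨σ', i', j', hj'⟩ h
  simp only [linkIndex, Prod.mk.injEq, Option.some.injEq, Fin.mk.injEq] at h ⊢
  exact ⟨h.1, h.2.1, by omega⟩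

lemma repIndex_injective : Function.Injective (repIndex k) := by
  rintro ⟨σ, i, j, hj⟩ ⟨σ', i', j', hj'⟩ h
  simp only [repIndex] at h
  split_ifs at h with h1 h2 h2
  · simp only [Prod.mk.injEq, Option.some.injEq, Fin.mk.injEq] at h ⊢
    exact ⟨h.1, h.2.1, by omega⟩
  · simp at h
  · simp at h
  · simp only [Prod.mk.injEq, List.cons.injEq, Fin.mk.injEq] at h ⊢
    exact ⟨h.1.2, h.1.1, by omega⟩

lemma repIndex_ne_linkIndex (v w : List Bool × Bool × Fin (k + 1)) :
    repIndex k v ≠ linkIndex k w := by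
  intro h
  rw [repIndex, linkIndex] at h
  split_ifs at h with h1
  · simp only [Prod.mk.injEq, Option.some.injEq, Fin.mk.injEq] at h
    omega
  · simp at h

lemma repIndex_ne_nil (v : List Bool × Bool × Fin (k + 1)) : repIndex k v ≠ ([], none) := by
  intro h
  rw [repIndex] at h
  split_ifs at h <;> simp at h

lemma base_eq_repMotion {v u : List Bool × Bool × Fin (k + 1)} (h : treePar v = some u) :
    Q.base k v = Q.repMotion k u := by
  obtain ⟨σ, i, j, hj⟩ := v
  cases j with
  | zero =>
    cases σ with
    | nil => simp [treePar, nodeEnd] at h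
    | cons i' σ =>
      simp only [treePar, nodeEnd, Option.some.injEq] at h
      subst h
      rfl
  | succ j =>
    simp only [treePar, Option.some.injEq] at h
    subst h
    rfl

lemma base_eq_id {v : List Bool × Bool × Fin (k + 1)} (h : treePar v = none) :
    Q.base k v = id := by
  obtain ⟨σ, i, j, hj⟩ := v
  cases j with
  | zero =>
    cases σ with
    | nil => rfl
    | cons i' σ => simp [treePar, nodeEnd] at h
  | succ j => simp [treePar] at h

end AxisPair

lemma hvol_cell_lt_top {r : ℝ} (hr : r < 1) : hvol d (cell d r) < ⊤ := by
  refine (hvol_le_mul_volume_image (measurableSet_cell r) hr fun y hy => le_of_lt hy).trans_lt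
    (ENNReal.mul_lt_top ENNReal.ofReal_lt_top ?_)
  refine (measure_mono ?_).trans_lt (measure_ball_lt_top (x := (0 : EuclideanSpace ℝ (Fin d)))
    (r := 1))
  rintro _ ⟨y, _, rfl⟩
  exact y.2

/-- The radius is chosen small for three reasons: good connection at both density points and their
antipodes, disjointness of the pieces, and the bound on the number of shells met. Distinct indices
in the free semigroup then give disjoint regions, and `two_step_le` gives the uniform intensity of
links. -/
lemma exists_skeleton (hd : 2 ≤ d) (φ : ConnectionFunction d) (h : 0 < φ.mass) :
    ∃ (k : ℕ) (K : Skeleton φ (List Bool × Bool × Fin (k + 1))),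
      (∀ v, K.par v = treePar v) ∧ K.bound ≠ 0 := by
  obtain ⟨a, ha, ha1, Q, hQ⟩ := φ.exists_axisPair hd h
  obtain ⟨δ, hδ, k, hk⟩ := Q.exists_disjoint_pieces
  have hev : ∀ᶠ r in nhdsWithin (0 : ℝ) (Set.Ioi 0), (∀ i, φ.GoodAt a r (Q.pt i) ∧
      φ.GoodAt a r (antipode (Q.pt i))) ∧ r < min δ (1 / 10) ∧ 0 < r := by
    refine Filter.Eventually.and (Filter.eventually_all.2 fun i => ?_) (Filter.Eventually.and ?_ ?_)
    · refine ((hQ i).eventually_goodAt φ (by omega)).and ?_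
      exact ConnectionFunction.IsDensityPoint.eventually_goodAt φ (by omega) (hQ i).neg
    · exact nhdsWithin_le_nhds (gt_mem_nhds (lt_min hδ (by norm_num)))
    · exact self_mem_nhdsWithin
  obtain ⟨r, hgood, hrlt, hr0⟩ := hev.exists
  obtain ⟨hrδ, hr10⟩ := lt_min_iff.1 hrlt
  have hdisj := hk r hr0 hrδ.le
  have hfin : hvol d (cell d r) ≠ ⊤ := (hvol_cell_lt_top (by linarith)).ne
  have hB := fun v => exists_shell_le hr0 hr10.le (Q.isMotion_repMotion k v)
  have hC := fun v => exists_shell_le hr0 hr10.le (Q.isMotion_linkMotion k v)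
  choose nB hnB using hB
  choose nC hnC using hC
  have hbound : ∀ A : Set (HSpace d), hvol d (cell d r) ≤ 3 * hvol d A →
      a * a * (hvol d (cell d r) / 6) ≤ hvol d A := by
    intro A hA
    calc a * a * (hvol d (cell d r) / 6) ≤ 1 * 1 * (hvol d (cell d r) / 3) := by
          gcongr; norm_num
      _ = hvol d (cell d r) / 3 := by rw [one_mul, one_mul]
      _ ≤ hvol d A := ENNReal.div_le_of_le_mul' hA
  refine ⟨k, {
    par := treePar
    par_ne := treePar_ne
    B := fun v => Q.repMotion k v '' cell d r
    C := fun v => Q.linkMotion k v '' cell d r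
    nB := nB
    nC := nC
    measB := fun v => (Q.isMotion_repMotion k v).measurableSet_image (measurableSet_cell r)
    measC := fun v => (Q.isMotion_linkMotion k v).measurableSet_image (measurableSet_cell r)
    disjB := ?_
    disjC := ?_
    disjBC := ?_
    origin_notMem := ?_
    ctr := fun v => Q.repMotion k v (origin d)
    ctr_mem := fun v => ⟨_, origin_mem_cell hr0, rfl⟩
    bound := a * a * (hvol d (cell d r) / 6)
    le_B := fun v => hbound _ (hnB v)
    le_C := ?_ }, fun v => rfl, ?_⟩
  · intro v w hvw
    simp only [AxisPair.image_repMotion]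
    exact hdisj _ _ _ _ fun heq => hvw (AxisPair.repIndex_injective k heq)
  · intro v w hvw
    simp only [AxisPair.image_linkMotion]
    exact hdisj _ _ _ _ fun heq => hvw (AxisPair.linkIndex_injective k heq)
  · intro v w
    simp only [AxisPair.image_repMotion, AxisPair.image_linkMotion]
    exact hdisj _ _ _ _ (AxisPair.repIndex_ne_linkIndex k v w)
  · intro v hv
    rw [AxisPair.image_repMotion] at hv
    refine Set.disjoint_left.1 (hdisj _ [] _ none (AxisPair.repIndex_ne_nil k v)) hv ?_
    exact ⟨origin d, origin_mem_cell hr0, rfl⟩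
  · intro v x y hx1 hx2 hy
    refine φ.two_step_le (hgood v.2.1).1 (hgood v.2.1).2 hfin (Q.isMotion_base k v) ?_ hy (hnC v)
    cases hpar : treePar v with
    | none =>
      rw [hx2 hpar, Q.base_eq_id k hpar]
      exact ⟨origin d, origin_mem_cell hr0, rfl⟩
    | some u =>
      rw [Q.base_eq_repMotion k hpar]
      exact hx1 u hpar
  · have h1 := hvol_pos_of_isOpen (isOpen_cell (d := d) r) ⟨_, origin_mem_cell hr0⟩
    simp only [ne_eq, mul_eq_zero, ha.ne', or_self, false_or, ENNReal.div_eq_zero_iff, h1.ne']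
    norm_num

/-! ### The critical intensities -/

lemma exists_supercritical (hd : 2 ≤ d) (φ : ConnectionFunction d) (h : 0 < φ.mass) :
    ∃ lam : ℝ≥0, 0 < lam ∧ chi φ lam = ⊤ ∧ 0 < theta φ lam := by
  obtain ⟨k, K, hpar, hb⟩ := exists_skeleton hd φ h
  exact K.exists_chi_eq_top_and_theta_pos (by omega) hpar hb

end HypRCM

/-- The infimum of a set of intensities is positive if the intensities `lam` with
`lam * m < 1` are excluded, for some finite `m`. -/
lemma iInf_pos_of_mul_lt_one {p : ℝ≥0 → Prop} {m : ℝ≥0∞} (hm : m < ⊤)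
    (h : ∀ lam : ℝ≥0, lam * m < 1 → ¬ p lam) :
    0 < ⨅ (lam : ℝ≥0) (_ : 0 < lam ∧ p lam), (lam : ℝ≥0∞) := by
  refine lt_of_lt_of_le (ENNReal.inv_pos.2 hm.ne) (le_iInf₂ fun lam hlam => ?_)
  by_contra hc
  push Not at hc
  refine h lam ?_ hlam.2
  rcases eq_or_ne m 0 with rfl | h0
  · simp
  · calc (lam : ℝ≥0∞) * m < m⁻¹ * m := (ENNReal.mul_lt_mul_iff_left h0 hm.ne).2 hc
      _ = 1 := ENNReal.inv_mul_cancel h0 hm.ne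

lemma iInf_eq_zero_of_forall {p : ℝ≥0 → Prop} (h : ∀ lam : ℝ≥0, 0 < lam → p lam) :
    ⨅ (lam : ℝ≥0) (_ : 0 < lam ∧ p lam), (lam : ℝ≥0∞) = 0 := by
  refine le_antisymm (le_of_forall_gt fun c hc => ?_) zero_le
  obtain ⟨lam, hlam0, hlam⟩ := ENNReal.lt_iff_exists_nnreal_btwn.1 hc
  have h0 : 0 < lam := by exact_mod_cast hlam0
  exact (iInf₂_le lam ⟨h0, h lam h0⟩).trans_lt hlam

lemma iInf_lt_top_iff {p : ℝ≥0 → Prop} :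
    ⨅ (lam : ℝ≥0) (_ : 0 < lam ∧ p lam), (lam : ℝ≥0∞) < ⊤ ↔ ∃ lam : ℝ≥0, 0 < lam ∧ p lam := by
  simp [iInf_lt_iff]

end

theorem proposition1p1 (d : ℕ) (hd : 2 ≤ d) (φ : HypRCM.ConnectionFunction d) :
    ((HypRCM.lambdaT φ < ⊤ ↔ 0 < φ.mass) ∧ (HypRCM.lambdaC φ < ⊤ ↔ 0 < φ.mass)) ∧
    ((0 < HypRCM.lambdaT φ ↔ φ.mass < ⊤) ∧ (0 < HypRCM.lambdaC φ ↔ φ.mass < ⊤)) := by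
  have hd1 : 1 ≤ d := by omega
  have hT : ∀ lam : ℝ≥0, lam * φ.mass < 1 → ¬ HypRCM.chi φ lam = ⊤ := fun lam h =>
    (HypRCM.chi_lt_top_of_mul_mass_lt_one hd1 φ h).ne
  have hC : ∀ lam : ℝ≥0, lam * φ.mass < 1 → ¬ 0 < HypRCM.theta φ lam := fun lam h =>
    (HypRCM.theta_eq_zero_of_mul_mass_lt_one hd1 φ h).not_gt
  have hpos : ∀ p : ℝ≥0 → Prop, (∀ lam : ℝ≥0, lam * φ.mass < 1 → ¬ p lam) →
      (∃ lam, 0 < lam ∧ p lam) → 0 < φ.mass := by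
    rintro p hp ⟨lam, _, hlam⟩
    rw [pos_iff_ne_zero]
    intro h0
    -- With mass zero every intensity satisfies the subcritical condition lam · m < 1.
    exact hp lam (by rw [h0]; simp) hlam
  rw [HypRCM.lambdaT, HypRCM.lambdaC]
  refine ⟨⟨iInf_lt_top_iff.trans ⟨hpos _ hT, fun h => ?_⟩,
    iInf_lt_top_iff.trans ⟨hpos _ hC, fun h => ?_⟩⟩,
    ⟨fun h => ?_, fun h => iInf_pos_of_mul_lt_one h hT⟩,
    ⟨fun h => ?_, fun h => iInf_pos_of_mul_lt_one h hC⟩⟩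
  · obtain ⟨lam, h0, h1, _⟩ := HypRCM.exists_supercritical hd φ h
    exact ⟨lam, h0, h1⟩
  · obtain ⟨lam, h0, _, h1⟩ := HypRCM.exists_supercritical hd φ h
    exact ⟨lam, h0, h1⟩
  · by_contra hc
    rw [not_lt, top_le_iff] at hc
    exact h.ne' (iInf_eq_zero_of_forall fun lam hlam =>
      (HypRCM.chi_eq_top_and_theta_pos_of_mass_eq_top hd1 φ hc hlam).1)
  · by_contra hc
    rw [not_lt, top_le_iff] at hc
    exact h.ne' (iInf_eq_zero_of_forall fun lam hlam =>
      (HypRCM.chi_eq_top_and_theta_pos_of_mass_eq_top hd1 φ hc hlam).2)
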